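/- Let $\mathbb T^3=(\mathbb R/2\pi\mathbb Z)^3$, let $\gamma,\alpha>0$, and let $f\in C^1(\mathbb R)$ satisfy, for some positive constants $C,\kappa,K$ and all $s\in\mathbb R$, $$f(s)s\ge -C+\kappa|s|^2,\qquad f'(s)\ge -K,\qquad |f'(s)|\le C(1+|s|^4).$$ For $w=\sum_{k\in\mathbb Z^3}w_ke^{ik\cdot x}$ put $\|w\|_{H^s}^2=(2\pi)^3\sum_k(1+|k|^2)^s|w_k|^2$ and $(-\Delta)^{\theta}w=\sum_k|k|^{2\theta}w_ke^{ik\cdot x}$, and let $\mathcal E=H^1(\mathbb T^3)\times L^2(\mathbb T^3)$, with norm $\|(w,z)\|_{\mathcal E}^2=\|w\|_{H^1}^2+\|z\|_{L^2}^2$. Given $g\in L^2(\mathbb T^3)$, $T>0$ and $(u_0,u_1)\in\mathcal E$, a weak energy solution on $[0,T]$ of $$\partial_t^2u+\gamma(-\Delta)^{1/2}\partial_tu+\alpha\,\partial_tu-\Delta u+f(u)=g,\qquad u|_{t=0}=u_0,\quad \partial_tu|_{t=0}=u_1, \tag{1}$$ is a function $u$ such that $\xi_u:=(u,\partial_tu)\in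 L^\infty(0,T;\mathcal E)$ (with $\partial_tu$ the distributional time derivative), $\partial_tu\in L^2(0,T;H^{1/2}(\mathbb T^3))$, the initial conditions hold (for the representatives of $u$ and $\partial_tu$ that are continuous in time with values in $L^2$ and $H^{-1}$, respectively), and for every $\phi\in C_0^\infty((0,T)\times\mathbb T^3)$ $$-\int_0^T(\partial_tu,\partial_t\phi)\,dt+\int_0^T(\nabla u,\nabla\phi)\,dt+\alpha\int_0^T(\partial_tu,\phi)\,dt+\gamma\int_0^T(\partial_tu,(-\Delta)^{1/2}\phi)\,dt+\int_0^T(f(u),\phi)\,dt=\int_0^T(g,\phi)\,dt,$$ where $(\cdot,\cdot)$ is the inner product of $L^2(\mathbb T^3)$. Then there is a monotone increasing function $Q:[0,\infty)\to[0,\infty)$, depending only on $\gamma,\alpha$ and $f$, such that for all $g$, $T$, $(u_0,u_1)$ as above every weak energy solution $u$ of (1) on $[0,T]$ belongs to $L^2(0,T;H^{3/2}(\mathbb T^3))$ and satisfies, for every $\tau\ge0$ with $\tau+1\le T$, $$\|u\|_{L^2([\tau,\tau+1],H^{3/2})}\le Q\Big(\|\xi_u\|_{L^\infty([\tau,\tau+1],\mathcal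 E)}+\|\partial_tu\|_{L^2([\tau,\tau+1],H^{1/2})}+\|g\|_{L^2}\Big).$$ -/

import Mathlib

open MeasureTheory Filter Topology
open scoped ENNReal NNReal ContDiff

noncomputable section

namespace QuinticWave

/-- `2π > 0`, needed for the Haar measure of the circle `ℝ / 2πℤ`. -/
instance factTwoPiPos : Fact (0 < 2 * Real.pi) := ⟨Real.two_pi_pos⟩

/-- The torus `𝕋³ = (ℝ / 2πℤ)³`; its `volume` is Lebesgue measure, of total mass `(2π)³`. -/
abbrev Torus : Type := Fin 3 → AddCircle (2 * Real.pi)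

/-- The real Hilbert space `L²(𝕋³)`. -/
abbrev L2 : Type := Lp ℝ 2 (volume : Measure Torus)

/-- The projection `ℝ³ → 𝕋³`. -/
def proj (y : Fin 3 → ℝ) : Torus := fun i => (y i : AddCircle (2 * Real.pi))

/-- `|k|²` for `k ∈ ℤ³`: the eigenvalue of `-Δ` on `𝕋³` at the eigenfunction `e^{ik·x}`. -/
def eig (k : Fin 3 → ℤ) : ℝ := ∑ i, (k i : ℝ) ^ 2

/-- The exponential `x ↦ e^{ik·x}` on `𝕋³`. -/
def expo (k : Fin 3 → ℤ) (x : Torus) : ℂ := ∏ i, fourier (k i) (x i)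

/-- The Fourier coefficient `w_k = (2π)⁻³ ∫ w(x) e^{-ik·x} dx`. -/
def coeff (w : Torus → ℝ) (k : Fin 3 → ℤ) : ℂ :=
  ((2 * (Real.pi : ℂ)) ^ 3)⁻¹ * ∫ x : Torus, (w x : ℂ) * expo (-k) x

/-- The norm of `H^s(𝕋³)`, `‖w‖² = (2π)³ ∑ₖ (1 + |k|²)^s |w_k|²`, with value `∞` when
`w ∈ L²(𝕋³)` is not in `H^s(𝕋³)`. -/
def sobNorm (s : ℝ) (w : L2) : ℝ≥0∞ :=
  (ENNReal.ofReal ((2 * Real.pi) ^ 3) *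
    ∑' k : Fin 3 → ℤ, ENNReal.ofReal ((1 + eig k) ^ s * ‖coeff w k‖ ^ 2)) ^ (1 / 2 : ℝ)

/-- The fractional Laplacian `(-Δ)^θ ψ = ∑ₖ |k|^{2θ} ψ_k e^{ik·x}` of a smooth real function
(the sum is real, since `ψ` is). -/
def fracLap (θ : ℝ) (ψ : Torus → ℝ) (x : Torus) : ℝ :=
  (∑' k : Fin 3 → ℤ, ((eig k ^ θ : ℝ) : ℂ) * coeff ψ k * expo k x).re

/-- The classical partial derivative `∂ᵢψ` of a function on the torus. -/
def partialDeriv (i : Fin 3) (ψ : Torus → ℝ) (x : Torus) : ℝ :=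
  deriv (fun s : ℝ => ψ (x + proj (Pi.single i s))) 0

/-- `ψ ∈ C^∞(𝕋³)`. -/
def SmoothOnTorus (ψ : Torus → ℝ) : Prop :=
  ContDiff ℝ ∞ (fun y : Fin 3 → ℝ => ψ (proj y))

/-- `G ∈ L²` is the weak derivative `∂ᵢw` of `w ∈ L²`. -/
def IsWeakPartial (i : Fin 3) (w G : L2) : Prop :=
  ∀ ψ : Torus → ℝ, SmoothOnTorus ψ →
    ∫ x : Torus, w x * partialDeriv i ψ x = -∫ x : Torus, G x * ψ x

open Classical in
/-- The weak derivative `∂ᵢw`. It is unique when it exists in `L²`, which it does for every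
`w ∈ H¹(𝕋³)`. -/
def weakPartial (i : Fin 3) (w : L2) : L2 :=
  if h : ∃ G : L2, IsWeakPartial i w G then h.choose else 0

/-- `φ ∈ C₀^∞((0,T) × 𝕋³)`. Being boundaryless, the torus puts no support condition in `x`. -/
structure IsTestFunction (T : ℝ) (φ : ℝ → Torus → ℝ) : Prop where
  smooth : ContDiff ℝ ∞ (fun p : ℝ × (Fin 3 → ℝ) => φ p.1 (proj p.2))
  supp : ∃ a b : ℝ, 0 < a ∧ b < T ∧ ∀ t, t ∉ Set.Icc a b → ∀ x, φ t x = 0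

/-- The time derivative `∂ₜφ`. -/
def timeDeriv (φ : ℝ → Torus → ℝ) (t : ℝ) (x : Torus) : ℝ := deriv (fun s => φ s x) t

/-- The norm of `(w, z)` in the energy space `𝓔 = H¹(𝕋³) × L²(𝕋³)`. -/
def energyNorm (w z : L2) : ℝ≥0∞ := (sobNorm 1 w ^ 2 + ‖z‖ₑ ^ 2) ^ (1 / 2 : ℝ)

/-- The norm of `(u, v)` in `L^∞(a, b; 𝓔)`. -/
def normLinftyEnergy (a b : ℝ) (u v : ℝ → L2) : ℝ≥0∞ :=
  essSup (fun t => energyNorm (u t) (v t)) (volume.restrict (Set.Ioo a b))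

/-- The norm of `u` in `L²(a, b; H^s(𝕋³))`. -/
def normL2Sob (s a b : ℝ) (u : ℝ → L2) : ℝ≥0∞ :=
  (∫⁻ t in Set.Ioo a b, sobNorm s (u t) ^ 2) ^ (1 / 2 : ℝ)

/-- `u ∈ L²(a, b; H^s(𝕋³))`, for `s ≥ 0`. -/
def MemL2Sob (s a b : ℝ) (u : ℝ → L2) : Prop :=
  AEStronglyMeasurable u (volume.restrict (Set.Ioo a b)) ∧ normL2Sob s a b u < ⊤

/-- `f ∈ C¹(ℝ)` satisfies the growth and dissipativity assumptions with constants `C`, `κ`, `K`. -/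
structure Nonlinearity (C κ K : ℝ) (f : ℝ → ℝ) : Prop where
  contDiff : ContDiff ℝ 1 f
  dissipative : ∀ s, -C + κ * |s| ^ 2 ≤ f s * s
  deriv_ge : ∀ s, -K ≤ deriv f s
  growth : ∀ s, |deriv f s| ≤ C * (1 + |s| ^ 4)

/-- The pair `ξ_u = (u, v)`, `v = ∂ₜu`, is a weak energy solution on `(0, T) × 𝕋³` of
`∂ₜ²u + γ(-Δ)^{1/2}∂ₜu + α∂ₜu - Δu + f(u) = g`, `u|_{t=0} = u₀`, `∂ₜu|_{t=0} = u₁`.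
A solution on `[0, ∞)` is one that is a solution on `(0, T)` for every `T > 0`. -/
structure IsWeakEnergySolution (γ α : ℝ) (f : ℝ → ℝ) (g : L2) (T : ℝ) (u₀ u₁ : L2)
    (u v : ℝ → L2) : Prop where
  measurable_u : AEStronglyMeasurable u (volume.restrict (Set.Ioo 0 T))
  measurable_v : AEStronglyMeasurable v (volume.restrict (Set.Ioo 0 T))
  /-- `ξ_u ∈ L^∞(0, T; 𝓔)`. -/
  energy : normLinftyEnergy 0 T u v < ⊤
  /-- `∂ₜu ∈ L²(0, T; H^{1/2})`. -/
  dissipation : MemL2Sob (1 / 2) 0 T v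
  /-- `v = ∂ₜu` in the sense of distributions. -/
  time_deriv : ∀ φ : ℝ → Torus → ℝ, IsTestFunction T φ →
    ∫ t in Set.Ioo 0 T, ∫ x : Torus, u t x * timeDeriv φ t x =
      -∫ t in Set.Ioo 0 T, ∫ x : Torus, v t x * φ t x
  /-- The initial data belong to `𝓔`. -/
  initial_energy : energyNorm u₀ u₁ < ⊤
  /-- `u(0) = u₀` for the representative of `u` that is continuous with values in `L²`. -/
  initial_u : Tendsto (fun t => ‖u t - u₀‖) (𝓝[>] (0 : ℝ) ⊓ ae volume) (𝓝 0)
  /-- `∂ₜu(0) = u₁` for the representative of `∂ₜu` that is continuous with values in `H⁻¹`. -/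
  initial_v : Tendsto (fun t => sobNorm (-1) (v t - u₁)) (𝓝[>] (0 : ℝ) ⊓ ae volume) (𝓝 0)
  /-- The equation holds in the sense of distributions. -/
  equation : ∀ φ : ℝ → Torus → ℝ, IsTestFunction T φ →
    -(∫ t in Set.Ioo 0 T, ∫ x : Torus, v t x * timeDeriv φ t x)
      + (∫ t in Set.Ioo 0 T, ∑ i, ∫ x : Torus, weakPartial i (u t) x * partialDeriv i (φ t) x)
      + α * (∫ t in Set.Ioo 0 T, ∫ x : Torus, v t x * φ t x)
      + γ * (∫ t in Set.Ioo 0 T, ∫ x : Torus, v t x * fracLap (1 / 2) (φ t) x)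
      + (∫ t in Set.Ioo 0 T, ∫ x : Torus, f (u t x) * φ t x)
      = ∫ t in Set.Ioo 0 T, ∫ x : Torus, g x * φ t x

end QuinticWave

end

noncomputable section

namespace QuinticWave

open scoped ComplexConjugate

/-! ### Characters of the torus and their orthogonality -/

section Exponentials

/-! Formally, the equation is tested with $|D|u$, where $|D|=(-\Delta)^{1/2}$. The term $(-\Delta
u,|D|u)$ is the homogeneous $H^{3/2}$ norm squared. Integrating in time, $(\partial_t^2u,|D|u)$
becomes the boundary term $(\partial_tu,|D|u)$, controlled by the energy, minus
$\int\||D|^{1/2}\partial_tu\|^2$, controlled by the $L^2H^{1/2}$ norm of $\partial_tu$. The damping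
terms are exact time derivatives of quantities of order at most $\|u\|_{H^1}^2$, and the source
pairs with $|D|u\in L^2$.

The nonlinear term is critical: $f(u)$ lies only in $L^{6/5}$, and $|D|u$ is not in the dual space
$L^6$. What saves it is a sign. Since $f'\ge-K$, the function $h(s)=f(s)+Ks$ is monotone, and for
each translation $y$ a change of variables gives $$\int
h(u)\Big(u-\tfrac12\big(u(\cdot+y)+u(\cdot-y)\big)\Big)=\tfrac12\int\big(h(u(x))-h(u(x+y))\big)\big(u(x)-u(x+y)\big)\,dx\ge0$$
(`integral_comp_mul_secondDiff_nonneg`). So $|D|$ is replaced by a finite positive combination of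
such second differences, along the axes at the scales $2^{-j}$, $j<n$, with weights $2^j$. Its
Fourier multiplier `mult` is at most $18|k|$ for every $n$ (`mult_le`) and at least $|k|/6$ as soon
as $n$ exceeds all $|k_i|$ (`le_mult`). For fixed $n$ this operator is bounded on $H^1\subset L^6$,
so the pairing with $h(u)\in L^{6/5}$ makes sense.

To make the test rigorous for weak solutions, everything is done mode by mode. Each Fourier
coefficient obeys a scalar equation in time, whose energy identity holds between almost all pairs of
times (`coeff_identity`). The identities are weighted by `mult` and summed over a finite set of
frequencies. The linear terms are bounded uniformly, while the nonlinear sum converges, as the set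
grows, to a nonnegative limit (`tendsto_nonlinear`). This yields `sum_mult_le`; choosing $n$ large
for a given finite set of frequencies then recovers the weight $|k|^3$, and monotone convergence
finishes. -/

theorem expo_neg (k : Fin 3 → ℤ) (x : Torus) : expo (-k) x = conj (expo k x) := by
  simp only [expo, Pi.neg_apply, fourier_neg, map_prod]

theorem expo_add (k l : Fin 3 → ℤ) (x : Torus) : expo (k + l) x = expo k x * expo l x := by
  simp only [expo, Pi.add_apply, fourier_add, ← Finset.prod_mul_distrib]

theorem expo_zero (x : Torus) : expo 0 x = 1 := by simp [expo]

theorem norm_expo (k : Fin 3 → ℤ) (x : Torus) : ‖expo k x‖ = 1 := by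
  rw [expo, norm_prod]
  refine Finset.prod_eq_one fun i _ => ?_
  rw [fourier_apply]
  exact Circle.norm_coe _

theorem continuous_expo (k : Fin 3 → ℤ) : Continuous (expo k) := by
  unfold expo; fun_prop

theorem expo_add_arg (k : Fin 3 → ℤ) (x y : Torus) :
    expo k (x + y) = expo k x * expo k y := by
  simp only [expo, Pi.add_apply, fourier_apply, smul_add, AddCircle.toCircle_add, Circle.coe_mul,
    ← Finset.prod_mul_distrib]

theorem expo_proj (k : Fin 3 → ℤ) (y : Fin 3 → ℝ) :
    expo k (proj y) = Complex.exp (Complex.I * ((∑ i, (k i : ℝ) * y i : ℝ) : ℂ)) := by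
  have hpi : (Real.pi : ℂ) ≠ 0 := by exact_mod_cast Real.pi_ne_zero
  simp only [expo, proj, fourier_coe_apply, ← Complex.exp_sum]
  congr 1
  push_cast
  rw [Finset.mul_sum]
  refine Finset.sum_congr rfl fun i _ => ?_
  field_simp

theorem expo_neg_arg (k : Fin 3 → ℤ) (x : Torus) : expo k (-x) = conj (expo k x) := by
  rw [← expo_neg]
  simp only [expo, Pi.neg_apply, fourier_apply, smul_neg, neg_smul]

/-- The exponential `e^{ik·x}` as a continuous map. -/
def expoC (k : Fin 3 → ℤ) : C(Torus, ℂ) := ⟨expo k, continuous_expo k⟩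

@[simp] theorem expoC_apply (k : Fin 3 → ℤ) (x : Torus) : expoC k x = expo k x := rfl

/-- The total mass `(2π)³` of the torus. -/
def vol : ℝ := (2 * Real.pi) ^ 3

theorem vol_pos : 0 < vol := by unfold vol; positivity

theorem vol_ne_zero : (vol : ℂ) ≠ 0 := by exact_mod_cast vol_pos.ne'

theorem vol_coe : ((2 * (Real.pi : ℂ)) ^ 3) = (vol : ℂ) := by simp [vol]

theorem integral_fourier (n : ℤ) :
    ∫ x : AddCircle (2 * Real.pi), fourier n x = if n = 0 then (2 * Real.pi : ℂ) else 0 := by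
  have h := AddCircle.volume_eq_smul_haarAddCircle (T := 2 * Real.pi)
  rw [h, integral_smul_measure]
  have h2 := (orthonormal_iff_ite.mp (orthonormal_fourier (T := 2 * Real.pi))) 0 n
  rw [ContinuousMap.inner_toLp] at h2
  have h3 : (fun x : AddCircle (2 * Real.pi) =>
      (fourier n x : ℂ) * conj (fourier 0 x)) = fun x => (fourier n x : ℂ) := by
    ext x; simp
  rw [h3] at h2
  rw [h2, ENNReal.toReal_ofReal Real.two_pi_pos.le]
  by_cases hn : n = 0
  · simp [hn]
  · simp [hn, Ne.symm hn]

theorem integral_expo (k : Fin 3 → ℤ) :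
    ∫ x : Torus, expo k x = if k = 0 then (vol : ℂ) else 0 := by
  unfold expo
  rw [MeasureTheory.integral_fintype_prod_volume_eq_prod
    (f := fun i (x : AddCircle (2 * Real.pi)) => (fourier (k i) x : ℂ))]
  simp only [integral_fourier]
  split_ifs with h
  · simp [h, vol]
  · obtain ⟨i, hi⟩ := Function.ne_iff.mp h
    exact Finset.prod_eq_zero (Finset.mem_univ i) (if_neg hi)

end Exponentials

/-! ### Density of trigonometric polynomials -/

section Density

/-- The star algebra of trigonometric polynomials on the torus. -/
def trigAlgebra : StarSubalgebra ℂ C(Torus, ℂ) where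
  toSubalgebra := Algebra.adjoin ℂ (Set.range expoC)
  star_mem' := by
    change Algebra.adjoin ℂ (Set.range expoC) ≤ star (Algebra.adjoin ℂ (Set.range expoC))
    refine Algebra.adjoin_le ?_
    rintro _ ⟨n, rfl⟩
    refine Algebra.subset_adjoin ⟨-n, ?_⟩
    ext1 x
    simp only [expoC_apply, expo_neg, starRingEnd_apply, ContinuousMap.star_apply]

theorem trigAlgebra_coe :
    trigAlgebra.toSubalgebra.toSubmodule = Submodule.span ℂ (Set.range expoC) := by
  apply Algebra.adjoin_eq_span_of_subset
  refine .trans (fun x => Submonoid.closure_induction (fun _ => id) ⟨0, ?_⟩ ?_)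
    Submodule.subset_span
  · ext z; simp [expo_zero]
  · rintro _ _ _ _ ⟨m, rfl⟩ ⟨n, rfl⟩
    refine ⟨m + n, ?_⟩
    ext z
    simp [expo_add]

theorem expo_single (z : Torus) (i : Fin 3) : expo (Pi.single i 1) z = fourier 1 (z i) := by
  unfold expo
  rw [Finset.prod_eq_single i]
  · simp
  · intro j _ hj; simp [Pi.single_eq_of_ne hj]
  · simp

theorem trigAlgebra_separatesPoints : trigAlgebra.SeparatesPoints := by
  intro x y hxy
  obtain ⟨i, hi⟩ := Function.ne_iff.mp hxy
  refine ⟨_, ⟨expoC (Pi.single i 1), Algebra.subset_adjoin ⟨Pi.single i 1, rfl⟩, rfl⟩, ?_⟩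
  simp only [expoC_apply]
  rw [expo_single, expo_single, fourier_one, fourier_one]
  exact fun h => hi (AddCircle.injective_toCircle Real.two_pi_pos.ne' (Circle.ext h))

/-- Stone–Weierstrass. -/
theorem span_expoC_closure_eq_top :
    (Submodule.span ℂ (Set.range expoC)).topologicalClosure = ⊤ := by
  rw [← trigAlgebra_coe]
  exact congr_arg (Subalgebra.toSubmodule <| StarSubalgebra.toSubalgebra ·)
    (ContinuousMap.starSubalgebra_topologicalClosure_eq_top_of_separatesPoints _
      trigAlgebra_separatesPoints)

end Density

/-! ### Fourier basis of complex $L^2$: Parseval and Riesz–Fischer -/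

section Basis

/-- The complex Hilbert space `L²(𝕋³; ℂ)`. -/
abbrev L2C : Type := Lp ℂ 2 (volume : Measure Torus)

/-- The exponential `e^{ik·x}` as an element of `L²`. -/
def expoL (k : Fin 3 → ℤ) : L2C := ContinuousMap.toLp (E := ℂ) 2 volume ℂ (expoC k)

theorem coeFn_expoL (k : Fin 3 → ℤ) : expoL k =ᵐ[volume] expo k :=
  ContinuousMap.coeFn_toLp volume (expoC k)

theorem span_expoL_closure_eq_top :
    (Submodule.span ℂ (Set.range expoL)).topologicalClosure = ⊤ := by
  have := (ContinuousMap.toLp_denseRange ℂ (volume : Measure Torus) ℂ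
    (p := 2) (by simp)).topologicalClosure_map_submodule span_expoC_closure_eq_top
  simp only [Submodule.map_span, ContinuousLinearMap.coe_coe, ← Set.range_comp,
    Function.comp_def] at this
  exact this

theorem inner_expoL (k l : Fin 3 → ℤ) :
    inner ℂ (expoL k) (expoL l) = if k = l then (vol : ℂ) else 0 := by
  unfold expoL
  rw [ContinuousMap.inner_toLp]
  have : ∀ x : Torus, expoC l x * conj (expoC k x) = expo (l - k) x := by
    intro x
    rw [sub_eq_add_neg, expo_add, expo_neg]; rfl
  simp only [this, integral_expo, sub_eq_zero, eq_comm]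

/-- The normalized exponential `(2π)^{-3/2} e^{ik·x}`. -/
def expoN (k : Fin 3 → ℤ) : L2C := ((Real.sqrt vol)⁻¹ : ℂ) • expoL k

theorem orthonormal_expoN : Orthonormal ℂ expoN := by
  rw [orthonormal_iff_ite]
  intro k l
  simp only [expoN, inner_smul_left, inner_smul_right, inner_expoL]
  split_ifs with h
  · have h1 : ((Real.sqrt vol : ℝ) : ℂ) * ((Real.sqrt vol : ℝ) : ℂ) = vol := by
      exact_mod_cast Real.mul_self_sqrt vol_pos.le
    have h2 : ((Real.sqrt vol : ℝ) : ℂ) ≠ 0 := by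
      exact_mod_cast (Real.sqrt_pos.2 vol_pos).ne'
    rw [← h1]
    simp only [map_inv₀, Complex.conj_ofReal]
    field_simp
  · simp

theorem span_expoN_eq : Submodule.span ℂ (Set.range expoN) = Submodule.span ℂ (Set.range expoL) := by
  have h2 : ((Real.sqrt vol : ℝ) : ℂ) ≠ 0 := by
    exact_mod_cast (Real.sqrt_pos.2 vol_pos).ne'
  apply le_antisymm
  · rw [Submodule.span_le]
    rintro _ ⟨k, rfl⟩
    exact Submodule.smul_mem _ _ (Submodule.subset_span ⟨k, rfl⟩)
  · rw [Submodule.span_le]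
    rintro _ ⟨k, rfl⟩
    have : expoL k = (Real.sqrt vol : ℂ) • expoN k := by
      simp [expoN, smul_smul, mul_inv_cancel₀ h2]
    rw [this]
    exact Submodule.smul_mem _ _ (Submodule.subset_span ⟨k, rfl⟩)

/-- The Fourier basis of `L²(𝕋³; ℂ)`. -/
def expoBasis : HilbertBasis (Fin 3 → ℤ) ℂ L2C :=
  HilbertBasis.mk orthonormal_expoN
    (by rw [span_expoN_eq, span_expoL_closure_eq_top])

theorem expoBasis_apply (k : Fin 3 → ℤ) : expoBasis k = expoN k := by
  simp [expoBasis]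

/-- Fourier coefficients of complex-valued functions. -/
def ccoeff (w : Torus → ℂ) (k : Fin 3 → ℤ) : ℂ :=
  (vol : ℂ)⁻¹ * ∫ x : Torus, w x * expo (-k) x

theorem coeff_eq_ccoeff (w : Torus → ℝ) (k : Fin 3 → ℤ) :
    coeff w k = ccoeff (fun x => (w x : ℂ)) k := by
  simp only [coeff, ccoeff, vol_coe]

theorem ccoeff_congr {w z : Torus → ℂ} (h : w =ᵐ[volume] z) (k : Fin 3 → ℤ) :
    ccoeff w k = ccoeff z k := by
  unfold ccoeff
  congr 1
  exact integral_congr_ae (by filter_upwards [h] with x hx; rw [hx])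

theorem inner_expoL_left (W : L2C) (k : Fin 3 → ℤ) :
    inner ℂ (expoL k) W = (vol : ℂ) * ccoeff W k := by
  rw [ccoeff, mul_inv_cancel_left₀ vol_ne_zero, L2.inner_def]
  refine integral_congr_ae ?_
  filter_upwards [coeFn_expoL k] with x hx
  rw [hx, expo_neg]
  simp [RCLike.inner_apply]

theorem inner_expoN_left (W : L2C) (k : Fin 3 → ℤ) :
    inner ℂ (expoN k) W = (Real.sqrt vol : ℂ) * ccoeff W k := by
  have h1 : ((Real.sqrt vol : ℝ) : ℂ) * ((Real.sqrt vol : ℝ) : ℂ) = vol := by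
    exact_mod_cast Real.mul_self_sqrt vol_pos.le
  have h2 : ((Real.sqrt vol : ℝ) : ℂ) ≠ 0 := by
    exact_mod_cast (Real.sqrt_pos.2 vol_pos).ne'
  rw [expoN, inner_smul_left, inner_expoL_left, ← h1]
  simp only [map_inv₀, Complex.conj_ofReal]
  field_simp

/-- Parseval; the factor $(2\pi)^{-3}$ comes from coefficients taken against the exponentials
without normalization. -/
theorem hasSum_conj_ccoeff_mul (W Z : L2C) :
    HasSum (fun k => conj (ccoeff W k) * ccoeff Z k) ((vol : ℂ)⁻¹ * inner ℂ W Z) := by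
  have h := (expoBasis.hasSum_inner_mul_inner W Z).mul_left (vol : ℂ)⁻¹
  refine h.congr_fun fun k => ?_
  have h1 : ((Real.sqrt vol : ℝ) : ℂ) * ((Real.sqrt vol : ℝ) : ℂ) = vol := by
    exact_mod_cast Real.mul_self_sqrt vol_pos.le
  rw [expoBasis_apply, ← inner_conj_symm W, inner_expoN_left, inner_expoN_left, map_mul,
    Complex.conj_ofReal]
  have := vol_ne_zero
  field_simp
  rw [← h1]; ring

/-- Riesz–Fischer; it supplies the weak derivatives of $H^1$ functions below. -/
theorem exists_ccoeff_eq (c : (Fin 3 → ℤ) → ℂ) (hc : Summable fun k => ‖c k‖ ^ 2) :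
    ∃ W : L2C, ∀ k, ccoeff W k = c k := by
  have h2 : ((Real.sqrt vol : ℝ) : ℂ) ≠ 0 := by
    exact_mod_cast (Real.sqrt_pos.2 vol_pos).ne'
  have hm : Memℓp (fun k => (Real.sqrt vol : ℂ) * c k) 2 := by
    apply memℓp_gen
    have := hc.mul_left vol
    refine this.congr fun k => ?_
    simp only [ENNReal.toReal_ofNat, Real.rpow_ofNat, norm_mul, mul_pow]
    rw [Complex.norm_real, Real.norm_of_nonneg (Real.sqrt_nonneg _), Real.sq_sqrt vol_pos.le]
  refine ⟨expoBasis.repr.symm ⟨_, hm⟩, fun k => ?_⟩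
  have h := expoBasis.repr_apply_apply (expoBasis.repr.symm ⟨_, hm⟩) k
  rw [LinearIsometryEquiv.apply_symm_apply, expoBasis_apply, inner_expoN_left] at h
  exact (mul_left_cancel₀ h2 h).symm

/-- Partial Fourier sums. -/
def partialSum (c : (Fin 3 → ℤ) → ℂ) (S : Finset (Fin 3 → ℤ)) (x : Torus) : ℂ :=
  ∑ k ∈ S, c k * expo k x

theorem continuous_partialSum (c : (Fin 3 → ℤ) → ℂ) (S : Finset (Fin 3 → ℤ)) :
    Continuous (partialSum c S) := by
  unfold partialSum
  exact continuous_finsetSum _ fun k _ => continuous_const.mul (continuous_expo k)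

theorem coeFn_sum_expoL (c : (Fin 3 → ℤ) → ℂ) (S : Finset (Fin 3 → ℤ)) :
    (∑ k ∈ S, c k • expoL k : L2C) =ᵐ[volume] partialSum c S := by
  have : (∑ k ∈ S, c k • expoL k : L2C)
      = ContinuousMap.toLp (E := ℂ) 2 volume ℂ (∑ k ∈ S, c k • expoC k) := by
    rw [map_sum]
    simp only [map_smul, expoL]
  rw [this]
  refine (ContinuousMap.coeFn_toLp volume _).trans (Eventually.of_forall fun x => ?_)
  simp [partialSum]

theorem hasSum_expoL (W : L2C) : HasSum (fun k => ccoeff W k • expoL k) W := by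
  have h := expoBasis.hasSum_repr W
  refine h.congr_fun fun k => ?_
  have h2 : ((Real.sqrt vol : ℝ) : ℂ) ≠ 0 := by
    exact_mod_cast (Real.sqrt_pos.2 vol_pos).ne'
  rw [expoBasis.repr_apply_apply, expoBasis_apply, inner_expoN_left, expoN, smul_smul]
  congr 1
  field_simp

end Basis

/-! ### Sobolev inequality $H^1\subset L^6$ for trigonometric polynomials -/

section Sobolev

/-- Every half-open cube of side $2\pi$ is a fundamental domain. The corner is left free because
both the centred cube and the eight cubes around the origin are needed. -/
theorem measurePreserving_proj (a : Fin 3 → ℝ) :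
    MeasurePreserving proj
      (volume.restrict (Set.univ.pi fun i => Set.Ioc (a i) (a i + 2 * Real.pi))) volume := by
  have h := measurePreserving_pi
    (fun i => (volume : Measure ℝ).restrict (Set.Ioc (a i) (a i + 2 * Real.pi)))
    (fun _ => (volume : Measure (AddCircle (2 * Real.pi))))
    (fun i => AddCircle.measurePreserving_mk (2 * Real.pi) (a i))
  rw [← Measure.restrict_pi_pi] at h
  exact h

theorem lintegral_partialSum (c : (Fin 3 → ℤ) → ℂ) (S : Finset (Fin 3 → ℤ)) :
    ∫⁻ x : Torus, ‖partialSum c S x‖ₑ ^ 2 = ENNReal.ofReal (vol * ∑ k ∈ S, ‖c k‖ ^ 2) := by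
  set W : L2C := ∑ k ∈ S, c k • expoL k
  have hW : W =ᵐ[volume] partialSum c S := coeFn_sum_expoL c S
  have h1 : ∫⁻ x : Torus, ‖partialSum c S x‖ₑ ^ 2 = ‖W‖ₑ ^ 2 := by
    rw [Lp.enorm_def, eLpNorm_congr_ae hW,
      eLpNorm_eq_lintegral_rpow_enorm_toReal (by simp) (by simp), ← ENNReal.rpow_natCast,
      ← ENNReal.rpow_mul]
    simp
  have h2 : ‖W‖ ^ 2 = vol * ∑ k ∈ S, ‖c k‖ ^ 2 := by
    have h3 : ((‖W‖ ^ 2 : ℝ) : ℂ) = inner ℂ W W := by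
      rw [inner_self_eq_norm_sq_to_K]; norm_cast
    have h4 : inner ℂ W W = ((vol * ∑ k ∈ S, ‖c k‖ ^ 2 : ℝ) : ℂ) := by
      simp only [W, sum_inner, inner_sum, inner_smul_left, inner_smul_right, inner_expoL]
      push_cast
      rw [Finset.mul_sum]
      refine Finset.sum_congr rfl fun k hk => ?_
      simp only [mul_ite, mul_zero, Finset.sum_ite_eq', hk, if_true]
      rw [← mul_assoc, Complex.mul_conj', mul_comm]
    rw [h4] at h3
    exact_mod_cast h3
  rw [h1, ← h2, ENNReal.ofReal_pow (norm_nonneg _), ofReal_norm]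

theorem hasFDerivAt_expo_proj (k : Fin 3 → ℤ) (y : Fin 3 → ℝ) :
    HasFDerivAt (fun y => expo k (proj y))
      (∑ i, (ContinuousLinearMap.proj (R := ℝ) (φ := fun _ : Fin 3 => ℝ) i).smulRight
        (Complex.I * (k i : ℂ) * expo k (proj y))) y := by
  simp only [expo_proj]
  have h1 : HasFDerivAt (fun y : Fin 3 → ℝ => ∑ i, (k i : ℝ) * y i)
      (∑ i, (k i : ℝ) • ContinuousLinearMap.proj (R := ℝ) (φ := fun _ : Fin 3 => ℝ) i) y :=
    HasFDerivAt.fun_sum fun i _ => (hasFDerivAt_apply i y).const_mul _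
  have h2 := ((Complex.ofRealCLM.hasFDerivAt.comp y h1).const_mul Complex.I).cexp
  refine h2.congr_fderiv ?_
  ext v
  simp [Finset.mul_sum]
  refine Finset.sum_congr rfl fun i _ => ?_
  ring

theorem hasFDerivAt_partialSum_proj (c : (Fin 3 → ℤ) → ℂ) (S : Finset (Fin 3 → ℤ))
    (y : Fin 3 → ℝ) :
    HasFDerivAt (fun y => partialSum c S (proj y))
      (∑ i, (ContinuousLinearMap.proj (R := ℝ) (φ := fun _ : Fin 3 => ℝ) i).smulRight
        (partialSum (fun k => Complex.I * (k i : ℂ) * c k) S (proj y))) y := by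
  unfold partialSum
  have h := HasFDerivAt.fun_sum (u := S) (x := y) fun k _ =>
    (hasFDerivAt_expo_proj k y).const_mul (c k)
  refine h.congr_fderiv ?_
  ext v
  simp only [sum_apply, smul_apply,
    ContinuousLinearMap.smulRight_apply, ContinuousLinearMap.proj_apply, Finset.smul_sum]
  rw [Finset.sum_comm]
  refine Finset.sum_congr rfl fun i _ => Finset.sum_congr rfl fun k _ => ?_
  simp only [smul_eq_mul, Complex.real_smul]
  ring

theorem contDiff_expo_proj (k : Fin 3 → ℤ) : ContDiff ℝ ∞ (fun y => expo k (proj y)) := by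
  simp only [expo_proj]
  have h : ContDiff ℝ ∞ fun y : Fin 3 → ℝ => ∑ i, (k i : ℝ) * y i :=
    ContDiff.sum fun i _ => contDiff_const.mul (contDiff_apply ℝ ℝ i)
  exact ContDiff.cexp (contDiff_const.mul (Complex.ofRealCLM.contDiff.comp h))

theorem contDiff_partialSum_proj (c : (Fin 3 → ℤ) → ℂ) (S : Finset (Fin 3 → ℤ)) :
    ContDiff ℝ ∞ (fun y => partialSum c S (proj y)) := by
  unfold partialSum
  exact ContDiff.sum fun k _ => contDiff_const.mul (contDiff_expo_proj k)

/-- The ball of the sup norm is the cube $[-3\pi/2,3\pi/2]^3$, which is covered by the eight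
fundamental cubes having the origin as a vertex. -/
theorem lintegral_ball_proj_le (h : Torus → ℝ≥0∞) (hh : Measurable h) :
    ∫⁻ y in Metric.closedBall (0 : Fin 3 → ℝ) (3 * Real.pi / 2), h (proj y)
      ≤ 8 * ∫⁻ x : Torus, h x := by
  have hpi := Real.pi_pos
  let a : (Fin 3 → Bool) → Fin 3 → ℝ := fun s i => if s i then -(2 * Real.pi) else 0
  have hsub : Metric.closedBall (0 : Fin 3 → ℝ) (3 * Real.pi / 2) ⊆
      ⋃ s, Set.univ.pi fun i => Set.Ioc (a s i) (a s i + 2 * Real.pi) := by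
    intro y hy
    rw [mem_closedBall_zero_iff, pi_norm_le_iff_of_nonneg (by positivity)] at hy
    refine Set.mem_iUnion.2 ⟨fun i => decide (y i ≤ 0), fun i _ => ?_⟩
    have := abs_le.1 (hy i)
    by_cases hi : y i ≤ 0
    · simp only [a, hi, decide_true, if_true, Set.mem_Ioc]; constructor <;> linarith
    · simp only [a, hi, decide_false, Set.mem_Ioc]; constructor <;> simp <;> linarith
  calc _ ≤ ∫⁻ y in ⋃ s, Set.univ.pi fun i => Set.Ioc (a s i) (a s i + 2 * Real.pi), h (proj y) :=
        lintegral_mono_set hsub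
    _ ≤ ∑' s, ∫⁻ y in Set.univ.pi fun i => Set.Ioc (a s i) (a s i + 2 * Real.pi), h (proj y) :=
        lintegral_iUnion_le _ _
    _ = ∑' s : Fin 3 → Bool, ∫⁻ x : Torus, h x := by
        congr 1; ext s
        exact (measurePreserving_proj (a s)).lintegral_comp hh
    _ = 8 * ∫⁻ x : Torus, h x := by
        rw [tsum_fintype]; simp

/-- The cutoff used to localize periodic functions. -/
def cutoff : ContDiffBump (0 : Fin 3 → ℝ) where
  rIn := Real.pi
  rOut := 3 * Real.pi / 2
  rIn_pos := Real.pi_pos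
  rIn_lt_rOut := by linarith [Real.pi_pos]

theorem exists_fderiv_cutoff_bound : ∃ M : ℝ, 1 ≤ M ∧ ∀ y, ‖fderiv ℝ cutoff y‖ ≤ M := by
  have hc : Continuous (fderiv ℝ cutoff) := (cutoff.contDiff (n := 1)).continuous_fderiv (by simp)
  obtain ⟨M, hM⟩ := (cutoff.hasCompactSupport.fderiv ℝ).exists_bound_of_continuous hc
  exact ⟨max 1 M, le_max_left _ _, fun y => (hM y).trans (le_max_right _ _)⟩

/-- The squared gradient density of a trigonometric polynomial, plus its square. -/
def sobDensity (c : (Fin 3 → ℤ) → ℂ) (S : Finset (Fin 3 → ℤ)) (x : Torus) : ℝ≥0∞ :=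
  ‖partialSum c S x‖ₑ ^ 2
    + ∑ i, ‖partialSum (fun k => Complex.I * (k i : ℂ) * c k) S x‖ₑ ^ 2

theorem measurable_sobDensity (c : (Fin 3 → ℤ) → ℂ) (S : Finset (Fin 3 → ℤ)) :
    Measurable (sobDensity c S) := by
  have h : ∀ c' : (Fin 3 → ℤ) → ℂ, Measurable (fun x => ‖partialSum c' S x‖ₑ ^ 2) := fun c' =>
    ((continuous_partialSum c' S).measurable.enorm).pow_const 2
  unfold sobDensity
  exact (h _).add (Finset.measurable_sum _ fun i _ => h _)

theorem lintegral_sobDensity (c : (Fin 3 → ℤ) → ℂ) (S : Finset (Fin 3 → ℤ)) :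
    ∫⁻ x, sobDensity c S x = ENNReal.ofReal (vol * ∑ k ∈ S, (1 + eig k) * ‖c k‖ ^ 2) := by
  have h : ∀ c' : (Fin 3 → ℤ) → ℂ, Measurable (fun x => ‖partialSum c' S x‖ₑ ^ 2) := fun c' =>
    ((continuous_partialSum c' S).measurable.enorm).pow_const 2
  have hv := vol_pos.le
  unfold sobDensity
  rw [lintegral_add_left (h _), lintegral_finsetSum _ fun i _ => h _]
  simp only [lintegral_partialSum]
  rw [← ENNReal.ofReal_sum_of_nonneg fun i _ => by positivity,
    ← ENNReal.ofReal_add (by positivity) (Finset.sum_nonneg fun i _ => by positivity)]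
  congr 1
  rw [← Finset.mul_sum, ← mul_add, Finset.sum_comm, ← Finset.sum_add_distrib]
  congr 1
  refine Finset.sum_congr rfl fun k _ => ?_
  simp only [norm_mul, Complex.norm_I, one_mul, mul_pow, eig, ← Finset.sum_mul]
  rw [add_mul, one_mul]
  congr 2
  refine Finset.sum_congr rfl fun i _ => ?_
  rw [show ((k i : ℤ) : ℂ) = (((k i : ℤ) : ℝ) : ℂ) by push_cast; rfl, Complex.norm_real,
    Real.norm_eq_abs, sq_abs]

/-- Product rule with $|\chi|\le1\le M$ and $|\nabla\chi|\le M$. The factor $4$ is Cauchy–Schwarz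
for the four summands $p,\partial_1p,\partial_2p,\partial_3p$. Off the support of the cutoff the
left side vanishes. -/
theorem enorm_fderiv_cutoff_mul_le {M : ℝ} (hM1 : 1 ≤ M) (hM : ∀ y, ‖fderiv ℝ cutoff y‖ ≤ M)
    (c : (Fin 3 → ℤ) → ℂ) (S : Finset (Fin 3 → ℤ)) (y : Fin 3 → ℝ) :
    ‖fderiv ℝ (fun y => cutoff y • partialSum c S (proj y)) y‖ₑ ^ 2 ≤
      (Metric.closedBall (0 : Fin 3 → ℝ) (3 * Real.pi / 2)).indicator
        (fun y => ENNReal.ofReal (4 * M ^ 2) * sobDensity c S (proj y)) y := by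
  by_cases hy : y ∈ Metric.closedBall (0 : Fin 3 → ℝ) (3 * Real.pi / 2)
  · rw [Set.indicator_of_mem hy]
    have h1 : HasFDerivAt cutoff (fderiv ℝ cutoff y) y :=
      ((cutoff.contDiff (n := 1)).differentiable (by simp) y).hasFDerivAt
    have h2 := h1.fun_smul (hasFDerivAt_partialSum_proj c S y)
    rw [h2.fderiv]
    set p := partialSum c S (proj y)
    set d : Fin 3 → ℂ := fun i => partialSum (fun k => Complex.I * (k i : ℂ) * c k) S (proj y)
    have hd : ‖∑ i, (ContinuousLinearMap.proj (R := ℝ) (φ := fun _ : Fin 3 => ℝ) i).smulRight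
        (d i)‖ ≤ ∑ i, ‖d i‖ := by
      refine (norm_sum_le _ _).trans (Finset.sum_le_sum fun i _ => ?_)
      rw [ContinuousLinearMap.norm_smulRight_apply]
      refine mul_le_of_le_one_left (norm_nonneg _) ?_
      exact ContinuousLinearMap.opNorm_le_bound _ zero_le_one fun v => by
        simpa using norm_le_pi_norm v i
    have hc : ‖cutoff y‖ ≤ 1 := by
      rw [Real.norm_of_nonneg cutoff.nonneg]; exact cutoff.le_one
    have hn : ‖cutoff y • (∑ i, (ContinuousLinearMap.proj (R := ℝ)
          (φ := fun _ : Fin 3 => ℝ) i).smulRight (d i))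
        + (fderiv ℝ cutoff y).smulRight p‖ ≤ M * (‖p‖ + ∑ i, ‖d i‖) := by
      refine (norm_add_le _ _).trans ?_
      rw [norm_smul, ContinuousLinearMap.norm_smulRight_apply]
      have : 0 ≤ ∑ i, ‖d i‖ := Finset.sum_nonneg fun i _ => norm_nonneg _
      have h3 : ‖cutoff y‖ * ‖∑ i, (ContinuousLinearMap.proj (R := ℝ)
          (φ := fun _ : Fin 3 => ℝ) i).smulRight (d i)‖ ≤ M * ∑ i, ‖d i‖ :=
        mul_le_mul (hc.trans hM1) hd (norm_nonneg _) (by linarith)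
      have h4 : ‖fderiv ℝ cutoff y‖ * ‖p‖ ≤ M * ‖p‖ :=
        mul_le_mul_of_nonneg_right (hM y) (norm_nonneg _)
      linarith
    have hsq : ‖cutoff y • (∑ i, (ContinuousLinearMap.proj (R := ℝ)
          (φ := fun _ : Fin 3 => ℝ) i).smulRight (d i))
        + (fderiv ℝ cutoff y).smulRight p‖ ^ 2 ≤ 4 * M ^ 2 * (‖p‖ ^ 2 + ∑ i, ‖d i‖ ^ 2) := by
      refine (pow_le_pow_left₀ (norm_nonneg _) hn 2).trans ?_
      rw [mul_pow]
      simp only [Fin.sum_univ_three]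
      have : (‖p‖ + (‖d 0‖ + ‖d 1‖ + ‖d 2‖)) ^ 2
          ≤ 4 * (‖p‖ ^ 2 + (‖d 0‖ ^ 2 + ‖d 1‖ ^ 2 + ‖d 2‖ ^ 2)) := by
        nlinarith [sq_nonneg (‖p‖ - ‖d 0‖), sq_nonneg (‖p‖ - ‖d 1‖), sq_nonneg (‖p‖ - ‖d 2‖),
          sq_nonneg (‖d 0‖ - ‖d 1‖), sq_nonneg (‖d 0‖ - ‖d 2‖), sq_nonneg (‖d 1‖ - ‖d 2‖)]
      nlinarith [sq_nonneg M]
    have hsd : sobDensity c S (proj y) = ENNReal.ofReal (‖p‖ ^ 2 + ∑ i, ‖d i‖ ^ 2) := by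
      rw [ENNReal.ofReal_add (by positivity) (Finset.sum_nonneg fun i _ => by positivity),
        ENNReal.ofReal_sum_of_nonneg fun i _ => by positivity]
      simp only [ENNReal.ofReal_pow (norm_nonneg _), ofReal_norm]
      rfl
    rw [hsd, ← ENNReal.ofReal_mul (by positivity), ← ofReal_norm,
      ← ENNReal.ofReal_pow (norm_nonneg _)]
    exact ENNReal.ofReal_le_ofReal hsq
  · rw [Set.indicator_of_notMem hy]
    have : y ∉ tsupport (fun y => cutoff y • partialSum c S (proj y)) := by
      intro h
      have h2 := tsupport_smul_subset_left _ _ h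
      rw [cutoff.tsupport_eq] at h2
      exact hy h2
    have h0 : ‖fderiv ℝ (fun y => cutoff y • partialSum c S (proj y)) y‖ = 0 := by
      rw [norm_eq_zero]
      exact image_eq_zero_of_notMem_tsupport fun h => this (tsupport_fderiv_subset ℝ h)
    rw [← ofReal_norm, h0]
    simp

/-- The Sobolev inequality `H¹ ⊂ L⁶` for trigonometric polynomials. -/
theorem exists_sobolev_partialSum : ∃ C : ℝ≥0, ∀ (c : (Fin 3 → ℤ) → ℂ) (S : Finset (Fin 3 → ℤ)),
    eLpNorm (partialSum c S) 6 volume ≤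
      C * (ENNReal.ofReal (vol * ∑ k ∈ S, (1 + eig k) * ‖c k‖ ^ 2)) ^ (1 / 2 : ℝ) := by
  obtain ⟨M, hM1, hM⟩ := exists_fderiv_cutoff_bound
  let C₀ := SNormLESNormFDerivOfEqConst ℂ (volume : Measure (Fin 3 → ℝ)) 2
  -- Eight periods cover the support of the cutoff; $4M^2$ is the cost of the product rule.
  let C₁ : ℝ≥0∞ := (8 * ENNReal.ofReal (4 * M ^ 2)) ^ (1 / 2 : ℝ)
  have hC₁ : C₁ ≠ ⊤ := ENNReal.rpow_ne_top_of_nonneg (by norm_num)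
    (ENNReal.mul_ne_top (by simp) ENNReal.ofReal_ne_top)
  refine ⟨C₀ * C₁.toNNReal, fun c S => ?_⟩
  set F : (Fin 3 → ℝ) → ℂ := fun y => cutoff y • partialSum c S (proj y)
  have hF : ContDiff ℝ 1 F :=
    cutoff.contDiff.smul ((contDiff_partialSum_proj c S).of_le (by exact_mod_cast le_top))
  have hFc : HasCompactSupport F := cutoff.hasCompactSupport.smul_right
  -- Gagliardo–Nirenberg–Sobolev in $\mathbb R^3$ with $1/6=1/2-1/3$, applied to the localized
  -- periodic function.
  have hgns : eLpNorm F ((6 : ℝ≥0) : ℝ≥0∞) volume ≤ C₀ * eLpNorm (fderiv ℝ F) ((2 : ℝ≥0) : ℝ≥0∞) volume :=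
    eLpNorm_le_eLpNorm_fderiv_of_eq volume hF hFc (p := 2) (p' := 6) (by norm_num)
      (by simp) (by simp; norm_num)
  -- The cutoff equals $1$ on the fundamental cube $(-\pi,\pi]^3$, so localizing loses nothing of
  -- the $L^6$ norm over one period.
  have hleft : eLpNorm (partialSum c S) 6 volume ≤ eLpNorm F ((6 : ℝ≥0) : ℝ≥0∞) volume := by
    rw [← eLpNorm_comp_measurePreserving
      (continuous_partialSum c S).aestronglyMeasurable
      (measurePreserving_proj fun _ => -Real.pi)]
    refine le_trans (le_of_eq ?_) (eLpNorm_mono_measure F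
      (Measure.restrict_le_self (s := Set.univ.pi fun _ => Set.Ioc (-Real.pi) (-Real.pi + 2 * Real.pi))))
    refine eLpNorm_congr_ae ?_
    filter_upwards [ae_restrict_mem (MeasurableSet.univ_pi fun _ => measurableSet_Ioc)] with y hy
    have : y ∈ Metric.closedBall (0 : Fin 3 → ℝ) Real.pi := by
      rw [mem_closedBall_zero_iff, pi_norm_le_iff_of_nonneg Real.pi_pos.le]
      intro i
      have := hy i trivial
      rw [Real.norm_eq_abs, abs_le]
      constructor <;> linarith [this.1, this.2]
    simp only [F, Function.comp]
    rw [cutoff.one_of_mem_closedBall this, one_smul]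
  have hright : eLpNorm (fderiv ℝ F) ((2 : ℝ≥0) : ℝ≥0∞) volume ≤
      C₁ * (ENNReal.ofReal (vol * ∑ k ∈ S, (1 + eig k) * ‖c k‖ ^ 2)) ^ (1 / 2 : ℝ) := by
    rw [show ((2 : ℝ≥0) : ℝ≥0∞) = 2 by norm_num,
      eLpNorm_eq_lintegral_rpow_enorm_toReal (by simp) (by simp)]
    simp only [ENNReal.toReal_ofNat, ENNReal.rpow_ofNat]
    rw [← ENNReal.mul_rpow_of_nonneg _ _ (by norm_num), ← lintegral_sobDensity]
    refine ENNReal.rpow_le_rpow ?_ (by norm_num)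
    calc ∫⁻ y, ‖fderiv ℝ F y‖ₑ ^ 2
        ≤ ∫⁻ y, (Metric.closedBall (0 : Fin 3 → ℝ) (3 * Real.pi / 2)).indicator
            (fun y => ENNReal.ofReal (4 * M ^ 2) * sobDensity c S (proj y)) y :=
          lintegral_mono fun y => enorm_fderiv_cutoff_mul_le hM1 hM c S y
      _ = ∫⁻ y in Metric.closedBall (0 : Fin 3 → ℝ) (3 * Real.pi / 2),
            ENNReal.ofReal (4 * M ^ 2) * sobDensity c S (proj y) :=
          lintegral_indicator Metric.isClosed_closedBall.measurableSet _
      _ ≤ 8 * ∫⁻ x, ENNReal.ofReal (4 * M ^ 2) * sobDensity c S x :=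
          lintegral_ball_proj_le _ ((measurable_sobDensity c S).const_mul _)
      _ = _ := by
          rw [lintegral_const_mul _ (measurable_sobDensity c S), mul_assoc]
  calc _ ≤ _ := hleft.trans hgns
    _ ≤ C₀ * (C₁ * _) := by gcongr
    _ = _ := by rw [ENNReal.coe_mul, ENNReal.coe_toNNReal hC₁, mul_assoc]

end Sobolev

/-! ### Real functions: Sobolev embedding and the $L^{6/5}$–$L^6$ pairing in Fourier coefficients -/

section RealFunctions

/-- Complexification of a real square-integrable function. -/
def toC (w : L2) : L2C := Complex.ofRealCLM.compLp w

theorem coeFn_toC (w : L2) : toC w =ᵐ[volume] fun x => (w x : ℂ) :=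
  Complex.ofRealCLM.coeFn_compLp w

theorem coeff_eq_ccoeff_toC (w : L2) (k : Fin 3 → ℤ) : coeff w k = ccoeff (toC w) k := by
  rw [coeff_eq_ccoeff, ccoeff_congr (coeFn_toC w)]

theorem norm_toC (w : L2) : ‖toC w‖ = ‖w‖ := by
  rw [Lp.norm_def, Lp.norm_def, eLpNorm_congr_ae (coeFn_toC w)]
  congr 1
  refine eLpNorm_congr_norm_ae (Eventually.of_forall fun x => ?_)
  simp

theorem inner_toC_left (w : L2) (Z : L2C) :
    inner ℂ (toC w) Z = ∫ x : Torus, (w x : ℂ) * Z x := by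
  rw [L2.inner_def]
  refine integral_congr_ae ?_
  filter_upwards [coeFn_toC w] with x hx
  rw [hx]
  simp [RCLike.inner_apply, mul_comm]

theorem hasSum_norm_sq_coeff (w : L2) :
    HasSum (fun k => ‖coeff w k‖ ^ 2) (vol⁻¹ * ‖w‖ ^ 2) := by
  have h := hasSum_conj_ccoeff_mul (toC w) (toC w)
  rw [inner_self_eq_norm_sq_to_K, norm_toC] at h
  have h2 := Complex.hasSum_re h
  convert! h2 using 1
  · ext k
    rw [coeff_eq_ccoeff_toC, Complex.conj_mul']
    norm_cast
  · change _ = (((vol : ℝ) : ℂ)⁻¹ * ((‖w‖ : ℝ) : ℂ) ^ 2).re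
    rw [← Complex.ofReal_inv, ← Complex.ofReal_pow, ← Complex.ofReal_mul, Complex.ofReal_re]

theorem sum_norm_sq_coeff_le (w : L2) (S : Finset (Fin 3 → ℤ)) :
    vol * ∑ k ∈ S, ‖coeff w k‖ ^ 2 ≤ ‖w‖ ^ 2 := by
  have h := sum_le_hasSum S (fun k _ => by positivity) (hasSum_norm_sq_coeff w)
  have := mul_le_mul_of_nonneg_left h vol_pos.le
  rwa [mul_inv_cancel_left₀ vol_pos.ne'] at this

theorem vol_mul_norm_sq_coeff_le (w : L2) (k : Fin 3 → ℤ) :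
    vol * ‖coeff w k‖ ^ 2 ≤ ‖w‖ ^ 2 := by
  simpa using sum_norm_sq_coeff_le w {k}

theorem integrable_mul_expo {w : Torus → ℂ} (hw : Integrable w) (k : Fin 3 → ℤ) :
    Integrable (fun x => w x * expo k x) :=
  hw.mul_bdd (c := 1) (continuous_expo k).aestronglyMeasurable
    (Eventually.of_forall fun x => (norm_expo k x).le)

theorem integrable_ofReal {w : Torus → ℝ} (hw : Integrable w) :
    Integrable (fun x => (w x : ℂ)) := hw.ofReal

theorem integrable_L2 (w : L2) : Integrable w :=
  (Lp.memLp w).integrable (by norm_num)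

theorem coeff_add {w z : Torus → ℝ} (hw : Integrable w) (hz : Integrable z) (k : Fin 3 → ℤ) :
    coeff (fun x => w x + z x) k = coeff w k + coeff z k := by
  simp only [coeff]
  rw [← mul_add, ← integral_add (integrable_mul_expo (integrable_ofReal hw) _)
    (integrable_mul_expo (integrable_ofReal hz) _)]
  congr 1
  refine integral_congr_ae (Eventually.of_forall fun x => ?_)
  simp only
  push_cast; ring

theorem coeff_const_mul (c : ℝ) (w : Torus → ℝ) (k : Fin 3 → ℤ) :
    coeff (fun x => c * w x) k = c * coeff w k := by
  simp only [coeff]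
  rw [mul_left_comm, ← integral_const_mul (c : ℂ)]
  congr 1
  refine integral_congr_ae (Eventually.of_forall fun x => ?_)
  simp only
  push_cast; ring

theorem coeff_congr {w z : Torus → ℝ} (h : w =ᵐ[volume] z) (k : Fin 3 → ℤ) :
    coeff w k = coeff z k := by
  rw [coeff_eq_ccoeff, coeff_eq_ccoeff]
  exact ccoeff_congr (by filter_upwards [h] with x hx; rw [hx]) k

/-- The Fourier coefficient as a continuous functional on `L²`. -/
def coeffCLM (k : Fin 3 → ℤ) : L2 →L[ℝ] ℂ :=
  LinearMap.mkContinuous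
    { toFun := fun w => coeff w k
      map_add' := fun w z => by
        rw [coeff_congr (Lp.coeFn_add w z)]
        exact coeff_add (integrable_L2 w) (integrable_L2 z) k
      map_smul' := fun c w => by
        rw [coeff_congr (Lp.coeFn_smul c w)]
        exact coeff_const_mul c w k } (Real.sqrt vol)⁻¹ (fun w => by
    have h := vol_mul_norm_sq_coeff_le w k
    have hs := Real.sqrt_pos.2 vol_pos
    change ‖coeff w k‖ ≤ _
    rw [inv_mul_eq_div, le_div_iff₀ hs]
    refine le_of_sq_le_sq ?_ (norm_nonneg _)
    rw [mul_pow, Real.sq_sqrt vol_pos.le]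
    linarith)

theorem coeffCLM_apply (k : Fin 3 → ℤ) (w : L2) : coeffCLM k w = coeff w k := rfl

theorem continuous_coeff (k : Fin 3 → ℤ) : Continuous fun w : L2 => coeff w k :=
  (coeffCLM k).continuous

theorem eig_nonneg (k : Fin 3 → ℤ) : 0 ≤ eig k := Finset.sum_nonneg fun _ _ => sq_nonneg _

theorem eig_neg (k : Fin 3 → ℤ) : eig (-k) = eig k := by simp [eig]

theorem sobNorm_sq (s : ℝ) (w : L2) : sobNorm s w ^ 2 =
    ENNReal.ofReal vol * ∑' k, ENNReal.ofReal ((1 + eig k) ^ s * ‖coeff w k‖ ^ 2) := by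
  rw [sobNorm, ← ENNReal.rpow_natCast, ← ENNReal.rpow_mul]
  simp [vol]

theorem ofReal_sum_le_sobNorm_sq (s : ℝ) (w : L2) (S : Finset (Fin 3 → ℤ)) :
    ENNReal.ofReal (vol * ∑ k ∈ S, (1 + eig k) ^ s * ‖coeff w k‖ ^ 2) ≤ sobNorm s w ^ 2 := by
  rw [sobNorm_sq, ENNReal.ofReal_mul vol_pos.le,
    ENNReal.ofReal_sum_of_nonneg fun k _ => by have := eig_nonneg k; positivity]
  gcongr
  exact ENNReal.sum_le_tsum S

theorem sobSum_ne_top {s : ℝ} {w : L2} (h : sobNorm s w < ⊤) :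
    ∑' k, ENNReal.ofReal ((1 + eig k) ^ s * ‖coeff w k‖ ^ 2) ≠ ⊤ := by
  have h2 : sobNorm s w ^ 2 < ⊤ := ENNReal.pow_lt_top h
  rw [sobNorm_sq] at h2
  intro h3
  rw [h3, ENNReal.mul_top (by simpa using vol_pos)] at h2
  exact lt_irrefl _ h2

theorem summable_of_sobNorm_lt_top {w : L2} (h : sobNorm 1 w < ⊤) :
    Summable fun k => (1 + eig k) * ‖coeff w k‖ ^ 2 := by
  have h2 := sobSum_ne_top h
  have h3 := ENNReal.summable_toReal h2
  refine h3.congr fun k => ?_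
  have := eig_nonneg k
  rw [ENNReal.toReal_ofReal (by positivity), Real.rpow_one]

/-- The constant of the Sobolev embedding `H¹ ⊂ L⁶`. -/
def sobConst : ℝ≥0 := exists_sobolev_partialSum.choose

theorem eLpNorm_partialSum_le (c : (Fin 3 → ℤ) → ℂ) (S : Finset (Fin 3 → ℤ)) :
    eLpNorm (partialSum c S) 6 volume ≤ sobConst *
      (ENNReal.ofReal (vol * ∑ k ∈ S, (1 + eig k) * ‖c k‖ ^ 2)) ^ (1 / 2 : ℝ) :=
  exists_sobolev_partialSum.choose_spec c S

theorem partialSum_sdiff (c : (Fin 3 → ℤ) → ℂ) {S S' : Finset (Fin 3 → ℤ)} (h : S ⊆ S')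
    (x : Torus) : partialSum c (S' \ S) x = partialSum c S' x - partialSum c S x := by
  rw [eq_sub_iff_add_eq]; exact Finset.sum_sdiff h

/-- Larger partial sums converge to $w$ in $L^2$, hence in measure, and the $L^6$ norm is lower
semicontinuous for that convergence. Each difference of partial sums is a polynomial with
frequencies outside $S$, to which the Sobolev inequality applies. The empty set gives the embedding
$H^1\subset L^6$; letting $S$ grow gives convergence of Fourier series in $L^6$. -/
theorem eLpNorm_sub_partialSum_le (w : L2) (S : Finset (Fin 3 → ℤ)) :
    eLpNorm (fun x => (w x : ℂ) - partialSum (coeff w) S x) 6 volume ≤ sobConst *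
      (ENNReal.ofReal vol * ∑' b : {k // k ∉ S},
        ENNReal.ofReal ((1 + eig b.1) * ‖coeff w b.1‖ ^ 2)) ^ (1 / 2 : ℝ) := by
  set c := coeff w
  have hsum : HasSum (fun k => c k • expoL k) (toC w) :=
    (hasSum_expoL (toC w)).congr_fun fun k => by rw [← coeff_eq_ccoeff_toC]
  have ht : Tendsto (fun S' : Finset (Fin 3 → ℤ) =>
      (∑ k ∈ S', c k • expoL k : L2C) - ∑ k ∈ S, c k • expoL k) atTop
      (𝓝 (toC w - ∑ k ∈ S, c k • expoL k)) := hsum.sub_const _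
  have hae : (toC w - ∑ k ∈ S, c k • expoL k : L2C) =ᵐ[volume]
      fun x => (w x : ℂ) - partialSum c S x := by
    filter_upwards [Lp.coeFn_sub (toC w) (∑ k ∈ S, c k • expoL k), coeFn_toC w,
      coeFn_sum_expoL c S] with x h1 h2 h3
    rw [h1, Pi.sub_apply, h2, h3]
  rw [← eLpNorm_congr_ae hae]
  refine eLpNorm_le_of_tendstoInMeasure ?_ (tendstoInMeasure_of_tendsto_Lp ht)
    fun S' => Lp.aestronglyMeasurable _
  filter_upwards [eventually_ge_atTop S] with S' hS'
  have hae2 : ((∑ k ∈ S', c k • expoL k) - ∑ k ∈ S, c k • expoL k : L2C) =ᵐ[volume]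
      partialSum c (S' \ S) := by
    filter_upwards [Lp.coeFn_sub (∑ k ∈ S', c k • expoL k) (∑ k ∈ S, c k • expoL k),
      coeFn_sum_expoL c S, coeFn_sum_expoL c S'] with x h1 h2 h3
    rw [h1, Pi.sub_apply, h2, h3, partialSum_sdiff c hS']
  rw [eLpNorm_congr_ae hae2]
  refine (eLpNorm_partialSum_le c _).trans ?_
  gcongr
  rw [ENNReal.ofReal_mul vol_pos.le,
    ENNReal.ofReal_sum_of_nonneg fun k _ => by have := eig_nonneg k; positivity]
  gcongr
  have := (ENNReal.sum_le_tsum (f := fun b : {k // k ∉ S} =>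
    ENNReal.ofReal ((1 + eig b.1) * ‖c b.1‖ ^ 2)) ((S' \ S).subtype (· ∉ S)))
  refine le_trans (le_of_eq ?_) this
  rw [← Finset.sum_subtype_of_mem (p := (· ∉ S))
    (fun k => ENNReal.ofReal ((1 + eig k) * ‖c k‖ ^ 2))
    fun k hk => (Finset.mem_sdiff.1 hk).2]

theorem eLpNorm_six_le (w : L2) : eLpNorm w 6 volume ≤ sobConst * sobNorm 1 w := by
  have h := eLpNorm_sub_partialSum_le w ∅
  have h1 : eLpNorm (fun x => (w x : ℂ) - partialSum (coeff w) ∅ x) 6 volume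
      = eLpNorm w 6 volume := by
    refine eLpNorm_congr_norm_ae (Eventually.of_forall fun x => ?_)
    simp [partialSum]
  rw [h1] at h
  refine h.trans ?_
  unfold sobNorm
  gcongr
  · exact le_of_eq rfl
  · simp only [Real.rpow_one]
    exact ENNReal.tsum_comp_le_tsum_of_injective Subtype.coe_injective
      (fun k => ENNReal.ofReal ((1 + eig k) * ‖coeff w k‖ ^ 2))

theorem tendsto_eLpNorm_sub_partialSum {w : L2} (hw : sobNorm 1 w < ⊤) :
    Tendsto (fun S => eLpNorm (fun x => (w x : ℂ) - partialSum (coeff w) S x) 6 volume) atTop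
      (𝓝 0) := by
  have h := ENNReal.tendsto_tsum_compl_atTop_zero (sobSum_ne_top hw)
  simp only [Real.rpow_one] at h
  refine tendsto_of_tendsto_of_tendsto_of_le_of_le tendsto_const_nhds ?_ (fun _ => zero_le)
    (eLpNorm_sub_partialSum_le w)
  have h2 := ENNReal.Tendsto.const_mul (a := ENNReal.ofReal vol) h (Or.inr ENNReal.ofReal_ne_top)
  have h3 := (ENNReal.continuous_rpow_const (y := (1 / 2 : ℝ))).tendsto _ |>.comp h2
  have h4 := ENNReal.Tendsto.const_mul (a := (sobConst : ℝ≥0∞)) h3 (Or.inr ENNReal.coe_ne_top)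
  simpa using h4

/-- Quintic growth puts $f(u)$ in $L^{6/5}$ when $u\in L^6$, and $L^{6/5}$ is dual to $L^6$. -/
instance holderTriple_six : ENNReal.HolderTriple (6 / 5) 6 1 where
  inv_add_inv_eq_inv := by
    rw [ENNReal.inv_div (by simp) (by simp), ← one_div, ← ENNReal.add_div,
      ]
    norm_num
    exact ENNReal.div_self (by simp) (by simp)

theorem enorm_integral_mul_le {h z : Torus → ℂ} (hh : AEStronglyMeasurable h volume)
    (hz : AEStronglyMeasurable z volume) :
    ‖∫ x, h x * z x‖ₑ ≤ eLpNorm h (6 / 5) volume * eLpNorm z 6 volume := by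
  refine (enorm_integral_le_lintegral_enorm _).trans ?_
  rw [← eLpNorm_one_eq_lintegral_enorm]
  change eLpNorm (h • z) 1 volume ≤ _
  have := eLpNorm_smul_le_mul_eLpNorm (f := z) (φ := h) (p := 6 / 5) (q := 6) (r := 1) hz hh
    (hpqr := holderTriple_six)
  exact this

theorem sum_coeff_mul_conj {h : Torus → ℝ} (hh : Integrable h) (c : (Fin 3 → ℤ) → ℂ)
    (S : Finset (Fin 3 → ℤ)) :
    ∑ k ∈ S, coeff h k * conj (c k)
      = (vol : ℂ)⁻¹ * ∫ x, (h x : ℂ) * conj (partialSum c S x) := by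
  have h1 : ∀ x, (h x : ℂ) * conj (partialSum c S x)
      = ∑ k ∈ S, ((h x : ℂ) * expo (-k) x) * conj (c k) := by
    intro x
    simp only [partialSum, map_sum, map_mul, Finset.mul_sum, expo_neg]
    exact Finset.sum_congr rfl fun k _ => by ring
  simp only [h1]
  rw [integral_finsetSum _ fun k _ => (integrable_mul_expo (integrable_ofReal hh) _).mul_const _,
    Finset.mul_sum]
  refine Finset.sum_congr rfl fun k _ => ?_
  rw [integral_mul_const, coeff, vol_coe, mul_assoc]

/-- Truncating $z$ does not increase its $H^1$ norm, and the Sobolev inequality is applied to the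
truncation itself, so the bound is uniform in $S$ without any boundedness of Fourier projections on
$L^6$. It serves as the dominating function when the limit in $S$ is taken under the time integral.
-/
theorem enorm_sum_coeff_mul_conj_le {h : Torus → ℝ} (hh : MemLp h (6 / 5) volume) (z : L2)
    (S : Finset (Fin 3 → ℤ)) :
    ‖∑ k ∈ S, coeff h k * conj (coeff z k)‖ₑ ≤
      ‖(vol : ℂ)⁻¹‖ₑ * (eLpNorm h (6 / 5) volume * (sobConst * sobNorm 1 z)) := by
  have hint : Integrable h := hh.integrable (by
    rw [ENNReal.le_div_iff_mul_le (by simp) (by simp)]; norm_num)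
  rw [sum_coeff_mul_conj hint, enorm_mul]
  gcongr
  refine (enorm_integral_mul_le (Complex.continuous_ofReal.comp_aestronglyMeasurable hh.1)
    (Complex.continuous_conj.comp (continuous_partialSum _ S)).aestronglyMeasurable).trans ?_
  have e1 : eLpNorm (fun x => ((h x : ℝ) : ℂ)) (6 / 5) volume = eLpNorm h (6 / 5) volume :=
    eLpNorm_congr_norm_ae (Eventually.of_forall fun x => by simp)
  have e2 : eLpNorm (fun x => conj (partialSum (coeff z) S x)) 6 volume
      = eLpNorm (partialSum (coeff z) S) 6 volume :=
    eLpNorm_congr_norm_ae (Eventually.of_forall fun x => by simp)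
  refine (mul_le_mul' (le_of_eq e1) (le_of_eq e2)).trans ?_
  gcongr
  refine (eLpNorm_partialSum_le _ S).trans ?_
  gcongr
  have := ENNReal.rpow_le_rpow (ofReal_sum_le_sobNorm_sq 1 z S) (z := (1 / 2 : ℝ)) (by norm_num)
  simp only [Real.rpow_one] at this
  refine this.trans (le_of_eq ?_)
  rw [← ENNReal.rpow_natCast, ← ENNReal.rpow_mul]; simp

/-- Parseval outside $L^2$: $h$ is only in $L^{6/5}$, but the partial sums of $z\in H^1$ converge in
the dual space $L^6$. -/
theorem tendsto_sum_coeff_mul_conj {h : Torus → ℝ} (hh : MemLp h (6 / 5) volume) {z : L2}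
    (hz : sobNorm 1 z < ⊤) :
    Tendsto (fun S => ∑ k ∈ S, coeff h k * conj (coeff z k)) atTop
      (𝓝 ((vol : ℂ)⁻¹ * ((∫ x, h x * z x : ℝ) : ℂ))) := by
  have hint : Integrable h := hh.integrable (by
    rw [ENNReal.le_div_iff_mul_le (by simp) (by simp)]; norm_num)
  simp only [sum_coeff_mul_conj hint]
  refine Tendsto.const_mul _ ?_
  have hz6 : MemLp z 6 volume := ⟨Lp.aestronglyMeasurable z,
    (eLpNorm_six_le z).trans_lt (ENNReal.mul_lt_top ENNReal.coe_lt_top hz)⟩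
  have hhz : Integrable (fun x => h x * z x) :=
    memLp_one_iff_integrable.1 (hz6.smul hh)
  have hcast : ((∫ x, h x * z x : ℝ) : ℂ) = ∫ x, (h x : ℂ) * (z x : ℂ) := by
    rw [← integral_complex_ofReal]; congr 1; ext x; simp
  rw [hcast, tendsto_iff_edist_tendsto_0]
  have hlim := ENNReal.Tendsto.const_mul (a := eLpNorm h (6 / 5) volume)
    (tendsto_eLpNorm_sub_partialSum hz) (Or.inr hh.2.ne)
  rw [mul_zero] at hlim
  refine tendsto_of_tendsto_of_tendsto_of_le_of_le tendsto_const_nhds hlim (fun _ => zero_le) ?_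
  intro S
  beta_reduce
  have e1 : eLpNorm (fun x => ((h x : ℝ) : ℂ)) (6 / 5) volume = eLpNorm h (6 / 5) volume :=
    eLpNorm_congr_norm_ae (Eventually.of_forall fun x => by simp)
  have i1 : Integrable fun x => (h x : ℂ) * (z x : ℂ) := by
    simpa using integrable_ofReal hhz
  have i2 : Integrable fun x => (h x : ℂ) * conj (partialSum (coeff z) S x) := by
    obtain ⟨M, hM⟩ := isCompact_univ.exists_bound_of_continuousOn
      (Complex.continuous_conj.comp (continuous_partialSum (coeff z) S)).continuousOn
    exact (integrable_ofReal hint).mul_bdd (c := M)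
      (Complex.continuous_conj.comp (continuous_partialSum _ S)).aestronglyMeasurable
      (Eventually.of_forall fun x => hM x trivial)
  rw [edist_comm, edist_eq_enorm_sub, ← integral_sub i1 i2]
  simp only [← mul_sub]
  refine (enorm_integral_mul_le (Complex.continuous_ofReal.comp_aestronglyMeasurable hh.1)
    (AEStronglyMeasurable.sub
      (Complex.continuous_ofReal.comp_aestronglyMeasurable (Lp.aestronglyMeasurable z))
      (Complex.continuous_conj.comp
        (continuous_partialSum _ S)).aestronglyMeasurable)).trans ?_
  refine mul_le_mul' (le_of_eq e1) (le_of_eq ?_)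
  refine eLpNorm_congr_norm_ae (Eventually.of_forall fun x => ?_)
  rw [← RCLike.norm_conj]
  simp

end RealFunctions

/-! ### Real trigonometric test functions -/

section Trig

/-- The real trigonometric function `Re (c e^{ik·x})`. -/
def trig (c : ℂ) (k : Fin 3 → ℤ) (x : Torus) : ℝ := (c * expo k x).re

theorem smooth_trig (c : ℂ) (k : Fin 3 → ℤ) : SmoothOnTorus (trig c k) :=
  Complex.reCLM.contDiff.comp (contDiff_const.mul (contDiff_expo_proj k))

theorem real_mul_trig (a : ℝ) (c : ℂ) (k : Fin 3 → ℤ) (x : Torus) :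
    trig (a * c) k x = a * trig c k x := by
  simp only [trig, mul_assoc, Complex.re_ofReal_mul]

theorem expo_proj_single (k : Fin 3 → ℤ) (i : Fin 3) (s : ℝ) :
    expo k (proj (Pi.single i s)) = Complex.exp (Complex.I * ((k i : ℝ) * s : ℝ)) := by
  rw [expo_proj]
  congr 3
  rw [Finset.sum_eq_single i]
  · simp
  · intro j _ hj; simp [Pi.single_eq_of_ne hj]
  · simp

theorem hasDerivAt_expo_single (k : Fin 3 → ℤ) (i : Fin 3) :
    HasDerivAt (fun s : ℝ => expo k (proj (Pi.single i s))) (Complex.I * (k i : ℂ)) 0 := by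
  simp only [expo_proj_single]
  have h : HasDerivAt (fun s : ℝ => (k i : ℝ) * s) (k i : ℝ) 0 := by
    simpa using (hasDerivAt_id (0 : ℝ)).const_mul (k i : ℝ)
  have h2 := (h.ofReal_comp.const_mul Complex.I).cexp
  simpa using h2

theorem partialDeriv_trig (i : Fin 3) (c : ℂ) (k : Fin 3 → ℤ) (x : Torus) :
    partialDeriv i (trig c k) x = trig (Complex.I * (k i : ℂ) * c) k x := by
  unfold partialDeriv trig
  have h1 := (hasDerivAt_expo_single k i).const_mul (c * expo k x)
  have h2 := Complex.reCLM.hasFDerivAt.comp_hasDerivAt (0 : ℝ) h1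
  have h3 : HasDerivAt (fun s : ℝ => (c * expo k (x + proj (Pi.single i s))).re)
      (c * expo k x * (Complex.I * (k i : ℂ))).re 0 := by
    refine h2.congr_of_eventuallyEq (Eventually.of_forall fun s => ?_)
    simp only [expo_add_arg, Function.comp, Complex.reCLM_apply, mul_assoc]
  rw [h3.deriv]
  congr 1; ring

theorem integral_mul_trig {w : Torus → ℝ} (hw : Integrable w) (c : ℂ) (k : Fin 3 → ℤ) :
    ∫ x, w x * trig c k x = vol * (c * coeff w (-k)).re := by
  have h1 : ∀ x, w x * trig c k x = (c * ((w x : ℂ) * expo k x)).re := by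
    intro x
    rw [mul_left_comm, Complex.re_ofReal_mul, trig]
  simp only [h1]
  have h2 : Integrable fun x => c * ((w x : ℂ) * expo k x) :=
    (integrable_mul_expo (integrable_ofReal hw) k).const_mul c
  have h3 := Complex.reCLM.integral_comp_comm h2
  simp only [Complex.reCLM_apply] at h3
  rw [h3, integral_const_mul, coeff, neg_neg, vol_coe, ← Complex.re_ofReal_mul]
  congr 1
  have := vol_ne_zero
  field_simp

theorem integral_expo_mul (j k : Fin 3 → ℤ) :
    ∫ x, expo k x * expo (-j) x = if j = k then (vol : ℂ) else 0 := by
  simp only [← expo_add, integral_expo, ← sub_eq_add_neg, sub_eq_zero, eq_comm]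

theorem trig_eq (c : ℂ) (k : Fin 3 → ℤ) (x : Torus) :
    (trig c k x : ℂ) = (c / 2) * expo k x + (conj c / 2) * expo (-k) x := by
  rw [trig, Complex.re_eq_add_conj, map_mul, expo_neg]; ring

theorem integrable_expo_mul (c : ℂ) (k : Fin 3 → ℤ) (j : Fin 3 → ℤ) :
    Integrable fun x => c * expo k x * expo j x :=
  ((continuous_const.mul (continuous_expo k)).mul (continuous_expo j)).integrable_of_hasCompactSupport
    (HasCompactSupport.of_compactSpace _)

/-- For $k=0$ both terms are active at $j=0$ and add up to $\operatorname{Re}c$, so no case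
distinction is needed later. -/
theorem coeff_trig (c : ℂ) (k j : Fin 3 → ℤ) :
    coeff (trig c k) j = (if j = k then c / 2 else 0) + (if j = -k then conj c / 2 else 0) := by
  simp only [coeff, trig_eq, add_mul]
  rw [integral_add (integrable_expo_mul _ _ _) (integrable_expo_mul _ _ _)]
  simp only [mul_assoc, integral_const_mul, integral_expo_mul, vol_coe, mul_add]
  have := vol_ne_zero
  congr 1 <;> split_ifs <;> field_simp <;> simp

theorem fracLap_trig (θ : ℝ) (c : ℂ) (k : Fin 3 → ℤ) (x : Torus) :
    fracLap θ (trig c k) x = eig k ^ θ * trig c k x := by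
  unfold fracLap
  have h1 : HasSum (fun j => ((eig j ^ θ : ℝ) : ℂ) * coeff (trig c k) j * expo j x)
      (((eig k ^ θ : ℝ) : ℂ) * (c / 2) * expo k x
        + ((eig k ^ θ : ℝ) : ℂ) * (conj c / 2) * expo (-k) x) := by
    have ha := hasSum_ite_eq k (((eig k ^ θ : ℝ) : ℂ) * (c / 2) * expo k x)
    have hb := hasSum_ite_eq (-k) (((eig k ^ θ : ℝ) : ℂ) * (conj c / 2) * expo (-k) x)
    refine (ha.add hb).congr_fun fun j => ?_
    rw [coeff_trig, mul_add, add_mul]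
    congr 1
    · split_ifs with h
      · rw [h]
      · simp
    · split_ifs with h
      · rw [h, eig_neg]
      · simp
  rw [h1.tsum_eq]
  have : ((eig k ^ θ : ℝ) : ℂ) * (c / 2) * expo k x
        + ((eig k ^ θ : ℝ) : ℂ) * (conj c / 2) * expo (-k) x
      = ((eig k ^ θ * trig c k x : ℝ) : ℂ) := by
    push_cast [trig_eq]; ring
  rw [this, Complex.ofReal_re]

end Trig

/-! ### Weak derivatives of $H^1$ functions -/

section WeakDerivative

theorem isOpenQuotientMap_proj : IsOpenQuotientMap proj :=
  IsOpenQuotientMap.piMap (fun _ => QuotientAddGroup.isOpenQuotientMap_mk)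

theorem SmoothOnTorus.continuous {ψ : Torus → ℝ} (hψ : SmoothOnTorus ψ) : Continuous ψ :=
  isOpenQuotientMap_proj.isQuotientMap.continuous_iff.2 (ContDiff.continuous hψ)

theorem proj_add (y z : Fin 3 → ℝ) : proj (y + z) = proj y + proj z := by
  ext i; simp [proj]

theorem proj_zero : proj 0 = 0 := by ext i; simp [proj]

theorem hasDerivAt_along (ψ : Torus → ℝ) (hψ : SmoothOnTorus ψ) (i : Fin 3) (y : Fin 3 → ℝ)
    (s : ℝ) : HasDerivAt (fun s : ℝ => ψ (proj y + proj (Pi.single i s)))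
      (fderiv ℝ (fun y => ψ (proj y)) (y + Pi.single i s) (Pi.single i 1)) s := by
  have h1 : HasFDerivAt (fun y => ψ (proj y)) (fderiv ℝ (fun y => ψ (proj y)) (y + Pi.single i s))
      (y + Pi.single i s) :=
    ((ContDiff.differentiable hψ (by simp)) _).hasFDerivAt
  have h2 : HasDerivAt (fun s : ℝ => y + (Pi.single i s : Fin 3 → ℝ)) (Pi.single i 1) s := by
    exact (hasDerivAt_single (𝕜 := ℝ) i s).const_add y
  have h3 := h1.comp_hasDerivAt s h2
  refine h3.congr_of_eventuallyEq (Eventually.of_forall fun s => ?_)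
  simp only [Function.comp, proj_add]

theorem partialDeriv_proj (ψ : Torus → ℝ) (hψ : SmoothOnTorus ψ) (i : Fin 3) (y : Fin 3 → ℝ) :
    partialDeriv i ψ (proj y) = fderiv ℝ (fun y => ψ (proj y)) y (Pi.single i 1) := by
  unfold partialDeriv
  have := (hasDerivAt_along ψ hψ i y 0).deriv
  simpa using this

theorem SmoothOnTorus.continuous_partialDeriv {ψ : Torus → ℝ} (hψ : SmoothOnTorus ψ)
    (i : Fin 3) : Continuous (partialDeriv i ψ) := by
  rw [isOpenQuotientMap_proj.isQuotientMap.continuous_iff]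
  have : partialDeriv i ψ ∘ proj =
      fun y => fderiv ℝ (fun y => ψ (proj y)) y (Pi.single i 1) := by
    ext y; exact partialDeriv_proj ψ hψ i y
  rw [this]
  exact (ContDiff.continuous_fderiv hψ (by simp)).clm_apply continuous_const

theorem hasDerivAt_shift (ψ : Torus → ℝ) (hψ : SmoothOnTorus ψ) (i : Fin 3) (x : Torus) (s : ℝ) :
    HasDerivAt (fun s : ℝ => ψ (x + proj (Pi.single i s)))
      (partialDeriv i ψ (x + proj (Pi.single i s))) s := by
  obtain ⟨y, rfl⟩ := isOpenQuotientMap_proj.surjective x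
  rw [← proj_add, partialDeriv_proj ψ hψ]
  exact hasDerivAt_along ψ hψ i y s

theorem coeff_shift (w : Torus → ℝ) (y : Torus) (k : Fin 3 → ℤ) :
    coeff (fun x => w (x + y)) k = expo k y * coeff w k := by
  unfold coeff
  rw [mul_left_comm, ← integral_const_mul (expo k y)]
  congr 1
  rw [← integral_add_right_eq_self (fun x => expo k y * ((w x : ℂ) * expo (-k) x)) y]
  refine integral_congr_ae (Eventually.of_forall fun x => ?_)
  simp only [expo_add_arg]
  have : expo k y * expo (-k) y = 1 := by
    rw [← expo_add, add_neg_cancel, expo_zero]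
  linear_combination (-(w (x + y) : ℂ) * expo (-k) x) * this

theorem integrable_of_continuous {E : Type*} [NormedAddCommGroup E] {w : Torus → E}
    (hw : Continuous w) : Integrable w :=
  hw.integrable_of_hasCompactSupport (HasCompactSupport.of_compactSpace _)

/-- Integration by parts is replaced by translation invariance: the $k$-th coefficient of the
translate by $s$ along the $i$-th axis is $e^{ik_is}$ times that of $\psi$. Its derivative at $s=0$
is computed once from this formula and once under the integral. -/
theorem coeff_partialDeriv {ψ : Torus → ℝ} (hψ : SmoothOnTorus ψ) (i : Fin 3) (k : Fin 3 → ℤ) :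
    coeff (partialDeriv i ψ) k = Complex.I * (k i : ℂ) * coeff ψ k := by
  obtain ⟨M, hM⟩ := isCompact_univ.exists_bound_of_continuousOn
    (hψ.continuous_partialDeriv i).continuousOn
  have hcs : ∀ s, Continuous fun x => ((ψ (x + proj (Pi.single i s)) : ℝ) : ℂ) * expo (-k) x :=
    fun s => (Complex.continuous_ofReal.comp
      (hψ.continuous.comp (continuous_id.add continuous_const))).mul (continuous_expo _)
  have h := (hasDerivAt_integral_of_dominated_loc_of_deriv_le (μ := (volume : Measure Torus))
    (F := fun s x => ((ψ (x + proj (Pi.single i s)) : ℝ) : ℂ) * expo (-k) x)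
    (F' := fun s x => ((partialDeriv i ψ (x + proj (Pi.single i s)) : ℝ) : ℂ) * expo (-k) x)
    (x₀ := (0 : ℝ)) (s := Set.univ) (bound := fun _ => M) univ_mem
    (Eventually.of_forall fun s => (hcs s).aestronglyMeasurable)
    (integrable_of_continuous (hcs 0))
    ((Complex.continuous_ofReal.comp
      ((hψ.continuous_partialDeriv i).comp (continuous_id.add continuous_const))).mul
        (continuous_expo _)).aestronglyMeasurable
    (Eventually.of_forall fun x s _ => by
      rw [norm_mul, norm_expo, mul_one, Complex.norm_real]
      exact hM _ trivial)
    (integrable_const M)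
    (Eventually.of_forall fun x s _ =>
      (hasDerivAt_shift ψ hψ i x s).ofReal_comp.mul_const _)).2
  have h2 : HasDerivAt (fun s : ℝ => coeff (fun x => ψ (x + proj (Pi.single i s))) k)
      (coeff (partialDeriv i ψ) k) 0 := by
    have := h.const_mul ((2 * (Real.pi : ℂ)) ^ 3)⁻¹
    simpa [coeff, proj_zero] using this
  simp only [coeff_shift] at h2
  exact h2.unique ((hasDerivAt_expo_single k i).mul_const _)

/-- A continuous function as an element of `L²`. -/
def ofCont (ψ : Torus → ℝ) (hψ : Continuous ψ) : L2 :=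
  ContinuousMap.toLp (E := ℝ) 2 volume ℝ ⟨ψ, hψ⟩

theorem coeFn_ofCont (ψ : Torus → ℝ) (hψ : Continuous ψ) : ofCont ψ hψ =ᵐ[volume] ψ :=
  ContinuousMap.coeFn_toLp volume _

/-- The coefficients $ik_iw_k$ are square summable for $w\in H^1$, so they belong to an $L^2$
function, and Parseval against a smooth $\psi$ turns them into the weak derivative. -/
theorem exists_isWeakPartial {w : L2} (hw : sobNorm 1 w < ⊤) (i : Fin 3) :
    ∃ G : L2, IsWeakPartial i w G := by
  have hsum : Summable fun k : Fin 3 → ℤ => ‖Complex.I * (k i : ℂ) * coeff w k‖ ^ 2 := by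
    refine Summable.of_nonneg_of_le (fun k => by positivity) (fun k => ?_)
      (summable_of_sobNorm_lt_top hw)
    rw [norm_mul, norm_mul, Complex.norm_I, one_mul, mul_pow]
    gcongr
    have h1 : (k i : ℝ) ^ 2 ≤ eig k :=
      Finset.single_le_sum (f := fun j => (k j : ℝ) ^ 2) (fun j _ => sq_nonneg _)
        (Finset.mem_univ i)
    have h2 : ‖((k i : ℤ) : ℂ)‖ ^ 2 = (k i : ℝ) ^ 2 := by
      rw [show ((k i : ℤ) : ℂ) = (((k i : ℤ) : ℝ) : ℂ) by push_cast; rfl, Complex.norm_real,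
        Real.norm_eq_abs, sq_abs]
    linarith
  obtain ⟨W, hW⟩ := exists_ccoeff_eq _ hsum
  -- Riesz–Fischer gives a complex function. Taking its real part avoids proving that it is real:
  -- $w$ and $\psi$ are real, so only real parts enter the identity.
  refine ⟨Complex.reCLM.compLp W, fun ψ hψ => ?_⟩
  set P := ofCont ψ hψ.continuous
  set D := ofCont (partialDeriv i ψ) (hψ.continuous_partialDeriv i)
  have h1 := hasSum_conj_ccoeff_mul (toC w) (toC D)
  have h2 := (Complex.hasSum_conj'.2 (hasSum_conj_ccoeff_mul (toC P) W)).neg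
  have h3 : ∀ k, conj (ccoeff (toC w) k) * ccoeff (toC D) k
      = -conj (conj (ccoeff (toC P) k) * ccoeff W k) := by
    intro k
    rw [hW, ← coeff_eq_ccoeff_toC, ← coeff_eq_ccoeff_toC, ← coeff_eq_ccoeff_toC,
      coeff_congr (coeFn_ofCont _ _), coeff_congr (coeFn_ofCont _ _), coeff_partialDeriv hψ]
    simp only [map_mul, Complex.conj_conj, Complex.conj_I, map_intCast]
    ring
  simp only [h3] at h1
  have h4 := h1.unique h2
  rw [map_mul, map_inv₀, Complex.conj_ofReal, ← mul_neg] at h4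
  have h5 := mul_left_cancel₀ (inv_ne_zero vol_ne_zero) h4
  rw [inner_toC_left, inner_toC_left] at h5
  have e1 : ∫ x, (w x : ℂ) * toC D x = ((∫ x, w x * partialDeriv i ψ x : ℝ) : ℂ) := by
    rw [← integral_complex_ofReal]
    refine integral_congr_ae ?_
    filter_upwards [coeFn_toC D, coeFn_ofCont _ (hψ.continuous_partialDeriv i)] with x hx hx2
    rw [hx, hx2]; push_cast; rfl
  have e2 : (∫ x, (P x : ℂ) * W x).re = ∫ x, (Complex.reCLM.compLp W : L2) x * ψ x := by
    have hint : Integrable fun x => (P x : ℂ) * W x := by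
      have := L2.integrable_inner (𝕜 := ℂ) (toC P) W
      refine this.congr ?_
      filter_upwards [coeFn_toC P] with x hx
      rw [hx]; simp [RCLike.inner_apply, mul_comm]
    have h6 := Complex.reCLM.integral_comp_comm hint
    simp only [Complex.reCLM_apply] at h6
    rw [← h6]
    refine integral_congr_ae ?_
    filter_upwards [Complex.reCLM.coeFn_compLp W, coeFn_ofCont _ hψ.continuous] with x hx hx2
    rw [hx, hx2, Complex.re_ofReal_mul, mul_comm]; rfl
  rw [e1] at h5
  have h7 := congrArg Complex.re h5
  rw [Complex.ofReal_re, Complex.neg_re, Complex.conj_re, e2] at h7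
  exact h7

theorem isWeakPartial_weakPartial {w : L2} (hw : sobNorm 1 w < ⊤) (i : Fin 3) :
    IsWeakPartial i w (weakPartial i w) := by
  have h := exists_isWeakPartial hw i
  rw [weakPartial, dif_pos h]
  exact h.choose_spec

/-- The derivative of a real mode is again a real mode, hence an admissible test function, and two
derivatives produce $-k_i^2$. Only the defining property of the weak derivative is used, so the
choice in `weakPartial` is harmless. -/
theorem integral_weakPartial_mul {w : L2} (hw : sobNorm 1 w < ⊤) (i : Fin 3) (c : ℂ)
    (k : Fin 3 → ℤ) :
    ∫ x, weakPartial i w x * partialDeriv i (trig c k) x = (k i : ℝ) ^ 2 * ∫ x, w x * trig c k x := by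
  simp only [partialDeriv_trig]
  have h := isWeakPartial_weakPartial hw i _ (smooth_trig (Complex.I * (k i : ℂ) * c) k)
  simp only [partialDeriv_trig] at h
  rw [← neg_eq_iff_eq_neg] at h
  rw [← h, ← integral_const_mul, ← integral_neg]
  refine integral_congr_ae (Eventually.of_forall fun x => ?_)
  have : Complex.I * (k i : ℂ) * (Complex.I * (k i : ℂ) * c) = ((-(k i : ℝ) ^ 2 : ℝ) : ℂ) * c := by
    push_cast; linear_combination ((k i : ℂ) ^ 2 * c) * Complex.I_sq
  simp only [this, real_mul_trig]
  ring

end WeakDerivative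

/-! ### Second differences and monotone functions -/

section Translation

/-- Translation by `y` on `L²`. -/
def shift (y : Torus) (w : L2) : L2 :=
  Lp.compMeasurePreserving (fun x => x + y) (measurePreserving_add_right volume y) w

theorem coeFn_shift (y : Torus) (w : L2) : shift y w =ᵐ[volume] fun x => w (x + y) :=
  Lp.coeFn_compMeasurePreserving w (measurePreserving_add_right volume y)

/-- The symmetric second difference `w - (w(· + y) + w(· - y)) / 2`. -/
def secondDiff (y : Torus) (w : L2) : L2 := w - (1 / 2 : ℝ) • (shift y w + shift (-y) w)

theorem coeFn_secondDiff (y : Torus) (w : L2) :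
    secondDiff y w =ᵐ[volume] fun x => w x - (w (x + y) + w (x + -y)) / 2 := by
  filter_upwards [Lp.coeFn_sub w ((1 / 2 : ℝ) • (shift y w + shift (-y) w)),
    Lp.coeFn_smul (1 / 2 : ℝ) (shift y w + shift (-y) w),
    Lp.coeFn_add (shift y w) (shift (-y) w), coeFn_shift y w, coeFn_shift (-y) w]
    with x h1 h2 h3 h4 h5
  rw [secondDiff, h1, Pi.sub_apply, h2, Pi.smul_apply, h3, Pi.add_apply, h4, h5, smul_eq_mul]
  ring

theorem coeff_secondDiff (y : Torus) (w : L2) (k : Fin 3 → ℤ) :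
    coeff (secondDiff y w) k = ((1 - (expo k y).re : ℝ) : ℂ) * coeff w k := by
  rw [← coeffCLM_apply, secondDiff, map_sub, map_smul, map_add]
  simp only [coeffCLM_apply]
  rw [coeff_congr (coeFn_shift y w), coeff_congr (coeFn_shift (-y) w), coeff_shift, coeff_shift,
    expo_neg_arg, ← add_mul, Complex.add_conj, Complex.real_smul]
  push_cast
  ring

theorem one_sub_re_expo_nonneg (k : Fin 3 → ℤ) (y : Torus) : 0 ≤ 1 - (expo k y).re := by
  have := (Complex.re_le_norm (expo k y)).trans (norm_expo k y).le
  linarith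

theorem one_sub_re_expo_le (k : Fin 3 → ℤ) (y : Torus) : 1 - (expo k y).re ≤ 2 := by
  have := (Complex.abs_re_le_norm (expo k y)).trans (norm_expo k y).le
  linarith [(abs_le.1 this).1]

theorem sobNorm_secondDiff_le (y : Torus) (w : L2) :
    sobNorm 1 (secondDiff y w) ≤ 2 * sobNorm 1 w := by
  have h : sobNorm 1 (secondDiff y w) ^ 2 ≤ (2 * sobNorm 1 w) ^ 2 := by
    rw [mul_pow, sobNorm_sq, sobNorm_sq, mul_left_comm]
    refine mul_le_mul' le_rfl ?_
    rw [← ENNReal.tsum_mul_left]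
    refine ENNReal.tsum_le_tsum fun k => ?_
    rw [show (2 : ℝ≥0∞) ^ 2 = ENNReal.ofReal 4 by norm_num, ← ENNReal.ofReal_mul (by norm_num)]
    apply ENNReal.ofReal_le_ofReal
    rw [coeff_secondDiff, norm_mul, Complex.norm_real, mul_pow, Real.norm_eq_abs, sq_abs]
    have h1 := one_sub_re_expo_nonneg k y
    have h2 := one_sub_re_expo_le k y
    have h3 : (1 - (expo k y).re) ^ 2 ≤ 4 := by nlinarith
    have h4 : 0 ≤ (1 + eig k) ^ (1 : ℝ) := by have := eig_nonneg k; positivity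
    calc (1 + eig k) ^ (1 : ℝ) * ((1 - (expo k y).re) ^ 2 * ‖coeff w k‖ ^ 2)
        ≤ (1 + eig k) ^ (1 : ℝ) * (4 * ‖coeff w k‖ ^ 2) := by gcongr
      _ = _ := by ring
  exact (ENNReal.pow_le_pow_left_iff (by norm_num)).1 h

theorem memLp_six {w : L2} (hw : sobNorm 1 w < ⊤) : MemLp w 6 volume :=
  ⟨Lp.aestronglyMeasurable w,
    (eLpNorm_six_le w).trans_lt (ENNReal.mul_lt_top ENNReal.coe_lt_top hw)⟩

theorem integrable_mul_of_memLp {h z : Torus → ℝ} (hh : MemLp h (6 / 5) volume)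
    (hz : MemLp z 6 volume) : Integrable fun x => h x * z x :=
  memLp_one_iff_integrable.1 (hz.smul hh)

/-- Monotone functions of `w` correlate nonnegatively with second differences of `w`. -/
theorem integral_comp_mul_secondDiff_nonneg {h : ℝ → ℝ} (hmono : Monotone h) {w : L2}
    (hh : MemLp (fun x => h (w x)) (6 / 5) volume) (hw : MemLp w 6 volume) (y : Torus) :
    0 ≤ ∫ x, h (w x) * secondDiff y w x := by
  have mp := measurePreserving_add_right (volume : Measure Torus) y
  have mp' := measurePreserving_add_right (volume : Measure Torus) (-y)
  have hw1 : MemLp (fun x => w (x + y)) 6 volume := hw.comp_measurePreserving mp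
  have hw2 : MemLp (fun x => w (x + -y)) 6 volume := hw.comp_measurePreserving mp'
  have hh1 : MemLp (fun x => h (w (x + y))) (6 / 5) volume := hh.comp_measurePreserving mp
  have i1 := integrable_mul_of_memLp hh hw
  have i2 := integrable_mul_of_memLp hh hw1
  have i3 := integrable_mul_of_memLp hh hw2
  have i4 := integrable_mul_of_memLp hh1 hw
  have i5 := integrable_mul_of_memLp hh1 hw1
  have e0 : ∫ x, h (w x) * secondDiff y w x =
      ∫ x, (h (w x) * w x - 1 / 2 * (h (w x) * w (x + y)) - 1 / 2 * (h (w x) * w (x + -y))) := by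
    refine integral_congr_ae ?_
    filter_upwards [coeFn_secondDiff y w] with x hx
    rw [hx]; ring
  have e1 : ∫ x, h (w x) * w x = ∫ x, h (w (x + y)) * w (x + y) :=
    (integral_add_right_eq_self (fun x => h (w x) * w x) y).symm
  have e2 : ∫ x, h (w x) * w (x + -y) = ∫ x, h (w (x + y)) * w x := by
    rw [← integral_add_right_eq_self (fun x => h (w x) * w (x + -y)) y]
    simp
  have e3 : ∫ x, (h (w x) - h (w (x + y))) * (w x - w (x + y)) =
      ∫ x, (h (w x) * w x - h (w x) * w (x + y) - h (w (x + y)) * w x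
        + h (w (x + y)) * w (x + y)) := by
    congr 1; ext x; ring
  -- By translation invariance (`e1`, `e2`) this integral is twice the one to be bounded, and
  -- monotonicity makes its integrand nonnegative pointwise.
  have hpos : 0 ≤ ∫ x, (h (w x) - h (w (x + y))) * (w x - w (x + y)) := by
    refine integral_nonneg fun x => ?_
    rcases le_total (w x) (w (x + y)) with hle | hle
    · exact mul_nonneg_of_nonpos_of_nonpos (sub_nonpos.2 (hmono hle)) (sub_nonpos.2 hle)
    · exact mul_nonneg (sub_nonneg.2 (hmono hle)) (sub_nonneg.2 hle)
  have j1 : Integrable fun x => h (w x) * w x - h (w x) * w (x + y) := i1.sub i2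
  have j2 : Integrable fun x => h (w x) * w x - h (w x) * w (x + y) - h (w (x + y)) * w x :=
    j1.sub i4
  have j3 : Integrable fun x => h (w x) * w x - 1 / 2 * (h (w x) * w (x + y)) :=
    i1.sub (i2.const_mul _)
  rw [e3, integral_add j2 i5, integral_sub j1 i4, integral_sub i1 i2, ← e1] at hpos
  rw [e0, integral_sub j3 (i3.const_mul _),
    integral_sub i1 (i2.const_mul _), integral_const_mul, integral_const_mul, e2]
  linarith

end Translation

/-! ### The quintic nonlinearity on $H^1$ -/

section Nonlinear

/-- At most quintic growth. -/
def QuinticGrowth (A : ℝ) (h : ℝ → ℝ) : Prop := ∀ s, |h s| ≤ A * (1 + |s| ^ 5)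

theorem one_le_six_fifths : (1 : ℝ≥0∞) ≤ 6 / 5 := by
  rw [ENNReal.le_div_iff_mul_le (by simp) (by simp)]; norm_num

theorem eLpNorm_pow_five (w : Torus → ℝ) :
    eLpNorm (fun x => |w x| ^ 5) (6 / 5) volume = eLpNorm w 6 volume ^ 5 := by
  have h := eLpNorm_norm_rpow (μ := (volume : Measure Torus)) (p := 6 / 5) w (q := 5) (by norm_num)
  have h2 : (6 / 5 : ℝ≥0∞) * ENNReal.ofReal 5 = 6 := by
    rw [show ENNReal.ofReal 5 = 5 by norm_num]
    exact ENNReal.div_mul_cancel (by simp) (by simp)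
  rw [h2] at h
  rw [← ENNReal.rpow_natCast]
  push_cast
  rw [← h]
  congr 1; ext x
  rw [Real.norm_eq_abs, ← Real.rpow_natCast]; norm_num

/-- Since $5\cdot\frac65=6$, the fifth power maps $L^6$ into $L^{6/5}$. This is the critical case of
the embedding $H^1\subset L^6$. -/
theorem eLpNorm_comp_le {A : ℝ} (hA : 0 ≤ A) {h : ℝ → ℝ} (hg : QuinticGrowth A h) (w : L2) :
    eLpNorm (fun x => h (w x)) (6 / 5) volume ≤ ENNReal.ofReal A *
      (eLpNorm (fun _ : Torus => (1 : ℝ)) (6 / 5) volume + (sobConst * sobNorm 1 w) ^ 5) := by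
  have h1 : eLpNorm (fun x => h (w x)) (6 / 5) volume
      ≤ eLpNorm (fun x => A * (1 + |w x| ^ 5)) (6 / 5) volume :=
    eLpNorm_mono_real fun x => hg (w x)
  refine h1.trans ?_
  have h2 := eLpNorm_const_smul (μ := (volume : Measure Torus)) A (fun x => 1 + |w x| ^ 5) (6 / 5)
  have h3 : eLpNorm (fun x => A * (1 + |w x| ^ 5)) (6 / 5) volume
      = ENNReal.ofReal A * eLpNorm (fun x => 1 + |w x| ^ 5) (6 / 5) volume := by
    rw [← ofReal_norm, Real.norm_of_nonneg hA] at h2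
    exact h2
  rw [h3]
  gcongr
  refine (eLpNorm_add_le aestronglyMeasurable_const ?_ one_le_six_fifths).trans ?_
  · exact (Lp.aestronglyMeasurable w).norm.pow 5
  · rw [eLpNorm_pow_five]
    gcongr
    exact eLpNorm_six_le w

theorem memLp_comp {A : ℝ} (hA : 0 ≤ A) {h : ℝ → ℝ} (hc : Continuous h) (hg : QuinticGrowth A h)
    {w : L2} (hw : sobNorm 1 w < ⊤) : MemLp (fun x => h (w x)) (6 / 5) volume := by
  refine ⟨hc.comp_aestronglyMeasurable (Lp.aestronglyMeasurable w),
    (eLpNorm_comp_le hA hg w).trans_lt ?_⟩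
  refine ENNReal.mul_lt_top ENNReal.ofReal_lt_top (ENNReal.add_lt_top.2 ⟨?_, ?_⟩)
  · exact (memLp_const (1 : ℝ)).2
  · exact ENNReal.pow_lt_top (ENNReal.mul_lt_top ENNReal.coe_lt_top hw)

theorem memLp_one_pow_five {w : L2} (hw : sobNorm 1 w < ⊤) :
    Integrable fun x => 1 + |w x| ^ 5 := by
  refine (integrable_const _).add ?_
  have : MemLp (fun x => |w x| ^ 5) (6 / 5) volume :=
    ⟨(Lp.aestronglyMeasurable w).norm.pow 5, by
      rw [eLpNorm_pow_five]; exact ENNReal.pow_lt_top (memLp_six hw).2⟩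
  exact this.integrable one_le_six_fifths

/-- Truncation to `[-M, M]`. -/
def clamp (M s : ℝ) : ℝ := max (-M) (min s M)

theorem abs_clamp_le {M : ℝ} (hM : 0 ≤ M) (s : ℝ) : |clamp M s| ≤ |s| := by
  unfold clamp
  rw [abs_le]
  constructor
  · rcases le_total s M with h | h
    · rw [min_eq_left h]; exact (neg_abs_le s).trans (le_max_right _ _)
    · rw [min_eq_right h]; have := abs_nonneg s; exact (by linarith : -|s| ≤ M).trans (le_max_right _ _)
  · exact max_le (by linarith [abs_nonneg s]) ((min_le_left _ _).trans (le_abs_self s))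

theorem clamp_mem {M : ℝ} (hM : 0 ≤ M) (s : ℝ) : clamp M s ∈ Set.Icc (-M) M :=
  ⟨le_max_left _ _, max_le (by linarith) (min_le_right _ _)⟩

theorem clamp_eq {M s : ℝ} (h : |s| ≤ M) : clamp M s = s := by
  obtain ⟨h1, h2⟩ := abs_le.1 h
  rw [clamp, min_eq_left h2, max_eq_right h1]

theorem lipschitzWith_clamp (M : ℝ) : LipschitzWith 1 (clamp M) :=
  (LipschitzWith.id.min_const M).const_max (-M)

/-- A $C^1$ function is Lipschitz on $[-M,M]$, and truncation is $1$-Lipschitz. Subtracting $h(0)$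
makes the composite vanish at $0$, so that it acts continuously on $L^2$. -/
theorem exists_lipschitzWith_comp_clamp {h : ℝ → ℝ} (hd : ContDiff ℝ 1 h) {M : ℝ} (hM : 0 ≤ M) :
    ∃ L : ℝ≥0, LipschitzWith L fun s => h (clamp M s) - h 0 := by
  obtain ⟨B, hB⟩ := (isCompact_Icc (a := -M) (b := M)).exists_bound_of_continuousOn
    (hd.continuous_deriv (by simp)).continuousOn
  have h1 : LipschitzOnWith B.toNNReal h (Set.Icc (-M) M) := by
    refine (convex_Icc (-M) M).lipschitzOnWith_of_nnnorm_deriv_le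
      (fun x _ => hd.differentiable (by simp) x) fun x hx => ?_
    rw [← NNReal.coe_le_coe, coe_nnnorm]
    exact (hB x hx).trans (Real.le_coe_toNNReal B)
  refine ⟨B.toNNReal, LipschitzWith.of_dist_le_mul fun x y => ?_⟩
  rw [dist_sub_right]
  refine (h1.dist_le_mul _ (clamp_mem hM x) _ (clamp_mem hM y)).trans ?_
  gcongr
  simpa using (lipschitzWith_clamp M).dist_le_mul x y

/-- Measurability of $t\mapsto u(t)$ is known only with values in $L^2$, where $w\mapsto h\circ w$
need not be continuous. The truncated nonlinearities are Lipschitz on $L^2$, and their coefficients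
converge for each $t$ with $u(t)\in H^1$ by dominated convergence. -/
theorem aestronglyMeasurable_coeff_comp {A : ℝ} (hA : 0 ≤ A) {h : ℝ → ℝ} (hd : ContDiff ℝ 1 h)
    (hg : QuinticGrowth A h) {μ : Measure ℝ} {u : ℝ → L2} (hu : AEStronglyMeasurable u μ)
    (hs : ∀ᵐ t ∂μ, sobNorm 1 (u t) < ⊤) (k : Fin 3 → ℤ) :
    AEStronglyMeasurable (fun t => coeff (fun x => h (u t x)) k) μ := by
  have h0 : AEStronglyMeasurable (fun t => coeff (fun x => h (u t x) - h 0) k) μ := by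
    refine aestronglyMeasurable_of_tendsto_ae atTop
      (f := fun (n : ℕ) t => coeff (fun x => h (clamp n (u t x)) - h 0) k) (fun n => ?_) ?_
    · obtain ⟨L, hL⟩ := exists_lipschitzWith_comp_clamp hd (M := n) (Nat.cast_nonneg n)
      have hz : h (clamp n 0) - h 0 = 0 := by rw [clamp_eq (by simp), sub_self]
      have hc : Continuous fun w : L2 => coeff (hL.compLp hz w) k :=
        (continuous_coeff k).comp (hL.continuous_compLp hz)
      refine (hc.comp_aestronglyMeasurable hu).congr (Eventually.of_forall fun t => ?_)
      exact coeff_congr (hL.coeFn_compLp hz (u t)) k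
    · filter_upwards [hs] with t ht
      unfold coeff
      refine Tendsto.const_mul _ ?_
      -- Truncation does not increase $|u|$, so $|h(u_n)|+|h(0)|\le A(1+|u|^5)+A\le 2A(1+|u|^5)$ for
      -- the truncations $u_n$ of $u$.
      refine tendsto_integral_of_dominated_convergence (fun x => (2 * A) * (1 + |u t x| ^ 5))
        (fun n => ?_) ((memLp_one_pow_five ht).const_mul _) (fun n => ?_) ?_
      · refine AEStronglyMeasurable.mul ?_ (continuous_expo _).aestronglyMeasurable
        refine Complex.continuous_ofReal.comp_aestronglyMeasurable ?_
        exact ((hd.continuous.comp (lipschitzWith_clamp n).continuous).sub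
          continuous_const).comp_aestronglyMeasurable (Lp.aestronglyMeasurable (u t))
      · refine Eventually.of_forall fun x => ?_
        rw [norm_mul, norm_expo, mul_one, Complex.norm_real, Real.norm_eq_abs]
        have h1 := hg (clamp n (u t x))
        have h2 := hg 0
        have h3 := abs_clamp_le (M := n) (Nat.cast_nonneg n) (u t x)
        have h4 : |clamp n (u t x)| ^ 5 ≤ |u t x| ^ 5 := pow_le_pow_left₀ (abs_nonneg _) h3 5
        have h5 : 0 ≤ |u t x| ^ 5 := by positivity
        have h6 := abs_sub (h (clamp n (u t x))) (h 0)
        simp only [abs_zero, ne_eq, OfNat.ofNat_ne_zero, not_false_eq_true, zero_pow,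
          add_zero, mul_one] at h2
        nlinarith
      · refine Eventually.of_forall fun x => ?_
        refine tendsto_const_nhds.congr' ?_
        filter_upwards [eventually_ge_atTop ⌈|u t x|⌉₊] with n hn
        rw [clamp_eq ((Nat.le_ceil _).trans (by exact_mod_cast hn))]
  have h1 : AEStronglyMeasurable
      (fun t => coeff (fun x => h (u t x) - h 0) k + coeff (fun _ => h 0) k) μ :=
    h0.add aestronglyMeasurable_const
  refine h1.congr ?_
  filter_upwards [hs] with t ht
  have hi : Integrable fun x => h (u t x) :=
    (memLp_comp hA hd.continuous hg ht).integrable one_le_six_fifths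
  have hi2 : Integrable fun x => h (u t x) - h 0 := hi.sub (integrable_const _)
  rw [← coeff_add hi2 (integrable_const _)]
  congr 1; ext x; ring

/-- The lower bound on $f'$ enters the argument only through this monotonicity. -/
theorem Nonlinearity.monotone {C κ K : ℝ} {f : ℝ → ℝ} (hf : Nonlinearity C κ K f) :
    Monotone fun s => f s + K * s := by
  have hd : Differentiable ℝ f := hf.contDiff.differentiable (by simp)
  refine monotone_of_deriv_nonneg (hd.add (differentiable_id.const_mul K)) fun s => ?_
  have := ((hd s).hasDerivAt.add ((hasDerivAt_id s).const_mul K)).deriv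
  have h2 := hf.deriv_ge s
  have h3 : deriv (fun s => f s + K * s) s = deriv f s + K * 1 := this
  rw [h3]; linarith

theorem Nonlinearity.quinticGrowth {C κ K : ℝ} {f : ℝ → ℝ} (hC : 0 < C)
    (hf : Nonlinearity C κ K f) : QuinticGrowth (|f 0| + 2 * C) f := by
  intro s
  have hd : Differentiable ℝ f := hf.contDiff.differentiable (by simp)
  have h1 : ‖f s - f 0‖ ≤ C * (1 + |s| ^ 4) * ‖s - 0‖ := by
    refine (convex_Icc (-|s|) |s|).norm_image_sub_le_of_norm_deriv_le (fun x _ => hd x)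
      (fun x hx => ?_) ⟨by linarith [abs_nonneg s], abs_nonneg s⟩ ⟨neg_abs_le s, le_abs_self s⟩
    refine (hf.growth x).trans ?_
    have hx' : |x| ≤ |s| := abs_le.2 hx
    have := pow_le_pow_left₀ (abs_nonneg x) hx' 4
    exact mul_le_mul_of_nonneg_left (by linarith) hC.le
  rw [sub_zero, Real.norm_eq_abs, Real.norm_eq_abs] at h1
  have h2 : |f s| ≤ |f 0| + |f s - f 0| := by
    have := abs_add_le (f 0) (f s - f 0); simpa using this
  have h3 : |s| ≤ 1 + |s| ^ 5 := by
    rcases le_total |s| 1 with h | h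
    · have : 0 ≤ |s| ^ 5 := by positivity
      linarith
    · have := le_self_pow₀ h (n := 5) (by norm_num); linarith
  have h4 : 0 ≤ |s| ^ 5 := by positivity
  have h5 := abs_nonneg (f 0)
  calc |f s| ≤ |f 0| + C * (1 + |s| ^ 4) * |s| := h2.trans (by linarith)
    _ = |f 0| + C * |s| + C * |s| ^ 5 := by ring
    _ ≤ |f 0| + C * (1 + |s| ^ 5) + C * |s| ^ 5 := by gcongr
    _ ≤ _ := by nlinarith

end Nonlinear

/-! ### Weak derivatives in time -/

section Time

/-- Smooth functions of time with compact support in `(0, T)`. -/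
structure IsTimeTest (T : ℝ) (θ : ℝ → ℝ) : Prop where
  smooth : ContDiff ℝ ∞ θ
  supp : ∃ a b : ℝ, 0 < a ∧ b < T ∧ ∀ t, t ∉ Set.Icc a b → θ t = 0

/-- `V` is the distributional derivative of `U` on `(0, T)`. -/
def HasWeakDeriv (T : ℝ) (U V : ℝ → ℝ) : Prop :=
  ∀ θ, IsTimeTest T θ →
    ∫ t in Set.Ioo 0 T, deriv θ t * U t = -∫ t in Set.Ioo 0 T, θ t * V t

theorem IsTimeTest.of_tsupport {T : ℝ} (hT : 0 < T) {g : ℝ → ℝ} (hg : ContDiff ℝ ∞ g)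
    (hc : HasCompactSupport g) (hs : tsupport g ⊆ Set.Ioo 0 T) : IsTimeTest T g := by
  refine ⟨hg, ?_⟩
  -- The extra point keeps the compact set nonempty when $g=0$, so that its least and greatest
  -- elements exist.
  set K := insert (T / 2) (tsupport g)
  have hK : IsCompact K := hc.isCompact.insert _
  have hne : K.Nonempty := ⟨T / 2, Set.mem_insert _ _⟩
  have hKs : K ⊆ Set.Ioo 0 T :=
    Set.insert_subset ⟨by linarith, by linarith⟩ hs
  obtain ⟨a, ha⟩ := hK.exists_isLeast hne
  obtain ⟨b, hb⟩ := hK.exists_isGreatest hne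
  refine ⟨a, b, (hKs ha.1).1, (hKs hb.1).2, fun t ht => ?_⟩
  by_contra h
  have : t ∈ K := Set.mem_insert_of_mem _ (subset_tsupport g h)
  exact ht ⟨ha.2 this, hb.2 this⟩

theorem integral_Ioo_eq_interval {T : ℝ} (hT : 0 ≤ T) (F : ℝ → ℝ) :
    ∫ t in Set.Ioo 0 T, F t = ∫ t in (0 : ℝ)..T, F t := by
  rw [intervalIntegral.integral_of_le hT, integral_Ioc_eq_integral_Ioo]

theorem intervalIntegrable_of_Ioo {T : ℝ} (hT : 0 ≤ T) {V : ℝ → ℝ}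
    (hV : IntegrableOn V (Set.Ioo 0 T)) : IntervalIntegrable V volume 0 T :=
  (intervalIntegrable_iff_integrableOn_Ioo_of_le hT).2 hV

theorem absolutelyContinuous_primitive {T : ℝ} {V : ℝ → ℝ}
    (hV : IntervalIntegrable V volume 0 T) (c : ℝ) :
    AbsolutelyContinuousOnInterval (fun t => c + ∫ s in (0 : ℝ)..t, V s) 0 T := by
  have h1 := hV.absolutelyContinuousOnInterval_intervalIntegral (c := 0) (by simp)
  have h2 : AbsolutelyContinuousOnInterval (fun _ : ℝ => c) 0 T :=
    (LipschitzWith.const c).lipschitzOnWith.absolutelyContinuousOnInterval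
  exact h2.add h1

theorem deriv_primitive_ae {T : ℝ} {V : ℝ → ℝ} (hV : IntervalIntegrable V volume 0 T) (c : ℝ) :
    ∀ᵐ t, t ∈ Set.uIcc 0 T → deriv (fun t => c + ∫ s in (0 : ℝ)..t, V s) t = V t := by
  filter_upwards [hV.ae_hasDerivAt_integral] with t ht htm
  exact ((ht htm 0 (by simp)).const_add c).deriv

theorem hasWeakDeriv_primitive {T : ℝ} (hT : 0 < T) {V : ℝ → ℝ}
    (hV : IntervalIntegrable V volume 0 T) :
    HasWeakDeriv T (fun t => 0 + ∫ s in (0 : ℝ)..t, V s) V := by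
  rintro θ ⟨hθ, a, b, ha, hb, hab⟩
  have h0 : θ 0 = 0 := hab 0 fun h => by linarith [h.1]
  have hT0 : θ T = 0 := hab T fun h => by linarith [h.2]
  have hθac : AbsolutelyContinuousOnInterval θ 0 T :=
    ((hθ.of_le (by simp)).contDiffOn).absolutelyContinuousOnInterval
  have h := hθac.integral_mul_deriv_eq_deriv_mul (absolutelyContinuous_primitive hV 0)
  rw [h0, hT0] at h
  rw [integral_Ioo_eq_interval hT.le, integral_Ioo_eq_interval hT.le]
  have h2 : ∫ t in (0 : ℝ)..T, θ t * deriv (fun t => 0 + ∫ s in (0 : ℝ)..t, V s) t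
      = ∫ t in (0 : ℝ)..T, θ t * V t := by
    apply intervalIntegral.integral_congr_ae
    filter_upwards [deriv_primitive_ae hV 0] with t ht htm
    rw [ht (Set.uIoc_subset_uIcc htm)]
  rw [h2] at h
  rw [h]; ring

/-- The primitive vanishes to the left of the support of $q$ by definition, and to its right because
the mean is zero. -/
theorem isTimeTest_primitive {T : ℝ} {q : ℝ → ℝ} (hq : IsTimeTest T q)
    (h0 : ∫ t in (0 : ℝ)..T, q t = 0) :
    IsTimeTest T (fun t => ∫ s in (0 : ℝ)..t, q s) ∧
      deriv (fun t => ∫ s in (0 : ℝ)..t, q s) = q := by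
  have hc : Continuous q := hq.smooth.continuous
  have hd : deriv (fun t => ∫ s in (0 : ℝ)..t, q s) = q := by
    ext t; exact hc.deriv_integral q 0 t
  refine ⟨⟨?_, ?_⟩, hd⟩
  · rw [contDiff_infty_iff_deriv, hd]
    refine ⟨fun t => ?_, hq.smooth⟩
    exact (intervalIntegral.integral_hasDerivAt_right (hc.intervalIntegrable _ _)
      hc.aestronglyMeasurable.stronglyMeasurableAtFilter hc.continuousAt).differentiableAt
  · obtain ⟨a, b, ha, hb, hab⟩ := hq.supp
    refine ⟨a, b, ha, hb, fun t ht => ?_⟩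
    rcases lt_or_ge t a with h | h
    · rw [intervalIntegral.integral_congr (g := fun _ => (0 : ℝ))]
      · simp
      · intro s hs
        refine hab s fun hs2 => ?_
        rcases Set.mem_uIcc.1 hs with h3 | h3
        · linarith [hs2.1, h3.2]
        · linarith [hs2.1, h3.2]
    · have hbt : b < t := by by_contra h2; exact ht ⟨h, not_lt.1 h2⟩
      rw [← intervalIntegral.integral_add_adjacent_intervals (b := T)
        (hc.intervalIntegrable _ _) (hc.intervalIntegrable _ _), h0, zero_add,
        intervalIntegral.integral_congr (g := fun _ => (0 : ℝ))]
      · simp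
      · intro s hs
        refine hab s fun hs2 => ?_
        rcases Set.mem_uIcc.1 hs with h3 | h3
        · linarith [hs2.2, h3.1]
        · linarith [hs2.2, h3.1]

theorem exists_isTimeTest_integral_one {T : ℝ} (hT : 0 < T) :
    ∃ ρ, IsTimeTest T ρ ∧ ∫ t in (0 : ℝ)..T, ρ t = 1 := by
  let η : ContDiffBump (T / 2 : ℝ) := ⟨T / 8, T / 4, by positivity, by linarith⟩
  have hs : tsupport (η.normed volume) ⊆ Set.Ioo 0 T := by
    rw [η.tsupport_normed_eq]
    intro t ht
    rw [Real.closedBall_eq_Icc] at ht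
    have h1 : η.rOut = T / 4 := rfl
    rw [h1] at ht
    exact ⟨by linarith [ht.1], by linarith [ht.2]⟩
  refine ⟨η.normed volume, IsTimeTest.of_tsupport hT η.contDiff_normed
    η.hasCompactSupport_normed hs, ?_⟩
  rw [intervalIntegral.integral_of_le hT.le,
    setIntegral_eq_integral_of_forall_compl_eq_zero, η.integral_normed]
  intro t ht
  exact image_eq_zero_of_notMem_tsupport fun h => ht (Set.Ioo_subset_Ioc_self (hs h))

theorem integrable_mul_of_continuous {T : ℝ} {g N : ℝ → ℝ} (hg : Continuous g)
    (hN : IntegrableOn N (Set.Ioo 0 T)) : IntegrableOn (fun t => g t * N t) (Set.Ioo 0 T) := by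
  obtain ⟨B, hB⟩ := (isCompact_Icc (a := 0) (b := T)).exists_bound_of_continuousOn hg.continuousOn
  refine Integrable.bdd_mul (c := B) hN hg.aestronglyMeasurable ?_
  filter_upwards [ae_restrict_mem measurableSet_Ioo] with t ht
  exact hB t (Set.Ioo_subset_Icc_self ht)

/-- The du Bois-Reymond lemma. -/
theorem ae_eq_const_of_hasWeakDeriv_zero {T : ℝ} (hT : 0 < T) {N : ℝ → ℝ}
    (hN : IntegrableOn N (Set.Ioo 0 T))
    (h : ∀ θ, IsTimeTest T θ → ∫ t in Set.Ioo 0 T, deriv θ t * N t = 0) :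
    ∃ c, ∀ᵐ t ∂volume.restrict (Set.Ioo 0 T), N t = c := by
  obtain ⟨ρ, hρ, hρ1⟩ := exists_isTimeTest_integral_one hT
  set c := ∫ t in Set.Ioo 0 T, ρ t * N t
  refine ⟨c, ?_⟩
  have hNc : IntegrableOn (fun t => N t - c) (Set.Ioo 0 T) :=
    hN.sub (integrableOn_const (by simp))
  have key := isOpen_Ioo.ae_eq_zero_of_integral_contDiff_smul_eq_zero
    (hNc.locallyIntegrableOn) (fun g hg hgc hgs => ?_)
  · rw [ae_restrict_iff' measurableSet_Ioo]
    filter_upwards [key] with t ht htm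
    linarith [ht htm]
  · have hgt := IsTimeTest.of_tsupport hT hg hgc hgs
    set I := ∫ t in (0 : ℝ)..T, g t
    -- Subtracting the multiple of $\rho$ with the same mean makes $g-I\rho$ the derivative of a
    -- test function. Hence $\int gN=I\int\rho N=Ic=\int gc$.
    have hq : IsTimeTest T (fun t => g t - I * ρ t) := by
      refine ⟨hg.sub (contDiff_const.mul hρ.smooth), ?_⟩
      obtain ⟨a, b, ha, hb, hab⟩ := hgt.supp
      obtain ⟨a', b', ha', hb', hab'⟩ := hρ.supp
      refine ⟨min a a', max b b', lt_min ha ha', max_lt hb hb', fun t ht => ?_⟩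
      rw [hab t fun h => ht ⟨(min_le_left _ _).trans h.1, h.2.trans (le_max_left _ _)⟩,
        hab' t fun h => ht ⟨(min_le_right _ _).trans h.1, h.2.trans (le_max_right _ _)⟩]
      simp
    have hq0 : ∫ t in (0 : ℝ)..T, (g t - I * ρ t) = 0 := by
      have hρi : IntervalIntegrable (fun t => I * ρ t) volume 0 T :=
        (continuous_const.mul hρ.smooth.continuous).intervalIntegrable _ _
      rw [intervalIntegral.integral_sub (hg.continuous.intervalIntegrable _ _) hρi,
        intervalIntegral.integral_const_mul, hρ1]
      simp [I]
    obtain ⟨hΘ, hΘd⟩ := isTimeTest_primitive hq hq0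
    have h1 := h _ hΘ
    rw [hΘd] at h1
    have i1 := integrable_mul_of_continuous hg.continuous hN
    have i2 := integrable_mul_of_continuous hρ.smooth.continuous hN
    have h2 : ∫ t in Set.Ioo 0 T, (g t - I * ρ t) * N t
        = (∫ t in Set.Ioo 0 T, g t * N t) - I * c := by
      rw [← integral_const_mul, ← integral_sub i1 (i2.const_mul I)]
      congr 1; ext t; ring
    have h3 : ∫ t, g t • (N t - c) = ∫ t in Set.Ioo 0 T, g t * (N t - c) := by
      symm
      refine setIntegral_eq_integral_of_forall_compl_eq_zero fun t ht => ?_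
      rw [image_eq_zero_of_notMem_tsupport fun h => ht (hgs h), zero_mul]
    have i3 : IntegrableOn (fun t => g t * c) (Set.Ioo 0 T) :=
      integrable_mul_of_continuous hg.continuous (integrableOn_const (by simp))
    have h4 : ∫ t in Set.Ioo 0 T, g t * (N t - c)
        = (∫ t in Set.Ioo 0 T, g t * N t) - I * c := by
      simp only [mul_sub]
      rw [integral_sub i1 i3, integral_mul_const, integral_Ioo_eq_interval hT.le g]
    rw [h3, h4, ← h2, h1]

theorem HasWeakDeriv.exists_primitive {T : ℝ} (hT : 0 < T) {U V : ℝ → ℝ}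
    (hU : IntegrableOn U (Set.Ioo 0 T)) (hV : IntegrableOn V (Set.Ioo 0 T))
    (h : HasWeakDeriv T U V) :
    ∃ c, ∀ᵐ t ∂volume.restrict (Set.Ioo 0 T), U t = c + ∫ s in (0 : ℝ)..t, V s := by
  have hV' := intervalIntegrable_of_Ioo hT.le hV
  have hP := hasWeakDeriv_primitive hT hV'
  have hPi : IntegrableOn (fun t => 0 + ∫ s in (0 : ℝ)..t, V s) (Set.Ioo 0 T) := by
    have hc := (absolutelyContinuous_primitive hV' 0).continuousOn
    rw [Set.uIcc_of_le hT.le] at hc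
    exact (hc.integrableOn_Icc).mono_set Set.Ioo_subset_Icc_self
  obtain ⟨c, hc⟩ := ae_eq_const_of_hasWeakDeriv_zero hT (hU.sub hPi) (fun θ hθ => by
    have hdc : Continuous (deriv θ) := hθ.smooth.continuous_deriv (by simp)
    simp only [Pi.sub_apply, mul_sub]
    rw [integral_sub (integrable_mul_of_continuous hdc hU)
      (integrable_mul_of_continuous hdc hPi), h θ hθ, hP θ hθ, sub_self])
  refine ⟨c, ?_⟩
  filter_upwards [hc] with t ht
  simp only [Pi.sub_apply] at ht
  linarith

/-- The product rule for weakly differentiable functions, between almost all pairs of times. -/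
theorem HasWeakDeriv.mul_sub_mul {T : ℝ} (hT : 0 < T) {A A' B B' : ℝ → ℝ}
    (hA : IntegrableOn A (Set.Ioo 0 T)) (hA' : IntegrableOn A' (Set.Ioo 0 T))
    (hB : IntegrableOn B (Set.Ioo 0 T)) (hB' : IntegrableOn B' (Set.Ioo 0 T))
    (h₁ : HasWeakDeriv T A A') (h₂ : HasWeakDeriv T B B') :
    ∃ G : Set ℝ, (∀ᵐ t ∂volume.restrict (Set.Ioo 0 T), t ∈ G) ∧ ∀ a ∈ G, ∀ b ∈ G, a ≤ b →
      A b * B b - A a * B a = ∫ t in Set.Ioc a b, (A' t * B t + A t * B' t) := by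
  obtain ⟨c, hc⟩ := h₁.exists_primitive hT hA hA'
  obtain ⟨d, hd⟩ := h₂.exists_primitive hT hB hB'
  set P : ℝ → ℝ := fun t => c + ∫ s in (0 : ℝ)..t, A' s
  set R : ℝ → ℝ := fun t => d + ∫ s in (0 : ℝ)..t, B' s
  have iA := intervalIntegrable_of_Ioo hT.le hA'
  have iB := intervalIntegrable_of_Ioo hT.le hB'
  -- The admissible endpoints are the times at which both functions agree with their absolutely
  -- continuous representatives.
  refine ⟨{t | t ∈ Set.Ioo 0 T ∧ A t = P t ∧ B t = R t}, ?_, ?_⟩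
  · filter_upwards [hc, hd, ae_restrict_mem measurableSet_Ioo] with t h1 h2 h3
    exact ⟨h3, h1, h2⟩
  · rintro a ⟨ha, hPa, hRa⟩ b ⟨hb, hPb, hRb⟩ hab
    have hsub : Set.uIcc a b ⊆ Set.uIcc 0 T := by
      rw [Set.uIcc_of_le hab, Set.uIcc_of_le hT.le]
      exact Set.Icc_subset_Icc ha.1.le hb.2.le
    have h := ((absolutelyContinuous_primitive iA c).mono hsub).integral_deriv_mul_eq_sub
      ((absolutelyContinuous_primitive iB d).mono hsub)
    rw [hPa, hRa, hPb, hRb]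
    refine h.symm.trans ?_
    rw [intervalIntegral.integral_of_le hab]
    refine setIntegral_congr_ae measurableSet_Ioc ?_
    rw [ae_restrict_iff' measurableSet_Ioo] at hc hd
    filter_upwards [hc, hd, deriv_primitive_ae iA c, deriv_primitive_ae iB d] with t h1 h2 h3 h4 ht
    have htm : t ∈ Set.Ioo 0 T := ⟨ha.1.trans ht.1, ht.2.trans_lt hb.2⟩
    have htm' : t ∈ Set.uIcc 0 T := by
      rw [Set.uIcc_of_le hT.le]; exact Set.Ioo_subset_Icc_self htm
    rw [h3 htm', h4 htm', h1 htm, h2 htm]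

end Time

/-! ### A dyadic second-difference multiplier comparable to $|k|$ -/

section Multiplier

/-- With $\varphi(t)=6|t|/(1+|t|)$ and $s=|t|$, the right side is
$2\varphi(t/2)-\varphi(t)=6s^2/((2+s)(1+s))$. It dominates both bounds for $1-\cos t$ in their
ranges: $s^2/2$ for $s\le2$ and $2$ for $s\ge2$. The constant $6$ is the one for which the three
agree at $s=2$. -/
theorem one_sub_cos_le (t : ℝ) :
    1 - Real.cos t ≤ 2 * (6 * |t / 2| / (1 + |t / 2|)) - 6 * |t| / (1 + |t|) := by
  set s := |t| with hs
  have hs0 : 0 ≤ s := abs_nonneg t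
  have h2 : |t / 2| = s / 2 := by rw [abs_div, abs_two]
  rw [h2]
  have e : 2 * (6 * (s / 2) / (1 + s / 2)) - 6 * s / (1 + s) = 6 * s ^ 2 / ((2 + s) * (1 + s)) := by
    field_simp; ring
  rw [e, le_div_iff₀ (by positivity)]
  rcases le_total s 2 with h | h
  · have h3 := Real.one_sub_sq_div_two_le_cos (x := t)
    have h4 : t ^ 2 = s ^ 2 := (sq_abs t).symm
    have h5 : (1 - Real.cos t) ≤ s ^ 2 / 2 := by rw [← h4]; linarith
    have h6 : (2 + s) * (1 + s) ≤ 12 := by nlinarith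
    calc (1 - Real.cos t) * ((2 + s) * (1 + s)) ≤ s ^ 2 / 2 * 12 := by
          refine mul_le_mul h5 h6 (by positivity) (by positivity)
      _ = 6 * s ^ 2 := by ring
  · have h3 := Real.neg_one_le_cos t
    have h4 : 2 * ((2 + s) * (1 + s)) ≤ 6 * s ^ 2 := by nlinarith
    refine le_trans ?_ h4
    gcongr
    linarith

/-- Multiplied by $2^j$, the bound $2\varphi(t/2)-\varphi(t)$ at $t=x2^{-j}$ telescopes. The
surviving term $2^n\varphi(x2^{-n})$ is at most $6|x|$, uniformly in $n$. -/
theorem sum_dyadic_le_telescope (x : ℝ) (n : ℕ) :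
    ∑ j ∈ Finset.range n, 2 ^ j * (1 - Real.cos (x * (1 / 2) ^ j)) ≤
      2 ^ n * (6 * |x * (1 / 2) ^ n| / (1 + |x * (1 / 2) ^ n|)) - 6 * |x| / (1 + |x|) := by
  induction n with
  | zero => simp
  | succ n ih =>
    rw [Finset.sum_range_succ]
    have h := one_sub_cos_le (x * (1 / 2) ^ n)
    have e : x * (1 / 2) ^ n / 2 = x * (1 / 2) ^ (n + 1) := by ring
    rw [e] at h
    have h2 := mul_le_mul_of_nonneg_left h (by positivity : (0 : ℝ) ≤ 2 ^ n)
    rw [pow_succ (2 : ℝ) n]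
    linarith

theorem sum_dyadic_le (x : ℝ) (n : ℕ) :
    ∑ j ∈ Finset.range n, 2 ^ j * (1 - Real.cos (x * (1 / 2) ^ j)) ≤ 6 * |x| := by
  refine (sum_dyadic_le_telescope x n).trans ?_
  have h1 : 0 ≤ 6 * |x| / (1 + |x|) := by positivity
  have h2 : 6 * |x * (1 / 2) ^ n| / (1 + |x * (1 / 2) ^ n|) ≤ 6 * |x * (1 / 2) ^ n| :=
    div_le_self (by positivity) (by linarith [abs_nonneg (x * (1 / 2) ^ n)])
  have h3 : 2 ^ n * (6 * |x * (1 / 2) ^ n|) = 6 * |x| := by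
    rw [abs_mul, abs_of_pos (by positivity : (0 : ℝ) < (1 / 2) ^ n)]
    have : (2 : ℝ) ^ n * (1 / 2) ^ n = 1 := by rw [← mul_pow]; norm_num
    linear_combination (6 * |x|) * this
  have h4 := mul_le_mul_of_nonneg_left h2 (by positivity : (0 : ℝ) ≤ 2 ^ n)
  linarith

theorem le_sum_dyadic (m : ℤ) {n : ℕ} (hn : m.natAbs < n) :
    |(m : ℝ)| / 6 ≤ ∑ j ∈ Finset.range n, 2 ^ j * (1 - Real.cos ((m : ℝ) * (1 / 2) ^ j)) := by
  have hnn : ∀ j ∈ Finset.range n, 0 ≤ (2 : ℝ) ^ j * (1 - Real.cos ((m : ℝ) * (1 / 2) ^ j)) :=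
    fun j _ => mul_nonneg (by positivity) (by linarith [Real.cos_le_one ((m : ℝ) * (1 / 2) ^ j)])
  by_cases hm : m = 0
  · subst hm; simp
  have hm' : m.natAbs ≠ 0 := Int.natAbs_ne_zero.2 hm
  -- This single scale suffices: $|m|2^{-j}\in[1,2]$, where the cosine is at most $\cos1\le2/3$, so
  -- the term is at least $2^j/3\ge|m|/6$. The scale is available because $\log_2|m|<|m|<n$.
  set j := Nat.log 2 m.natAbs
  have hj : j ∈ Finset.range n :=
    Finset.mem_range.2 ((Nat.log_lt_self 2 hm').trans hn)
  refine le_trans ?_ (Finset.single_le_sum hnn hj)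
  have h1 : ((2 : ℝ) ^ j) ≤ |(m : ℝ)| := by
    have := Nat.pow_log_le_self 2 hm'
    rw [← Int.cast_abs, ← Nat.cast_natAbs]
    exact_mod_cast this
  have h2 : |(m : ℝ)| ≤ 2 * 2 ^ j := by
    have := (Nat.lt_pow_succ_log_self (b := 2) (by norm_num) m.natAbs).le
    rw [← Int.cast_abs, ← Nat.cast_natAbs]
    have h3 : ((m.natAbs : ℕ) : ℝ) ≤ 2 ^ (j + 1) := by exact_mod_cast this
    rw [pow_succ] at h3
    linarith
  have hp : (0 : ℝ) < 2 ^ j := by positivity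
  have e : |(m : ℝ) * (1 / 2) ^ j| = |(m : ℝ)| / 2 ^ j := by
    rw [abs_mul, abs_of_pos (by positivity : (0 : ℝ) < (1 / 2) ^ j), one_div, inv_pow, div_eq_mul_inv]
  have h3 : 1 ≤ |(m : ℝ) * (1 / 2) ^ j| := by rw [e, le_div_iff₀ hp]; linarith
  have h4 : |(m : ℝ) * (1 / 2) ^ j| ≤ 2 := by rw [e, div_le_iff₀ hp]; linarith
  have hcos : Real.cos ((m : ℝ) * (1 / 2) ^ j) ≤ 2 / 3 := by
    rw [← Real.cos_abs]
    refine (Real.cos_le_cos_of_nonneg_of_le_pi zero_le_one ?_ h3).trans ?_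
    · linarith [Real.two_le_pi]
    · exact Real.cos_one_le.trans (by norm_num)
  have h5 : (2 : ℝ) ^ j * (1 / 3) ≤ 2 ^ j * (1 - Real.cos ((m : ℝ) * (1 / 2) ^ j)) := by
    gcongr; linarith
  linarith

/-- The translation `2^{-j}` in direction `i`. -/
def dyadicShift (p : Fin 3 × ℕ) : Torus := proj (Pi.single p.1 ((1 / 2) ^ p.2))

/-- The Fourier multiplier of the discretization `∑ᵢ ∑_{j<n} 2^j (1 - τ)` of `(-Δ)^{1/2}` by
second differences. -/
def mult (n : ℕ) (k : Fin 3 → ℤ) : ℝ :=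
  ∑ p ∈ Finset.univ ×ˢ Finset.range n, 2 ^ p.2 * (1 - (expo k (dyadicShift p)).re)

theorem mult_eq (n : ℕ) (k : Fin 3 → ℤ) :
    mult n k = ∑ i, ∑ j ∈ Finset.range n, 2 ^ j * (1 - Real.cos ((k i : ℝ) * (1 / 2) ^ j)) := by
  unfold mult
  rw [Finset.sum_product]
  refine Finset.sum_congr rfl fun i _ => Finset.sum_congr rfl fun j _ => ?_
  rw [dyadicShift, expo_proj_single, mul_comm Complex.I, Complex.exp_ofReal_mul_I_re]

theorem mult_nonneg (n : ℕ) (k : Fin 3 → ℤ) : 0 ≤ mult n k :=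
  Finset.sum_nonneg fun p _ => mul_nonneg (by positivity) (one_sub_re_expo_nonneg k _)

theorem abs_le_sqrt_eig (k : Fin 3 → ℤ) (i : Fin 3) : |(k i : ℝ)| ≤ Real.sqrt (eig k) := by
  refine Real.abs_le_sqrt ?_
  exact Finset.single_le_sum (f := fun j => (k j : ℝ) ^ 2) (fun j _ => sq_nonneg _)
    (Finset.mem_univ i)

theorem mult_le (n : ℕ) (k : Fin 3 → ℤ) : mult n k ≤ 18 * Real.sqrt (eig k) := by
  rw [mult_eq]
  calc _ ≤ ∑ i, 6 * |(k i : ℝ)| := Finset.sum_le_sum fun i _ => sum_dyadic_le _ _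
    _ ≤ ∑ _i : Fin 3, 6 * Real.sqrt (eig k) := by
        refine Finset.sum_le_sum fun i _ => ?_
        gcongr
        exact abs_le_sqrt_eig k i
    _ = _ := by simp; ring

/-- Each coordinate contributes $|k_i|/6$, and $|k|\le\sum_i|k_i|$. The threshold on $n$ depends on
$k$, which is harmless for finitely many frequencies. -/
theorem le_mult {n : ℕ} {k : Fin 3 → ℤ} (hn : ∀ i, (k i).natAbs < n) :
    Real.sqrt (eig k) / 6 ≤ mult n k := by
  rw [mult_eq]
  have h1 : Real.sqrt (eig k) ≤ ∑ i, |(k i : ℝ)| := by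
    refine Real.sqrt_le_iff.2 ⟨Finset.sum_nonneg fun i _ => abs_nonneg _, ?_⟩
    simp only [eig, Fin.sum_univ_three]
    have h0 := abs_nonneg (k 0 : ℝ)
    have h1 := abs_nonneg (k 1 : ℝ)
    have h2 := abs_nonneg (k 2 : ℝ)
    rw [← sq_abs (k 0 : ℝ), ← sq_abs (k 1 : ℝ), ← sq_abs (k 2 : ℝ)]
    nlinarith [mul_nonneg h0 h1, mul_nonneg h0 h2, mul_nonneg h1 h2]
  calc _ ≤ (∑ i, |(k i : ℝ)|) / 6 := by gcongr
    _ = ∑ i, |(k i : ℝ)| / 6 := Finset.sum_div _ _ _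
    _ ≤ _ := Finset.sum_le_sum fun i _ => le_sum_dyadic (k i) (hn i)

end Multiplier

/-! ### Testing with a single mode; bounds for Fourier coefficients -/

section Modes

/-- The real mode `Re (c w_k)`. -/
def mode (c : ℂ) (k : Fin 3 → ℤ) (w : Torus → ℝ) : ℝ := (c * coeff w k).re

theorem isTestFunction_trig {T : ℝ} {θ : ℝ → ℝ} (hθ : IsTimeTest T θ) (c : ℂ) (k : Fin 3 → ℤ) :
    IsTestFunction T (fun t x => θ t * trig c k x) := by
  refine ⟨?_, ?_⟩
  · exact (hθ.smooth.comp contDiff_fst).mul ((smooth_trig c k).comp contDiff_snd)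
  · obtain ⟨a, b, ha, hb, hab⟩ := hθ.supp
    exact ⟨a, b, ha, hb, fun t ht x => by rw [hab t ht, zero_mul]⟩

theorem timeDeriv_trig {T : ℝ} {θ : ℝ → ℝ} (hθ : IsTimeTest T θ) (c : ℂ) (k : Fin 3 → ℤ) (t : ℝ)
    (x : Torus) : timeDeriv (fun t x => θ t * trig c k x) t x = deriv θ t * trig c k x := by
  unfold timeDeriv
  exact deriv_mul_const (hθ.smooth.differentiable (by simp) t) _

theorem integral_mul_smul_trig {w : Torus → ℝ} (hw : Integrable w) (a : ℝ) (c : ℂ)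
    (k : Fin 3 → ℤ) :
    ∫ x, w x * (a * trig c (-k) x) = vol * (a * mode c k w) := by
  simp only [mul_left_comm _ a]
  rw [integral_const_mul, integral_mul_trig hw, neg_neg, mode]

theorem mul_trig_fun (a : ℝ) (c : ℂ) (k : Fin 3 → ℤ) :
    (fun x => a * trig c k x) = trig (a * c) k := by
  ext x; rw [real_mul_trig]

theorem integral_weakPartial_sum {w : L2} (hw : sobNorm 1 w < ⊤) (a : ℝ) (c : ℂ)
    (k : Fin 3 → ℤ) :
    ∑ i, ∫ x, weakPartial i w x * partialDeriv i (fun x => a * trig c (-k) x) x =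
      vol * (eig k * (a * mode c k w)) := by
  rw [mul_trig_fun]
  simp only [integral_weakPartial_mul hw]
  rw [← Finset.sum_mul]
  have h : ∫ x, w x * trig (a * c) (-k) x = vol * (a * mode c k w) := by
    simpa only [real_mul_trig] using integral_mul_smul_trig (integrable_L2 w) a c k
  rw [h, ← eig_neg k, eig]
  ring

theorem integral_fracLap {w : Torus → ℝ} (hw : Integrable w) (a : ℝ) (c : ℂ) (k : Fin 3 → ℤ) :
    ∫ x, w x * fracLap (1 / 2) (fun x => a * trig c (-k) x) x =
      vol * (Real.sqrt (eig k) * (a * mode c k w)) := by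
  rw [mul_trig_fun]
  simp only [fracLap_trig, eig_neg, real_mul_trig, ← mul_assoc _ a]
  rw [integral_mul_smul_trig hw, Real.sqrt_eq_rpow]

theorem sq_energyNorm (w z : L2) : energyNorm w z ^ 2 = sobNorm 1 w ^ 2 + ‖z‖ₑ ^ 2 := by
  rw [energyNorm, ← ENNReal.rpow_natCast, ← ENNReal.rpow_mul]; simp

theorem sobNorm_le_energyNorm (w z : L2) : sobNorm 1 w ≤ energyNorm w z := by
  refine (ENNReal.pow_le_pow_left_iff (n := 2) (by norm_num)).1 ?_
  rw [sq_energyNorm]; exact le_self_add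

/-- The energy of finitely many modes. -/
theorem sum_modes_le_energy {w z : L2} {E : ℝ} (hE : 0 ≤ E)
    (h : energyNorm w z ≤ ENNReal.ofReal E) (S : Finset (Fin 3 → ℤ)) :
    vol * ∑ k ∈ S, ((1 + eig k) * ‖coeff w k‖ ^ 2 + ‖coeff z k‖ ^ 2) ≤ E ^ 2 := by
  have h1 : energyNorm w z ^ 2 ≤ ENNReal.ofReal (E ^ 2) := by
    rw [ENNReal.ofReal_pow hE]; gcongr
  rw [sq_energyNorm] at h1
  have h2 := ofReal_sum_le_sobNorm_sq 1 w S
  simp only [Real.rpow_one] at h2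
  have h3 : ENNReal.ofReal (vol * ∑ k ∈ S, ‖coeff z k‖ ^ 2) ≤ ‖z‖ₑ ^ 2 := by
    rw [← ofReal_norm, ← ENNReal.ofReal_pow (norm_nonneg _)]
    exact ENNReal.ofReal_le_ofReal (sum_norm_sq_coeff_le z S)
  have hv := vol_pos.le
  have n1 : 0 ≤ vol * ∑ k ∈ S, (1 + eig k) * ‖coeff w k‖ ^ 2 :=
    mul_nonneg hv (Finset.sum_nonneg fun k _ => by have := eig_nonneg k; positivity)
  have n2 : 0 ≤ vol * ∑ k ∈ S, ‖coeff z k‖ ^ 2 := by positivity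
  rw [Finset.sum_add_distrib, mul_add,
    ← ENNReal.ofReal_le_ofReal_iff (by positivity), ENNReal.ofReal_add n1 n2]
  exact (add_le_add h2 h3).trans h1

theorem norm_coeff_u_le {w z : L2} {E : ℝ} (hE : 0 ≤ E)
    (h : energyNorm w z ≤ ENNReal.ofReal E) (k : Fin 3 → ℤ) :
    ‖coeff w k‖ ≤ E / Real.sqrt vol ∧ ‖coeff z k‖ ≤ E / Real.sqrt vol := by
  have h1 := sum_modes_le_energy hE h {k}
  rw [Finset.sum_singleton] at h1
  have hs := Real.sqrt_pos.2 vol_pos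
  have h2 := eig_nonneg k
  have hv := vol_pos
  have key : ∀ a : ℝ, 0 ≤ a → vol * a ^ 2 ≤ E ^ 2 → a ≤ E / Real.sqrt vol := by
    intro a ha h
    rw [le_div_iff₀ hs]
    refine le_of_sq_le_sq ?_ hE
    rw [mul_pow, Real.sq_sqrt vol_pos.le]; linarith
  have n0 := mul_nonneg hv.le (sq_nonneg ‖coeff w k‖)
  have n1 := mul_nonneg hv.le (sq_nonneg ‖coeff z k‖)
  have n2 := mul_nonneg n0 h2
  exact ⟨key _ (norm_nonneg _) (by nlinarith), key _ (norm_nonneg _) (by nlinarith)⟩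

/-- The bound depends on $w$ only through $E$, so along a solution the modes of $f(u)$ are
essentially bounded in time. -/
theorem exists_coeff_comp_bound {A : ℝ} (hA : 0 ≤ A) {h : ℝ → ℝ} (hc : Continuous h)
    (hg : QuinticGrowth A h) (E : ℝ) :
    ∃ B : ℝ, ∀ w : L2, sobNorm 1 w ≤ ENNReal.ofReal E → ∀ k,
      ‖coeff (fun x => h (w x)) k‖ ≤ B := by
  set N : ℝ≥0∞ := ENNReal.ofReal A *
      (eLpNorm (fun _ : Torus => (1 : ℝ)) (6 / 5) volume + (sobConst * ENNReal.ofReal E) ^ 5)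
  set R : ℝ≥0∞ := ‖(vol : ℂ)⁻¹‖ₑ * (N * eLpNorm (fun _ : Torus => (1 : ℝ)) 6 volume)
  have hN : N ≠ ⊤ := ENNReal.mul_ne_top ENNReal.ofReal_ne_top (ENNReal.add_ne_top.2
    ⟨(memLp_const (1 : ℝ)).2.ne,
      ENNReal.pow_ne_top (ENNReal.mul_ne_top ENNReal.coe_ne_top ENNReal.ofReal_ne_top)⟩)
  have hR : R ≠ ⊤ := ENNReal.mul_ne_top enorm_ne_top
    (ENNReal.mul_ne_top hN (memLp_const (1 : ℝ)).2.ne)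
  refine ⟨R.toReal, fun w hw k => ?_⟩
  have hw' : sobNorm 1 w < ⊤ := hw.trans_lt ENNReal.ofReal_lt_top
  have hm := memLp_comp hA hc hg hw'
  have h1 : ‖coeff (fun x => h (w x)) k‖ₑ ≤ R := by
    rw [coeff, vol_coe, enorm_mul]
    refine mul_le_mul' le_rfl ?_
    refine (enorm_integral_mul_le (Complex.continuous_ofReal.comp_aestronglyMeasurable hm.1)
      (continuous_expo _).aestronglyMeasurable).trans ?_
    refine mul_le_mul' ?_ ?_
    · have e1 : eLpNorm (fun x => ((h (w x) : ℝ) : ℂ)) (6 / 5) volume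
          = eLpNorm (fun x => h (w x)) (6 / 5) volume :=
        eLpNorm_congr_norm_ae (Eventually.of_forall fun x => by simp)
      refine (le_of_eq e1).trans ((eLpNorm_comp_le hA hg w).trans ?_)
      simp only [N]
      gcongr
    · refine le_of_eq (eLpNorm_congr_norm_ae (Eventually.of_forall fun x => ?_))
      simp [norm_expo]
  rw [← toReal_enorm]
  exact ENNReal.toReal_mono hR h1

end Modes

/-! ### The scalar equation of a mode and its energy identity -/

section ModalEquation

/-- Essentially bounded measurable functions of time. -/
def BddMeas (T : ℝ) (U : ℝ → ℝ) : Prop :=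
  AEStronglyMeasurable U (volume.restrict (Set.Ioo 0 T)) ∧
    ∃ B, ∀ᵐ t ∂volume.restrict (Set.Ioo 0 T), |U t| ≤ B

theorem BddMeas.integrableOn {T : ℝ} {U : ℝ → ℝ} (h : BddMeas T U) :
    IntegrableOn U (Set.Ioo 0 T) := by
  obtain ⟨hm, B, hB⟩ := h
  exact Integrable.of_bound hm B hB

theorem BddMeas.mul {T : ℝ} {U V : ℝ → ℝ} (hU : BddMeas T U) (hV : BddMeas T V) :
    BddMeas T fun t => U t * V t := by
  obtain ⟨hm, B, hB⟩ := hU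
  obtain ⟨hm', B', hB'⟩ := hV
  refine ⟨hm.mul hm', B * B', ?_⟩
  filter_upwards [hB, hB'] with t h1 h2
  rw [abs_mul]
  exact mul_le_mul h1 h2 (abs_nonneg _) ((abs_nonneg _).trans h1)

theorem BddMeas.add {T : ℝ} {U V : ℝ → ℝ} (hU : BddMeas T U) (hV : BddMeas T V) :
    BddMeas T fun t => U t + V t := by
  obtain ⟨hm, B, hB⟩ := hU
  obtain ⟨hm', B', hB'⟩ := hV
  refine ⟨hm.add hm', B + B', ?_⟩
  filter_upwards [hB, hB'] with t h1 h2
  exact (abs_add_le _ _).trans (add_le_add h1 h2)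

theorem BddMeas.const (T c : ℝ) : BddMeas T fun _ => c :=
  ⟨aestronglyMeasurable_const, |c|, Eventually.of_forall fun _ => le_rfl⟩

theorem BddMeas.const_mul {T : ℝ} {U : ℝ → ℝ} (hU : BddMeas T U) (c : ℝ) :
    BddMeas T fun t => c * U t := (BddMeas.const T c).mul hU

theorem BddMeas.sum {T : ℝ} {ι : Type*} (S : Finset ι) {U : ι → ℝ → ℝ}
    (hU : ∀ k, BddMeas T (U k)) : BddMeas T fun t => ∑ k ∈ S, U k t := by
  classical
  induction S using Finset.induction_on with
  | empty => simpa using BddMeas.const T 0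
  | insert k S hk ih =>
    simp only [Finset.sum_insert hk]
    exact (hU k).add ih

theorem integral_lincomb {μ : Measure ℝ} {p q r s : ℝ → ℝ} (hp : Integrable p μ)
    (hq : Integrable q μ) (hr : Integrable r μ) (hs : Integrable s μ) {x y z : ℝ} :
    ∫ t, (p t + x * q t + y * r t + z * s t) ∂μ =
      (∫ t, p t ∂μ) + x * (∫ t, q t ∂μ) + y * (∫ t, r t ∂μ) + z * (∫ t, s t ∂μ) := by
  have h1 : Integrable (fun t => p t + x * q t) μ := hp.add (hq.const_mul x)
  have h2 : Integrable (fun t => p t + x * q t + y * r t) μ := h1.add (hr.const_mul y)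
  rw [integral_add h2 (hs.const_mul z), integral_add h1 (hr.const_mul y),
    integral_add hp (hq.const_mul x), integral_const_mul, integral_const_mul, integral_const_mul]

theorem abs_mode_le (c : ℂ) (k : Fin 3 → ℤ) (w : Torus → ℝ) :
    |mode c k w| ≤ ‖c‖ * ‖coeff w k‖ :=
  (Complex.abs_re_le_norm _).trans (norm_mul _ _).le

variable {γ α T : ℝ} {f : ℝ → ℝ} {g u₀ u₁ : L2} {u v : ℝ → L2}

theorem IsWeakEnergySolution.ae_energy (sol : IsWeakEnergySolution γ α f g T u₀ u₁ u v) :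
    ∀ᵐ t ∂volume.restrict (Set.Ioo 0 T), energyNorm (u t) (v t) ≤
      ENNReal.ofReal (normLinftyEnergy 0 T u v).toReal := by
  rw [ENNReal.ofReal_toReal sol.energy.ne]
  exact ENNReal.ae_le_essSup _

theorem IsWeakEnergySolution.ae_sobNorm (sol : IsWeakEnergySolution γ α f g T u₀ u₁ u v) :
    ∀ᵐ t ∂volume.restrict (Set.Ioo 0 T), sobNorm 1 (u t) < ⊤ := by
  filter_upwards [sol.ae_energy] with t ht
  exact ((sobNorm_le_energyNorm _ _).trans ht).trans_lt ENNReal.ofReal_lt_top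

theorem IsWeakEnergySolution.bddMeas_u (sol : IsWeakEnergySolution γ α f g T u₀ u₁ u v) (c : ℂ)
    (k : Fin 3 → ℤ) : BddMeas T fun t => mode c k (u t) := by
  refine ⟨?_, ‖c‖ * ((normLinftyEnergy 0 T u v).toReal / Real.sqrt vol), ?_⟩
  · exact (Complex.continuous_re.comp (continuous_const.mul
      (continuous_coeff k))).comp_aestronglyMeasurable sol.measurable_u
  · filter_upwards [sol.ae_energy] with t ht
    refine (abs_mode_le c k _).trans ?_
    gcongr
    exact (norm_coeff_u_le ENNReal.toReal_nonneg ht k).1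

theorem IsWeakEnergySolution.bddMeas_v (sol : IsWeakEnergySolution γ α f g T u₀ u₁ u v) (c : ℂ)
    (k : Fin 3 → ℤ) : BddMeas T fun t => mode c k (v t) := by
  refine ⟨?_, ‖c‖ * ((normLinftyEnergy 0 T u v).toReal / Real.sqrt vol), ?_⟩
  · exact (Complex.continuous_re.comp (continuous_const.mul
      (continuous_coeff k))).comp_aestronglyMeasurable sol.measurable_v
  · filter_upwards [sol.ae_energy] with t ht
    refine (abs_mode_le c k _).trans ?_
    gcongr
    exact (norm_coeff_u_le ENNReal.toReal_nonneg ht k).2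

theorem IsWeakEnergySolution.bddMeas_comp (sol : IsWeakEnergySolution γ α f g T u₀ u₁ u v)
    {A : ℝ} (hA : 0 ≤ A) {h : ℝ → ℝ} (hd : ContDiff ℝ 1 h) (hg : QuinticGrowth A h) (c : ℂ)
    (k : Fin 3 → ℤ) : BddMeas T fun t => mode c k (fun x => h (u t x)) := by
  obtain ⟨B, hB⟩ := exists_coeff_comp_bound hA hd.continuous hg (normLinftyEnergy 0 T u v).toReal
  refine ⟨?_, ‖c‖ * B, ?_⟩
  · exact (Complex.continuous_re.comp (continuous_const_mul c)).comp_aestronglyMeasurable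
      (aestronglyMeasurable_coeff_comp hA hd hg sol.measurable_u sol.ae_sobNorm k)
  · filter_upwards [sol.ae_energy] with t ht
    refine (abs_mode_le c k _).trans ?_
    gcongr
    exact hB _ ((sobNorm_le_energyNorm _ _).trans ht) k

theorem IsWeakEnergySolution.hasWeakDeriv_u (sol : IsWeakEnergySolution γ α f g T u₀ u₁ u v)
    (c : ℂ) (k : Fin 3 → ℤ) :
    HasWeakDeriv T (fun t => mode c k (u t)) (fun t => mode c k (v t)) := by
  intro θ hθ
  have h := sol.time_deriv _ (isTestFunction_trig hθ c (-k))
  simp only [timeDeriv_trig hθ, integral_mul_smul_trig (integrable_L2 _)] at h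
  rw [integral_const_mul, integral_const_mul, ← mul_neg] at h
  exact mul_left_cancel₀ vol_pos.ne' h

/-- Testing with $\theta(t)\operatorname{Re}(ce^{-ik\cdot x})$ diagonalizes the linear operators and
leaves a second order scalar equation for the mode. -/
theorem IsWeakEnergySolution.hasWeakDeriv_v (sol : IsWeakEnergySolution γ α f g T u₀ u₁ u v)
    {A : ℝ} (hA : 0 ≤ A) (hd : ContDiff ℝ 1 f) (hg : QuinticGrowth A f) (c : ℂ)
    (k : Fin 3 → ℤ) :
    HasWeakDeriv T (fun t => mode c k (v t)) (fun t => mode c k g + -(eig k) * mode c k (u t)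
      + -(α + γ * Real.sqrt (eig k)) * mode c k (v t) + -1 * mode c k (fun x => f (u t x))) := by
  intro θ hθ
  have h := sol.equation _ (isTestFunction_trig hθ c (-k))
  have hθc := hθ.smooth.continuous
  have iu := integrable_mul_of_continuous hθc (sol.bddMeas_u c k).integrableOn
  have iv := integrable_mul_of_continuous hθc (sol.bddMeas_v c k).integrableOn
  have iF := integrable_mul_of_continuous hθc (sol.bddMeas_comp hA hd hg c k).integrableOn
  have ig := integrable_mul_of_continuous hθc (BddMeas.const T (mode c k g)).integrableOn
  have e1 : ∫ t in Set.Ioo 0 T, ∑ i, ∫ x, weakPartial i (u t) x *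
      partialDeriv i ((fun t x => θ t * trig c (-k) x) t) x
      = vol * (eig k * ∫ t in Set.Ioo 0 T, θ t * mode c k (u t)) := by
    rw [← integral_const_mul, ← integral_const_mul]
    refine integral_congr_ae ?_
    filter_upwards [sol.ae_sobNorm] with t ht
    exact integral_weakPartial_sum ht _ c k
  have e2 : ∫ t in Set.Ioo 0 T, ∫ x, f (u t x) * (θ t * trig c (-k) x)
      = vol * ∫ t in Set.Ioo 0 T, θ t * mode c k (fun x => f (u t x)) := by
    rw [← integral_const_mul]
    refine integral_congr_ae ?_
    filter_upwards [sol.ae_sobNorm] with t ht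
    exact integral_mul_smul_trig ((memLp_comp hA hd.continuous hg ht).integrable
      one_le_six_fifths) _ c k
  rw [e1, e2] at h
  simp only [timeDeriv_trig hθ, integral_mul_smul_trig (integrable_L2 _),
    integral_fracLap (integrable_L2 _)] at h
  simp only [integral_const_mul] at h
  have e3 : ∫ t in Set.Ioo 0 T, θ t * (mode c k g + -(eig k) * mode c k (u t)
      + -(α + γ * Real.sqrt (eig k)) * mode c k (v t) + -1 * mode c k (fun x => f (u t x)))
      = (∫ t in Set.Ioo 0 T, θ t * mode c k g)
        + -(eig k) * (∫ t in Set.Ioo 0 T, θ t * mode c k (u t))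
        + -(α + γ * Real.sqrt (eig k)) * (∫ t in Set.Ioo 0 T, θ t * mode c k (v t))
        + -1 * (∫ t in Set.Ioo 0 T, θ t * mode c k (fun x => f (u t x))) := by
    rw [← integral_lincomb ig iu iv iF]
    refine integral_congr_ae (Eventually.of_forall fun t => ?_)
    beta_reduce
    ring
  rw [e3]
  have := vol_pos.ne'
  apply mul_left_cancel₀ this
  linear_combination -h

/-- The energy identity of a single real mode. -/
theorem IsWeakEnergySolution.mode_identity (sol : IsWeakEnergySolution γ α f g T u₀ u₁ u v)
    (hT : 0 < T) {A : ℝ} (hA : 0 ≤ A) (hd : ContDiff ℝ 1 f) (hg : QuinticGrowth A f) (c : ℂ)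
    (k : Fin 3 → ℤ) :
    ∃ G : Set ℝ, (∀ᵐ t ∂volume.restrict (Set.Ioo 0 T), t ∈ G) ∧ ∀ a ∈ G, ∀ b ∈ G, a ≤ b →
      eig k * (∫ t in Set.Ioc a b, mode c k (u t) * mode c k (u t))
          + (∫ t in Set.Ioc a b, mode c k (fun x => f (u t x)) * mode c k (u t))
        = -(mode c k (v b) * mode c k (u b) - mode c k (v a) * mode c k (u a))
          - (α + γ * Real.sqrt (eig k)) / 2 *
            (mode c k (u b) * mode c k (u b) - mode c k (u a) * mode c k (u a))
          + (∫ t in Set.Ioc a b, mode c k (v t) * mode c k (v t))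
          + (∫ t in Set.Ioc a b, mode c k g * mode c k (u t)) := by
  have bu := sol.bddMeas_u c k
  have bv := sol.bddMeas_v c k
  have bF := sol.bddMeas_comp hA hd hg c k
  have bg := BddMeas.const T (mode c k g)
  have bW := ((bg.add (bu.const_mul (-(eig k)))).add
    (bv.const_mul (-(α + γ * Real.sqrt (eig k))))).add (bF.const_mul (-1))
  obtain ⟨G₁, hG₁, h₁⟩ := HasWeakDeriv.mul_sub_mul hT bv.integrableOn bW.integrableOn
    bu.integrableOn bv.integrableOn (sol.hasWeakDeriv_v hA hd hg c k) (sol.hasWeakDeriv_u c k)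
  -- The first product rule, for $vu$, tests the modal equation with $u$. This one, for $u^2$, turns
  -- the damping integral $\int vu$ into boundary terms.
  obtain ⟨G₂, hG₂, h₂⟩ := HasWeakDeriv.mul_sub_mul hT bu.integrableOn bv.integrableOn
    bu.integrableOn bv.integrableOn (sol.hasWeakDeriv_u c k) (sol.hasWeakDeriv_u c k)
  refine ⟨G₁ ∩ G₂ ∩ Set.Ioo 0 T, ?_, ?_⟩
  · filter_upwards [hG₁, hG₂, ae_restrict_mem measurableSet_Ioo] with t t1 t2 t3
    exact ⟨⟨t1, t2⟩, t3⟩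
  · rintro a ⟨⟨a1, a2⟩, a3⟩ b ⟨⟨b1, b2⟩, b3⟩ hab
    have hsub : Set.Ioc a b ⊆ Set.Ioo 0 T := fun t ht => ⟨a3.1.trans ht.1, ht.2.trans_lt b3.2⟩
    have ivv := (bv.mul bv).integrableOn.mono_set hsub
    have igu := (bg.mul bu).integrableOn.mono_set hsub
    have iuu := (bu.mul bu).integrableOn.mono_set hsub
    have ivu := (bv.mul bu).integrableOn.mono_set hsub
    have iFu := (bF.mul bu).integrableOn.mono_set hsub
    have e1 := h₁ a a1 b b1 hab
    have e2 := h₂ a a2 b b2 hab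
    have e3 : ∫ t in Set.Ioc a b, (mode c k (v t) * mode c k (u t)
        + mode c k (u t) * mode c k (v t))
        = 2 * ∫ t in Set.Ioc a b, mode c k (v t) * mode c k (u t) := by
      rw [← integral_const_mul]
      refine integral_congr_ae (Eventually.of_forall fun t => ?_)
      beta_reduce; ring
    have i5 : IntegrableOn (fun t => mode c k (v t) * mode c k (v t)
        + mode c k g * mode c k (u t)) (Set.Ioc a b) := ivv.add igu
    have e4 : (∫ t in Set.Ioc a b, ((mode c k (v t) * mode c k (v t)
          + mode c k g * mode c k (u t)) + -(eig k) * (mode c k (u t) * mode c k (u t))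
          + -(α + γ * Real.sqrt (eig k)) * (mode c k (v t) * mode c k (u t))
          + -1 * (mode c k (fun x => f (u t x)) * mode c k (u t)))) = _ :=
      integral_lincomb i5 iuu ivu iFu
    rw [integral_add ivv igu] at e4
    have e5 : ∫ t in Set.Ioc a b, ((mode c k g + -(eig k) * mode c k (u t)
        + -(α + γ * Real.sqrt (eig k)) * mode c k (v t)
        + -1 * mode c k (fun x => f (u t x))) * mode c k (u t) + mode c k (v t) * mode c k (v t))
        = ∫ t in Set.Ioc a b, ((mode c k (v t) * mode c k (v t)
          + mode c k g * mode c k (u t)) + -(eig k) * (mode c k (u t) * mode c k (u t))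
          + -(α + γ * Real.sqrt (eig k)) * (mode c k (v t) * mode c k (u t))
          + -1 * (mode c k (fun x => f (u t x)) * mode c k (u t))) := by
      refine integral_congr_ae (Eventually.of_forall fun t => ?_)
      beta_reduce; ring
    rw [e5, e4] at e1
    rw [e3] at e2
    linear_combination e1 + (α + γ * Real.sqrt (eig k)) / 2 * e2

/-- The real pairing `Re (w_k conj z_k)` of Fourier coefficients. -/
def pairing (k : Fin 3 → ℤ) (w z : Torus → ℝ) : ℝ := (coeff w k * conj (coeff z k)).re

/-- The factors $1$ and $-i$ extract the real and imaginary parts, so complex identities follow from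
two real ones. -/
theorem pairing_eq (k : Fin 3 → ℤ) (w z : Torus → ℝ) :
    pairing k w z = mode 1 k w * mode 1 k z + mode (-Complex.I) k w * mode (-Complex.I) k z := by
  simp [pairing, mode]

theorem pairing_self (k : Fin 3 → ℤ) (w : Torus → ℝ) : pairing k w w = ‖coeff w k‖ ^ 2 := by
  rw [pairing, Complex.mul_conj']
  norm_cast

theorem abs_pairing_le (k : Fin 3 → ℤ) (w z : Torus → ℝ) :
    |pairing k w z| ≤ ‖coeff w k‖ * ‖coeff z k‖ := by
  refine (Complex.abs_re_le_norm _).trans ?_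
  rw [norm_mul, RCLike.norm_conj]

theorem IsWeakEnergySolution.bddMeas_pairing_uu (sol : IsWeakEnergySolution γ α f g T u₀ u₁ u v)
    (k : Fin 3 → ℤ) : BddMeas T fun t => pairing k (u t) (u t) := by
  simp only [pairing_eq]
  exact ((sol.bddMeas_u _ k).mul (sol.bddMeas_u _ k)).add
    ((sol.bddMeas_u _ k).mul (sol.bddMeas_u _ k))

theorem IsWeakEnergySolution.bddMeas_pairing_vv (sol : IsWeakEnergySolution γ α f g T u₀ u₁ u v)
    (k : Fin 3 → ℤ) : BddMeas T fun t => pairing k (v t) (v t) := by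
  simp only [pairing_eq]
  exact ((sol.bddMeas_v _ k).mul (sol.bddMeas_v _ k)).add
    ((sol.bddMeas_v _ k).mul (sol.bddMeas_v _ k))

theorem IsWeakEnergySolution.bddMeas_pairing_gu (sol : IsWeakEnergySolution γ α f g T u₀ u₁ u v)
    (k : Fin 3 → ℤ) : BddMeas T fun t => pairing k g (u t) := by
  simp only [pairing_eq]
  exact ((BddMeas.const T _).mul (sol.bddMeas_u _ k)).add
    ((BddMeas.const T _).mul (sol.bddMeas_u _ k))

theorem IsWeakEnergySolution.bddMeas_pairing_comp
    (sol : IsWeakEnergySolution γ α f g T u₀ u₁ u v)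
    {A : ℝ} (hA : 0 ≤ A) {h : ℝ → ℝ} (hd : ContDiff ℝ 1 h) (hg : QuinticGrowth A h)
    (k : Fin 3 → ℤ) : BddMeas T fun t => pairing k (fun x => h (u t x)) (u t) := by
  simp only [pairing_eq]
  exact ((sol.bddMeas_comp hA hd hg _ k).mul (sol.bddMeas_u _ k)).add
    ((sol.bddMeas_comp hA hd hg _ k).mul (sol.bddMeas_u _ k))

/-- The energy identity of a single Fourier mode. -/
theorem IsWeakEnergySolution.coeff_identity (sol : IsWeakEnergySolution γ α f g T u₀ u₁ u v)
    (hT : 0 < T) {A : ℝ} (hA : 0 ≤ A) (hd : ContDiff ℝ 1 f) (hg : QuinticGrowth A f)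
    (k : Fin 3 → ℤ) :
    ∃ G : Set ℝ, (∀ᵐ t ∂volume.restrict (Set.Ioo 0 T), t ∈ G) ∧ ∀ a ∈ G, ∀ b ∈ G, a ≤ b →
      eig k * (∫ t in Set.Ioc a b, pairing k (u t) (u t))
          + (∫ t in Set.Ioc a b, pairing k (fun x => f (u t x)) (u t))
        = -(pairing k (v b) (u b) - pairing k (v a) (u a))
          - (α + γ * Real.sqrt (eig k)) / 2 *
            (pairing k (u b) (u b) - pairing k (u a) (u a))
          + (∫ t in Set.Ioc a b, pairing k (v t) (v t))
          + (∫ t in Set.Ioc a b, pairing k g (u t)) := by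
  obtain ⟨G₁, hG₁, h₁⟩ := sol.mode_identity hT hA hd hg 1 k
  obtain ⟨G₂, hG₂, h₂⟩ := sol.mode_identity hT hA hd hg (-Complex.I) k
  refine ⟨G₁ ∩ G₂ ∩ Set.Ioo 0 T, ?_, ?_⟩
  · filter_upwards [hG₁, hG₂, ae_restrict_mem measurableSet_Ioo] with t t1 t2 t3
    exact ⟨⟨t1, t2⟩, t3⟩
  · rintro a ⟨⟨a1, a2⟩, a3⟩ b ⟨⟨b1, b2⟩, b3⟩ hab
    have hsub : Set.Ioc a b ⊆ Set.Ioo 0 T := fun t ht => ⟨a3.1.trans ht.1, ht.2.trans_lt b3.2⟩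
    have bu := fun c => sol.bddMeas_u c k
    have bv := fun c => sol.bddMeas_v c k
    have bF := fun c => sol.bddMeas_comp hA hd hg c k
    have ivv := fun c => ((bv c).mul (bv c)).integrableOn.mono_set hsub
    have igu := fun c => ((BddMeas.const T (mode c k g)).mul (bu c)).integrableOn.mono_set hsub
    have iuu := fun c => ((bu c).mul (bu c)).integrableOn.mono_set hsub
    have iFu := fun c => ((bF c).mul (bu c)).integrableOn.mono_set hsub
    simp only [pairing_eq]
    rw [integral_add (iuu _) (iuu _), integral_add (iFu _) (iFu _), integral_add (ivv _) (ivv _),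
      integral_add (igu _) (igu _)]
    linear_combination h₁ a a1 b b1 hab + h₂ a a2 b b2 hab

end ModalEquation

/-! ### Sign of the nonlinear term and bounds for the linear terms -/

section Estimate

variable {γ α T : ℝ} {f : ℝ → ℝ} {g u₀ u₁ : L2} {u v : ℝ → L2}

theorem re_sum_coeff_secondDiff (h w : Torus → ℝ) {z : L2} (hz : w = z) (y : Torus)
    (S : Finset (Fin 3 → ℤ)) :
    (∑ k ∈ S, coeff h k * conj (coeff (secondDiff y z) k)).re =
      ∑ k ∈ S, (1 - (expo k y).re) * pairing k h w := by
  rw [Complex.re_sum]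
  refine Finset.sum_congr rfl fun k _ => ?_
  rw [coeff_secondDiff, map_mul, Complex.conj_ofReal, mul_left_comm, Complex.re_ofReal_mul, pairing,
    hz]

/-- Positivity belongs to the full pairing of $h(u)$ with the second difference of $u$ and may fail
for finite sums of modes. Hence the sums are sent to their limit, by dominated convergence in time,
and only the limit carries the sign. -/
theorem IsWeakEnergySolution.tendsto_secondDiff (sol : IsWeakEnergySolution γ α f g T u₀ u₁ u v)
    {A : ℝ} (hA : 0 ≤ A) {h : ℝ → ℝ} (hd : ContDiff ℝ 1 h) (hg : QuinticGrowth A h)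
    (hm : Monotone h) {a b : ℝ} (hsub : Set.Ioc a b ⊆ Set.Ioo 0 T) (y : Torus) :
    ∃ L : ℝ, 0 ≤ L ∧ Tendsto (fun S : Finset (Fin 3 → ℤ) => ∫ t in Set.Ioc a b,
      ∑ k ∈ S, (1 - (expo k y).re) * pairing k (fun x => h (u t x)) (u t)) atTop (𝓝 L) := by
  set E := (normLinftyEnergy 0 T u v).toReal
  set N : ℝ≥0∞ := ENNReal.ofReal A *
      (eLpNorm (fun _ : Torus => (1 : ℝ)) (6 / 5) volume + (sobConst * ENNReal.ofReal E) ^ 5)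
  -- A bound for the truncated pairing at almost every time, independent of the set of modes; the
  -- $2$ is the norm of the second difference on $H^1$.
  set R : ℝ≥0∞ := ‖(vol : ℂ)⁻¹‖ₑ * (N * (sobConst * (2 * ENNReal.ofReal E)))
  have hN : N ≠ ⊤ := ENNReal.mul_ne_top ENNReal.ofReal_ne_top (ENNReal.add_ne_top.2
    ⟨(memLp_const (1 : ℝ)).2.ne,
      ENNReal.pow_ne_top (ENNReal.mul_ne_top ENNReal.coe_ne_top ENNReal.ofReal_ne_top)⟩)
  have hR : R ≠ ⊤ := ENNReal.mul_ne_top enorm_ne_top (ENNReal.mul_ne_top hN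
    (ENNReal.mul_ne_top ENNReal.coe_ne_top (ENNReal.mul_ne_top (by simp) ENNReal.ofReal_ne_top)))
  have hμ : volume.restrict (Set.Ioc a b) ≤ volume.restrict (Set.Ioo 0 T) :=
    Measure.restrict_mono hsub le_rfl
  have hen := ae_mono hμ sol.ae_energy
  refine ⟨∫ t in Set.Ioc a b, vol⁻¹ * ∫ x, h (u t x) * secondDiff y (u t) x, ?_, ?_⟩
  · refine integral_nonneg_of_ae ?_
    filter_upwards [hen] with t ht
    have hs : sobNorm 1 (u t) < ⊤ :=
      ((sobNorm_le_energyNorm _ _).trans ht).trans_lt ENNReal.ofReal_lt_top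
    exact mul_nonneg (inv_nonneg.2 vol_pos.le) (integral_comp_mul_secondDiff_nonneg hm
      (memLp_comp hA hd.continuous hg hs) (memLp_six hs) y)
  · refine tendsto_integral_filter_of_dominated_convergence (fun _ => R.toReal)
      (Eventually.of_forall fun S => ?_) (Eventually.of_forall fun S => ?_)
      (integrable_const _) ?_
    · have := BddMeas.sum S fun k => (sol.bddMeas_pairing_comp hA hd hg k).const_mul
        (1 - (expo k y).re)
      exact this.1.mono_measure hμ
    · filter_upwards [hen] with t ht
      have hs := (sobNorm_le_energyNorm _ _).trans ht
      have hs' : sobNorm 1 (u t) < ⊤ := hs.trans_lt ENNReal.ofReal_lt_top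
      rw [← re_sum_coeff_secondDiff _ _ rfl]
      refine (Complex.abs_re_le_norm _).trans ?_
      rw [← toReal_enorm]
      refine ENNReal.toReal_mono hR ?_
      refine (enorm_sum_coeff_mul_conj_le (memLp_comp hA hd.continuous hg hs') _ S).trans ?_
      refine mul_le_mul' le_rfl (mul_le_mul' ((eLpNorm_comp_le hA hg _).trans ?_)
        (mul_le_mul' le_rfl ((sobNorm_secondDiff_le y _).trans (mul_le_mul' le_rfl hs))))
      simp only [N]
      gcongr
    · filter_upwards [hen] with t ht
      have hs : sobNorm 1 (u t) < ⊤ :=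
        ((sobNorm_le_energyNorm _ _).trans ht).trans_lt ENNReal.ofReal_lt_top
      have hs2 : sobNorm 1 (secondDiff y (u t)) < ⊤ :=
        (sobNorm_secondDiff_le y _).trans_lt (ENNReal.mul_lt_top (by simp) hs)
      have h1 := tendsto_sum_coeff_mul_conj (memLp_comp hA hd.continuous hg hs) hs2
      have h2 := (Complex.continuous_re.tendsto _).comp h1
      have e : ((vol : ℂ)⁻¹ * ((∫ x, h (u t x) * secondDiff y (u t) x : ℝ) : ℂ)).re
          = vol⁻¹ * ∫ x, h (u t x) * secondDiff y (u t) x := by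
        rw [← Complex.ofReal_inv, ← Complex.ofReal_mul, Complex.ofReal_re]
      rw [e] at h2
      refine h2.congr fun S => ?_
      exact re_sum_coeff_secondDiff _ _ rfl y S

/-- At fixed $n$ the multiplier is a finite combination, with positive weights $2^j$, of the
multipliers $1-\operatorname{Re}e^{ik\cdot y}$ of second differences, so both the convergence and
the sign are inherited. -/
theorem IsWeakEnergySolution.tendsto_nonlinear (sol : IsWeakEnergySolution γ α f g T u₀ u₁ u v)
    {A : ℝ} (hA : 0 ≤ A) {h : ℝ → ℝ} (hd : ContDiff ℝ 1 h) (hg : QuinticGrowth A h)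
    (hm : Monotone h) {a b : ℝ} (hsub : Set.Ioc a b ⊆ Set.Ioo 0 T) (n : ℕ) :
    ∃ L : ℝ, 0 ≤ L ∧ Tendsto (fun S : Finset (Fin 3 → ℤ) =>
      ∑ k ∈ S, mult n k * ∫ t in Set.Ioc a b, pairing k (fun x => h (u t x)) (u t))
      atTop (𝓝 L) := by
  choose L hL0 hL using fun y => sol.tendsto_secondDiff hA hd hg hm hsub y
  refine ⟨∑ p ∈ Finset.univ ×ˢ Finset.range n, 2 ^ p.2 * L (dyadicShift p),
    Finset.sum_nonneg fun p _ => mul_nonneg (by positivity) (hL0 _), ?_⟩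
  refine (tendsto_finsetSum _ fun p _ => (hL (dyadicShift p)).const_mul (2 ^ p.2)).congr
    fun S => ?_
  have hi : ∀ k, IntegrableOn (fun t => pairing k (fun x => h (u t x)) (u t)) (Set.Ioc a b) :=
    fun k => (sol.bddMeas_pairing_comp hA hd hg k).integrableOn.mono_set hsub
  have e : ∀ p, ∫ t in Set.Ioc a b, ∑ k ∈ S, (1 - (expo k (dyadicShift p)).re) *
      pairing k (fun x => h (u t x)) (u t) = ∑ k ∈ S, (1 - (expo k (dyadicShift p)).re) *
        ∫ t in Set.Ioc a b, pairing k (fun x => h (u t x)) (u t) := by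
    intro p
    rw [integral_finsetSum _ fun k _ => (hi k).const_mul _]
    simp only [integral_const_mul]
  simp only [e, mult, Finset.mul_sum, Finset.sum_mul]
  rw [Finset.sum_comm]
  exact Finset.sum_congr rfl fun k _ => Finset.sum_congr rfl fun p _ => by ring

theorem integral_Ioc_le {τ σ a b c : ℝ} {Y : ℝ → ℝ} (hY : BddMeas T Y) (hab : a ≤ b)
    (hsubT : Set.Ioc a b ⊆ Set.Ioo 0 T) (hsub : Set.Ioc a b ⊆ Set.Ioo τ σ)
    (h : ∀ᵐ t ∂volume.restrict (Set.Ioo τ σ), Y t ≤ c) :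
    ∫ t in Set.Ioc a b, Y t ≤ c * (b - a) := by
  have h1 : ∫ t in Set.Ioc a b, Y t ≤ ∫ _t in Set.Ioc a b, c :=
    integral_mono_ae (hY.integrableOn.mono_set hsubT) (integrable_const _)
      (ae_mono (Measure.restrict_mono hsub le_rfl) h)
  refine h1.trans (le_of_eq ?_)
  simp [hab, mul_comm]

theorem sqrt_eig_le (k : Fin 3 → ℤ) : Real.sqrt (eig k) ≤ 1 + eig k := by
  have h := Real.sq_sqrt (eig_nonneg k)
  nlinarith [sq_nonneg (Real.sqrt (eig k) - 1), Real.sqrt_nonneg (eig k)]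

/-- Young: $18|k||z_k||w_k|\le9(|k|^2|w_k|^2+|z_k|^2)$. One derivative falls entirely on $w\in H^1$,
so $z$ need only be in $L^2$; it is applied with $z=\partial_tu$ and $z=g$. -/
theorem mult_mul_abs_pairing_le (n : ℕ) (k : Fin 3 → ℤ) (z w : Torus → ℝ) :
    mult n k * |pairing k z w| ≤ 9 * ((1 + eig k) * ‖coeff w k‖ ^ 2 + ‖coeff z k‖ ^ 2) := by
  have h1 := mult_le n k
  have h2 := abs_pairing_le k z w
  have h3 := Real.sq_sqrt (eig_nonneg k)
  have h4 := Real.sqrt_nonneg (eig k)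
  have h5 : mult n k * |pairing k z w|
      ≤ 18 * Real.sqrt (eig k) * (‖coeff z k‖ * ‖coeff w k‖) :=
    mul_le_mul h1 h2 (abs_nonneg _) (by positivity)
  have h6 := sq_nonneg (Real.sqrt (eig k) * ‖coeff w k‖ - ‖coeff z k‖)
  have h7 : (Real.sqrt (eig k) * ‖coeff w k‖) ^ 2 = eig k * ‖coeff w k‖ ^ 2 := by
    rw [mul_pow, h3]
  have h8 := sq_nonneg ‖coeff w k‖
  nlinarith

theorem sum_mult_pairing_le {w z : L2} {E : ℝ} (hE : 0 ≤ E)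
    (h : energyNorm w z ≤ ENNReal.ofReal E) (n : ℕ) (S : Finset (Fin 3 → ℤ)) :
    vol * ∑ k ∈ S, mult n k * |pairing k z w| ≤ 9 * E ^ 2 := by
  have h1 := sum_modes_le_energy hE h S
  have h2 : ∑ k ∈ S, mult n k * |pairing k z w|
      ≤ 9 * ∑ k ∈ S, ((1 + eig k) * ‖coeff w k‖ ^ 2 + ‖coeff z k‖ ^ 2) := by
    rw [Finset.mul_sum]
    exact Finset.sum_le_sum fun k _ => mult_mul_abs_pairing_le n k z w
  have := mul_le_mul_of_nonneg_left h2 vol_pos.le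
  linarith

theorem sum_weight_le {w z : L2} {E : ℝ} (hE : 0 ≤ E)
    (h : energyNorm w z ≤ ENNReal.ofReal E) (S : Finset (Fin 3 → ℤ)) :
    vol * ∑ k ∈ S, (1 + eig k) * ‖coeff w k‖ ^ 2 ≤ E ^ 2 := by
  refine le_trans ?_ (sum_modes_le_energy hE h S)
  refine mul_le_mul_of_nonneg_left (Finset.sum_le_sum fun k _ => ?_) vol_pos.le
  have := sq_nonneg ‖coeff z k‖
  linarith

theorem sum_mult_source_le {w z g : L2} {E : ℝ} (hE : 0 ≤ E)
    (h : energyNorm w z ≤ ENNReal.ofReal E) (n : ℕ) (S : Finset (Fin 3 → ℤ)) :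
    vol * ∑ k ∈ S, mult n k * pairing k g w ≤ 9 * (E ^ 2 + ‖g‖ ^ 2) := by
  have h1 := sum_weight_le hE h S
  have h2 := sum_norm_sq_coeff_le g S
  have h3 : ∑ k ∈ S, mult n k * pairing k g w
      ≤ 9 * (∑ k ∈ S, (1 + eig k) * ‖coeff w k‖ ^ 2 + ∑ k ∈ S, ‖coeff g k‖ ^ 2) := by
    rw [← Finset.sum_add_distrib, Finset.mul_sum]
    refine Finset.sum_le_sum fun k _ => le_trans ?_ (mult_mul_abs_pairing_le n k g w)
    exact mul_le_mul_of_nonneg_left (le_abs_self _) (mult_nonneg n k)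
  have := mul_le_mul_of_nonneg_left h3 vol_pos.le
  linarith

theorem sum_mult_sq_le {w z : L2} {E : ℝ} (hE : 0 ≤ E)
    (h : energyNorm w z ≤ ENNReal.ofReal E) (n : ℕ) (S : Finset (Fin 3 → ℤ)) :
    vol * ∑ k ∈ S, mult n k * pairing k w w ≤ 18 * E ^ 2 := by
  have h1 := sum_weight_le hE h S
  have h3 : ∑ k ∈ S, mult n k * pairing k w w
      ≤ 18 * ∑ k ∈ S, (1 + eig k) * ‖coeff w k‖ ^ 2 := by
    rw [Finset.mul_sum]
    refine Finset.sum_le_sum fun k _ => ?_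
    rw [pairing_self, ← mul_assoc]
    refine mul_le_mul_of_nonneg_right ?_ (sq_nonneg _)
    have := mult_le n k
    have := sqrt_eig_le k
    linarith
  have := mul_le_mul_of_nonneg_left h3 vol_pos.le
  linarith

/-- The fractional damping contributes $|k|$ and the multiplier another $|k|$: together exactly the
$H^1$ norm squared, since $|k|(\alpha+\gamma|k|)\le(\alpha+\gamma)(1+|k|^2)$. -/
theorem sum_mult_damping_le (hγ : 0 ≤ γ) (hα : 0 ≤ α) {w z : L2} {E : ℝ} (hE : 0 ≤ E)
    (h : energyNorm w z ≤ ENNReal.ofReal E) (n : ℕ) (S : Finset (Fin 3 → ℤ)) :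
    vol * ∑ k ∈ S, mult n k * ((α + γ * Real.sqrt (eig k)) / 2 * pairing k w w)
      ≤ 9 * (α + γ) * E ^ 2 := by
  have h1 := sum_weight_le hE h S
  have h3 : ∑ k ∈ S, mult n k * ((α + γ * Real.sqrt (eig k)) / 2 * pairing k w w)
      ≤ 9 * (α + γ) * ∑ k ∈ S, (1 + eig k) * ‖coeff w k‖ ^ 2 := by
    rw [Finset.mul_sum]
    refine Finset.sum_le_sum fun k _ => ?_
    rw [pairing_self, ← mul_assoc, ← mul_assoc]
    refine mul_le_mul_of_nonneg_right ?_ (sq_nonneg _)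
    have h4 := mult_le n k
    have h5 := sqrt_eig_le k
    have h6 := Real.sq_sqrt (eig_nonneg k)
    have h7 := Real.sqrt_nonneg (eig k)
    have h8 : 0 ≤ (α + γ * Real.sqrt (eig k)) / 2 := by positivity
    calc mult n k * ((α + γ * Real.sqrt (eig k)) / 2)
        ≤ 18 * Real.sqrt (eig k) * ((α + γ * Real.sqrt (eig k)) / 2) := by gcongr
      _ = 9 * (α * Real.sqrt (eig k) + γ * Real.sqrt (eig k) ^ 2) := by ring
      _ ≤ 9 * (α * (1 + eig k) + γ * (1 + eig k)) := by
          rw [h6]; gcongr; linarith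
      _ = _ := by ring
  have := mul_le_mul_of_nonneg_left h3 vol_pos.le
  have h9 : 9 * (α + γ) * (vol * ∑ k ∈ S, (1 + eig k) * ‖coeff w k‖ ^ 2)
      ≤ 9 * (α + γ) * E ^ 2 := by gcongr
  linarith

/-- The kinetic term carries one derivative on $|v_k|^2$, which is what the $L^2H^{1/2}$ bound on
$\partial_tu$ pays for. -/
theorem IsWeakEnergySolution.sum_mult_dissipation_le
    (sol : IsWeakEnergySolution γ α f g T u₀ u₁ u v) {τ σ a b D : ℝ}
    (hsubT : Set.Ioc a b ⊆ Set.Ioo 0 T) (hsub : Set.Ioc a b ⊆ Set.Ioo τ σ)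
    (hD : ∫⁻ t in Set.Ioo τ σ, sobNorm (1 / 2) (v t) ^ 2 ≤ ENNReal.ofReal (D ^ 2)) (n : ℕ)
    (S : Finset (Fin 3 → ℤ)) :
    vol * ∑ k ∈ S, mult n k * ∫ t in Set.Ioc a b, pairing k (v t) (v t) ≤ 18 * D ^ 2 := by
  have hi : ∀ k, IntegrableOn (fun t => pairing k (v t) (v t)) (Set.Ioc a b) :=
    fun k => (sol.bddMeas_pairing_vv k).integrableOn.mono_set hsubT
  have hnn : ∀ k, 0 ≤ ∫ t in Set.Ioc a b, pairing k (v t) (v t) := fun k =>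
    integral_nonneg fun t => by rw [pairing_self]; positivity
  have h1 : vol * ∑ k ∈ S, mult n k * ∫ t in Set.Ioc a b, pairing k (v t) (v t)
      ≤ 18 * (vol * ∑ k ∈ S, (1 + eig k) ^ (1 / 2 : ℝ) *
        ∫ t in Set.Ioc a b, pairing k (v t) (v t)) := by
    rw [mul_left_comm]
    refine mul_le_mul_of_nonneg_left ?_ vol_pos.le
    rw [Finset.mul_sum]
    refine Finset.sum_le_sum fun k _ => ?_
    rw [← mul_assoc]
    refine mul_le_mul_of_nonneg_right ((mult_le n k).trans ?_) (hnn k)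
    gcongr
    rw [← Real.sqrt_eq_rpow]
    exact Real.sqrt_le_sqrt (by linarith)
  refine h1.trans (mul_le_mul_of_nonneg_left ?_ (by norm_num))
  have e : vol * ∑ k ∈ S, (1 + eig k) ^ (1 / 2 : ℝ) * ∫ t in Set.Ioc a b, pairing k (v t) (v t)
      = ∫ t in Set.Ioc a b, vol * ∑ k ∈ S, (1 + eig k) ^ (1 / 2 : ℝ) * ‖coeff (v t) k‖ ^ 2 := by
    simp only [← pairing_self]
    rw [integral_const_mul, integral_finsetSum _ fun k _ => (hi k).const_mul _]
    simp only [integral_const_mul]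
  have hint : IntegrableOn (fun t => vol * ∑ k ∈ S, (1 + eig k) ^ (1 / 2 : ℝ) *
      ‖coeff (v t) k‖ ^ 2) (Set.Ioc a b) := by
    simp only [← pairing_self]
    exact (integrable_finsetSum _ fun k _ => (hi k).const_mul _).const_mul _
  rw [e, ← ENNReal.ofReal_le_ofReal_iff (sq_nonneg D),
    ofReal_integral_eq_lintegral_ofReal hint (Eventually.of_forall fun t => ?_)]
  · refine le_trans ?_ hD
    refine (lintegral_mono fun t => ofReal_sum_le_sobNorm_sq (1 / 2) (v t) S).trans ?_
    exact lintegral_mono_set hsub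
  · exact mul_nonneg vol_pos.le (Finset.sum_nonneg fun k _ => by
      have := eig_nonneg k; positivity)

end Estimate

/-! ### The $H^{3/2}$ estimate -/

section Regularity

variable {γ α T : ℝ} {f : ℝ → ℝ} {g u₀ u₁ : L2} {u v : ℝ → L2}

theorem QuinticGrowth.add_const_mul {A K : ℝ} {f : ℝ → ℝ} (hf : QuinticGrowth A f) (hK : 0 ≤ K) :
    QuinticGrowth (A + K) fun s => f s + K * s := by
  intro s
  have h1 : |s| ≤ 1 + |s| ^ 5 := by
    rcases le_total |s| 1 with h | h
    · have := pow_nonneg (abs_nonneg s) 5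
      linarith
    · have := pow_le_pow_right₀ h (show 1 ≤ 5 by norm_num)
      rw [pow_one] at this
      linarith
  calc |f s + K * s| ≤ |f s| + K * |s| := by
        refine (abs_add_le _ _).trans ?_
        rw [abs_mul, abs_of_nonneg hK]
    _ ≤ A * (1 + |s| ^ 5) + K * (1 + |s| ^ 5) := by gcongr; exact hf s
    _ = _ := by ring

theorem pairing_add_const_mul {h : Torus → ℝ} (hh : Integrable h) (K : ℝ) (w : L2)
    (k : Fin 3 → ℤ) :
    pairing k (fun x => h x + K * w x) w = pairing k h w + K * pairing k w w := by
  simp only [pairing]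
  rw [coeff_add hh ((integrable_L2 w).const_mul K), coeff_const_mul, add_mul, Complex.add_re,
    mul_assoc, Complex.re_ofReal_mul]

theorem IsWeakEnergySolution.integral_pairing_shift
    (sol : IsWeakEnergySolution γ α f g T u₀ u₁ u v) {A K : ℝ} (hA : 0 ≤ A)
    (hd : ContDiff ℝ 1 f) (hg : QuinticGrowth A f) {a b : ℝ}
    (hsub : Set.Ioc a b ⊆ Set.Ioo 0 T) (k : Fin 3 → ℤ) :
    ∫ t in Set.Ioc a b, pairing k (fun x => f (u t x) + K * u t x) (u t) =
      (∫ t in Set.Ioc a b, pairing k (fun x => f (u t x)) (u t)) +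
        K * ∫ t in Set.Ioc a b, pairing k (u t) (u t) := by
  rw [← integral_const_mul, ← integral_add
    ((sol.bddMeas_pairing_comp hA hd hg k).integrableOn.mono_set hsub)
    (((sol.bddMeas_pairing_uu k).integrableOn.mono_set hsub).const_mul K)]
  refine integral_congr_ae ?_
  filter_upwards [ae_mono (Measure.restrict_mono hsub le_rfl) sol.ae_sobNorm] with t ht
  exact pairing_add_const_mul
    ((memLp_comp hA hd.continuous hg ht).integrable one_le_six_fifths) K (u t) k

theorem sum_mult_integral_le
    {τ σ a b c : ℝ}
    {P : (Fin 3 → ℤ) → ℝ → ℝ} (hP : ∀ k, BddMeas T (P k)) (hab : a ≤ b)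
    (hsubT : Set.Ioc a b ⊆ Set.Ioo 0 T) (hsub : Set.Ioc a b ⊆ Set.Ioo τ σ) (n : ℕ)
    (S : Finset (Fin 3 → ℤ))
    (h : ∀ᵐ t ∂volume.restrict (Set.Ioo τ σ), vol * ∑ k ∈ S, mult n k * P k t ≤ c) :
    vol * ∑ k ∈ S, mult n k * ∫ t in Set.Ioc a b, P k t ≤ c * (b - a) := by
  have e : vol * ∑ k ∈ S, mult n k * ∫ t in Set.Ioc a b, P k t =
      ∫ t in Set.Ioc a b, vol * ∑ k ∈ S, mult n k * P k t := by
    rw [integral_const_mul, integral_finsetSum _ fun k _ =>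
      ((hP k).integrableOn.mono_set hsubT).const_mul _]
    simp only [integral_const_mul]
  rw [e]
  exact integral_Ioc_le ((BddMeas.sum S fun k => (hP k).const_mul (mult n k)).const_mul vol) hab
    hsubT hsub h

/-- The bound for `∫ (-Δ u, |D| u)` furnished by testing the equation with `|D| u`. -/
def multBound (γ α K ℓ E D N : ℝ) : ℝ :=
  (18 + 9 * (α + γ) + (18 * K + 9) * ℓ) * E ^ 2 + 18 * D ^ 2 + 9 * ℓ * N ^ 2

/-- The modal identities, weighted by the multiplier and summed, with $K\int|u_k|^2$ added to both
sides so that the nonlinear term becomes that of the monotone function $f(s)+Ks$. The right side is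
bounded uniformly in $n$ and in the set of modes: $9E^2$ from each endpoint pairing of $\partial_tu$
with $u$, $9(\alpha+\gamma)E^2$ from the damping at $a$, $18D^2$ from the kinetic term, and the
source and the shift by $K$ in proportion to the length of the interval. -/
theorem IsWeakEnergySolution.sum_mult_le (sol : IsWeakEnergySolution γ α f g T u₀ u₁ u v)
    (hT : 0 < T) (hγ : 0 ≤ γ) (hα : 0 ≤ α) {A K : ℝ} (hA : 0 ≤ A) (hK : 0 ≤ K)
    (hd : ContDiff ℝ 1 f) (hg : QuinticGrowth A f) (hm : Monotone fun s => f s + K * s)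
    {τ σ E D : ℝ} (hτ : 0 ≤ τ) (hσ : σ ≤ T) (hE : 0 ≤ E)
    (hen : ∀ᵐ t ∂volume.restrict (Set.Ioo τ σ), energyNorm (u t) (v t) ≤ ENNReal.ofReal E)
    (hD : ∫⁻ t in Set.Ioo τ σ, sobNorm (1 / 2) (v t) ^ 2 ≤ ENNReal.ofReal (D ^ 2)) :
    ∃ G : Set ℝ, (∀ᵐ t ∂volume.restrict (Set.Ioo τ σ), t ∈ G) ∧ ∀ a ∈ G, ∀ b ∈ G, a ≤ b →
      ∀ (n : ℕ) (S : Finset (Fin 3 → ℤ)),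
        vol * ∑ k ∈ S, mult n k * (eig k * ∫ t in Set.Ioc a b, pairing k (u t) (u t)) ≤
          multBound γ α K (σ - τ) E D ‖g‖ := by
  choose Γ hΓ hid using fun k => sol.coeff_identity hT hA hd hg k
  have hsub0 : Set.Ioo τ σ ⊆ Set.Ioo 0 T := Set.Ioo_subset_Ioo hτ hσ
  -- There are countably many modes, so one set of full measure serves them all.
  refine ⟨{t | (∀ k, t ∈ Γ k) ∧ energyNorm (u t) (v t) ≤ ENNReal.ofReal E ∧ t ∈ Set.Ioo τ σ},
    ?_, ?_⟩
  · filter_upwards [ae_mono (Measure.restrict_mono hsub0 le_rfl) (ae_all_iff.2 hΓ), hen,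
      ae_restrict_mem measurableSet_Ioo] with t h1 h2 h3
    exact ⟨h1, h2, h3⟩
  rintro a ⟨ha, hea, haI⟩ b ⟨hb, heb, hbI⟩ hab n S₀
  have hsub : Set.Ioc a b ⊆ Set.Ioo τ σ := fun t ht =>
    ⟨haI.1.trans ht.1, ht.2.trans_lt hbI.2⟩
  have hsubT : Set.Ioc a b ⊆ Set.Ioo 0 T := hsub.trans hsub0
  have hba : b - a ≤ σ - τ := by have := haI.1; have := hbI.2; linarith
  obtain ⟨L, hL0, hL⟩ := sol.tendsto_nonlinear (add_nonneg hA hK)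
    (hd.add (contDiff_const.mul contDiff_id)) (hg.add_const_mul hK) hm hsubT n
  have key : ∀ S, vol * ∑ k ∈ S, mult n k * (eig k * ∫ t in Set.Ioc a b, pairing k (u t) (u t)) +
      vol * ∑ k ∈ S, mult n k *
        ∫ t in Set.Ioc a b, pairing k (fun x => f (u t x) + K * u t x) (u t) ≤
      multBound γ α K (σ - τ) E D ‖g‖ := by
    intro S
    have e : ∀ k ∈ S, mult n k * (eig k * ∫ t in Set.Ioc a b, pairing k (u t) (u t)) +
        mult n k * ∫ t in Set.Ioc a b, pairing k (fun x => f (u t x) + K * u t x) (u t) ≤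
        mult n k * |pairing k (v b) (u b)| + mult n k * |pairing k (v a) (u a)| +
        mult n k * ((α + γ * Real.sqrt (eig k)) / 2 * pairing k (u a) (u a)) +
        mult n k * (∫ t in Set.Ioc a b, pairing k (v t) (v t)) +
        mult n k * (∫ t in Set.Ioc a b, pairing k g (u t)) +
        K * (mult n k * ∫ t in Set.Ioc a b, pairing k (u t) (u t)) := by
      intro k _
      have h1 := hid k a (ha k) b (hb k) hab
      rw [sol.integral_pairing_shift hA hd hg hsubT k]
      have h2 := neg_abs_le (pairing k (v b) (u b))
      have h3 := le_abs_self (pairing k (v a) (u a))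
      -- The damping term at the final time has the favourable sign and is discarded.
      have h4 : 0 ≤ (α + γ * Real.sqrt (eig k)) / 2 * pairing k (u b) (u b) := by
        rw [pairing_self]; positivity
      have h5 := mult_nonneg n k
      rw [← mul_add, mul_left_comm K, ← mul_add, ← mul_add, ← mul_add, ← mul_add, ← mul_add]
      refine mul_le_mul_of_nonneg_left ?_ h5
      linarith
    have h0 := Finset.sum_le_sum e
    simp only [Finset.sum_add_distrib, ← Finset.mul_sum S _ K] at h0
    have h1 := sum_mult_pairing_le hE heb n S
    have h2 := sum_mult_pairing_le hE hea n S
    have h3 := sum_mult_damping_le hγ hα hE hea n S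
    have h4 := sol.sum_mult_dissipation_le hsubT hsub hD n S
    have h5 := sum_mult_integral_le (τ := τ) (σ := σ) sol.bddMeas_pairing_gu hab hsubT hsub n S
      (hen.mono fun t ht => sum_mult_source_le (g := g) hE ht n S)
    have h6 := sum_mult_integral_le (τ := τ) (σ := σ) sol.bddMeas_pairing_uu hab hsubT hsub n S
      (hen.mono fun t ht => sum_mult_sq_le hE ht n S)
    have h7 : 9 * (E ^ 2 + ‖g‖ ^ 2) * (b - a) ≤ 9 * (E ^ 2 + ‖g‖ ^ 2) * (σ - τ) := by gcongr
    have h8 : 18 * E ^ 2 * (b - a) ≤ 18 * E ^ 2 * (σ - τ) := by gcongr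
    have h9 := mul_le_mul_of_nonneg_left h0 vol_pos.le
    have h10 := mul_le_mul_of_nonneg_left (h6.trans h8) hK
    unfold multBound
    linarith
  have hlim := (hL.const_mul vol).const_add
    (vol * ∑ k ∈ S₀, mult n k * (eig k * ∫ t in Set.Ioc a b, pairing k (u t) (u t)))
  have h1 : vol * ∑ k ∈ S₀, mult n k * (eig k * ∫ t in Set.Ioc a b, pairing k (u t) (u t)) +
      vol * L ≤ multBound γ α K (σ - τ) E D ‖g‖ := by
    -- The modes of $S_0$ are kept fixed while $S\supseteq S_0$ grows in the nonlinear sum. The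
    -- quadratic terms are nonnegative, so those over $S_0$ are dominated by those over $S$. The
    -- limit $L\ge0$ is then dropped.
    refine le_of_tendsto hlim ?_
    filter_upwards [eventually_ge_atTop S₀] with S hS
    refine le_trans (add_le_add_left (mul_le_mul_of_nonneg_left
      (Finset.sum_le_sum_of_subset_of_nonneg hS fun k _ _ => ?_) vol_pos.le) _) (key S)
    have h2 : 0 ≤ ∫ t in Set.Ioc a b, pairing k (u t) (u t) :=
      integral_nonneg fun t => by rw [pairing_self]; positivity
    exact mul_nonneg (mult_nonneg n k) (mul_nonneg (eig_nonneg k) h2)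
  have := mul_nonneg vol_pos.le hL0
  linarith

theorem rpow_three_halves_le {e : ℝ} (he : 0 ≤ e) :
    (1 + e) ^ (3 / 2 : ℝ) ≤ 3 * (1 + e) + 3 * (Real.sqrt e * e) := by
  have h1 : (1 + e) ^ (3 / 2 : ℝ) = (1 + e) * Real.sqrt (1 + e) := by
    rw [Real.sqrt_eq_rpow, show (3 / 2 : ℝ) = 1 + 1 / 2 by norm_num,
      Real.rpow_add (by linarith), Real.rpow_one]
  have h2 : Real.sqrt (1 + e) ≤ 1 + Real.sqrt e := by
    rw [Real.sqrt_le_left (by positivity)]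
    nlinarith [Real.sq_sqrt he, Real.sqrt_nonneg e]
  rw [h1]
  have h3 := mul_le_mul_of_nonneg_left h2 (by linarith : 0 ≤ 1 + e)
  have h4 : Real.sqrt e ≤ 1 + e := by
    nlinarith [Real.sq_sqrt he, sq_nonneg (Real.sqrt e - 1), Real.sqrt_nonneg e]
  have h5 := mul_nonneg (Real.sqrt_nonneg e) he
  nlinarith

/-- By monotone convergence it suffices to bound finite sums of modes. There
$(1+|k|^2)^{3/2}\le3(1+|k|^2)+3|k|^3$; the first part is energy, and the second is at most $18$
times the multiplier times $|k|^2$. -/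
theorem IsWeakEnergySolution.lintegral_sobNorm_Ioc_le
    (sol : IsWeakEnergySolution γ α f g T u₀ u₁ u v) {τ σ a b E B : ℝ} (hE : 0 ≤ E)
    (hab : a ≤ b)
    (hsubT : Set.Ioc a b ⊆ Set.Ioo 0 T) (hsub : Set.Ioc a b ⊆ Set.Ioo τ σ) (hba : b - a ≤ σ - τ)
    (hen : ∀ᵐ t ∂volume.restrict (Set.Ioo τ σ), energyNorm (u t) (v t) ≤ ENNReal.ofReal E)
    (hB : ∀ (n : ℕ) (S : Finset (Fin 3 → ℤ)),
      vol * ∑ k ∈ S, mult n k * (eig k * ∫ t in Set.Ioc a b, pairing k (u t) (u t)) ≤ B) :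
    ∫⁻ t in Set.Ioc a b, sobNorm (3 / 2) (u t) ^ 2 ≤
      ENNReal.ofReal (3 * E ^ 2 * (σ - τ) + 18 * B) := by
  have hi : ∀ k, IntegrableOn (fun t => pairing k (u t) (u t)) (Set.Ioc a b) :=
    fun k => (sol.bddMeas_pairing_uu k).integrableOn.mono_set hsubT
  have hnn : ∀ k, 0 ≤ ∫ t in Set.Ioc a b, pairing k (u t) (u t) := fun k =>
    integral_nonneg fun t => by rw [pairing_self]; positivity
  have hw : ∀ k, 0 ≤ (1 + eig k) ^ (3 / 2 : ℝ) := fun k => by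
    have := eig_nonneg k; positivity
  have e : ∀ k, ∫⁻ t in Set.Ioc a b, ENNReal.ofReal ((1 + eig k) ^ (3 / 2 : ℝ) *
      ‖coeff (u t) k‖ ^ 2) = ENNReal.ofReal ((1 + eig k) ^ (3 / 2 : ℝ) *
        ∫ t in Set.Ioc a b, pairing k (u t) (u t)) := by
    intro k
    simp only [← pairing_self]
    rw [← integral_const_mul, ofReal_integral_eq_lintegral_ofReal ((hi k).const_mul _)]
    exact Eventually.of_forall fun t => by
      simp only [pairing_self, Pi.zero_apply]
      exact mul_nonneg (hw k) (sq_nonneg _)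
  simp only [sobNorm_sq]
  rw [lintegral_const_mul' _ _ ENNReal.ofReal_ne_top, lintegral_tsum fun k => ?_]
  · simp only [e]
    rw [ENNReal.tsum_eq_iSup_sum, ENNReal.mul_iSup]
    refine iSup_le fun S => ?_
    rw [← ENNReal.ofReal_sum_of_nonneg fun k _ => mul_nonneg (hw k) (hnn k),
      ← ENNReal.ofReal_mul vol_pos.le]
    refine ENNReal.ofReal_le_ofReal ?_
    -- The number of scales is chosen after the finite set of modes, which is allowed because $B$
    -- does not depend on $n$.
    obtain ⟨n, hn⟩ : ∃ n : ℕ, ∀ k ∈ S, ∀ i, (k i).natAbs < n := by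
      refine ⟨S.sup (fun k => ∑ i, (k i).natAbs) + 1, fun k hk i => Nat.lt_succ_of_le ?_⟩
      exact (Finset.single_le_sum (f := fun j => (k j).natAbs) (fun _ _ => Nat.zero_le _)
        (Finset.mem_univ i)).trans (Finset.le_sup (f := fun k : Fin 3 → ℤ => ∑ i, (k i).natAbs) hk)
    have h1 : ∑ k ∈ S, (1 + eig k) ^ (3 / 2 : ℝ) * ∫ t in Set.Ioc a b, pairing k (u t) (u t) ≤
        ∑ k ∈ S, (3 * ((1 + eig k) * ∫ t in Set.Ioc a b, pairing k (u t) (u t)) +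
          18 * (mult n k * (eig k * ∫ t in Set.Ioc a b, pairing k (u t) (u t)))) := by
      refine Finset.sum_le_sum fun k hk => ?_
      have h2 := rpow_three_halves_le (eig_nonneg k)
      have h3 := mul_le_mul_of_nonneg_right (le_mult (hn k hk)) (eig_nonneg k)
      have h4 := mul_le_mul_of_nonneg_right (show (1 + eig k) ^ (3 / 2 : ℝ) ≤
        3 * (1 + eig k) + 18 * (mult n k * eig k) by linarith) (hnn k)
      linarith
    rw [Finset.sum_add_distrib, ← Finset.mul_sum, ← Finset.mul_sum] at h1
    have h5 : vol * ∑ k ∈ S, (1 + eig k) * ∫ t in Set.Ioc a b, pairing k (u t) (u t) ≤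
        E ^ 2 * (σ - τ) := by
      have e2 : vol * ∑ k ∈ S, (1 + eig k) * ∫ t in Set.Ioc a b, pairing k (u t) (u t) =
          ∫ t in Set.Ioc a b, vol * ∑ k ∈ S, (1 + eig k) * pairing k (u t) (u t) := by
        rw [integral_const_mul, integral_finsetSum _ fun k _ => (hi k).const_mul _]
        simp only [integral_const_mul]
      rw [e2]
      refine (integral_Ioc_le ((BddMeas.sum S fun k => (sol.bddMeas_pairing_uu k).const_mul
        (1 + eig k)).const_mul vol) hab hsubT hsub (c := E ^ 2) ?_).trans (by gcongr)
      filter_upwards [hen] with t ht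
      simp only [pairing_self]
      exact sum_weight_le hE ht S
    have h6 := mul_le_mul_of_nonneg_left h1 vol_pos.le
    have h7 := hB n S
    linarith
  · refine ((AEStronglyMeasurable.aemeasurable ?_).const_mul _).ennreal_ofReal
    simp only [← pairing_self]
    exact (hi k).1

theorem aemeasurable_sobNorm_sq {μ : Measure ℝ} (hu : AEStronglyMeasurable u μ) (s : ℝ) :
    AEMeasurable (fun t => sobNorm s (u t) ^ 2) μ := by
  simp only [sobNorm_sq]
  refine AEMeasurable.const_mul (AEMeasurable.tsum fun k => ?_) _
  exact ((((continuous_coeff k).comp_aestronglyMeasurable hu).norm.aemeasurable.pow_const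
    2).const_mul _).ennreal_ofReal

/-- A set of full measure is dense, so good endpoints can be chosen tending to $\tau$ and $\sigma$,
and the integrals over the exhausting intervals converge. -/
theorem lintegral_Ioo_le_of_dense {F : ℝ → ℝ≥0∞} {τ σ : ℝ} (hτσ : τ < σ) {c : ℝ≥0∞}
    (hF : AEMeasurable F (volume.restrict (Set.Ioo τ σ))) {G : Set ℝ}
    (hG : ∀ᵐ t ∂volume.restrict (Set.Ioo τ σ), t ∈ G)
    (h : ∀ a ∈ G, ∀ b ∈ G, a ≤ b → τ < a → b < σ → ∫⁻ t in Set.Ioc a b, F t ≤ c) :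
    ∫⁻ t in Set.Ioo τ σ, F t ≤ c := by
  have hdense : Dense {t | t ∈ Set.Ioo τ σ → t ∈ G} :=
    Measure.dense_of_ae ((ae_restrict_iff' measurableSet_Ioo).1 hG)
  have hmid : (τ + σ) / 2 ∈ Set.Ioo τ σ := ⟨by linarith, by linarith⟩
  obtain ⟨x, -, hx, hxlim⟩ := exists_seq_strictAnti_tendsto' hmid.1
  obtain ⟨y, -, hy, hylim⟩ := exists_seq_strictMono_tendsto' hmid.2
  choose a haG ha using fun n => hdense.exists_between (hx n).1
  choose b hbG hb using fun n => hdense.exists_between (hy n).2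
  have halim : Tendsto a atTop (𝓝 τ) := tendsto_of_tendsto_of_tendsto_of_le_of_le
    tendsto_const_nhds hxlim (fun n => (ha n).1.le) fun n => (ha n).2.le
  have hblim : Tendsto b atTop (𝓝 σ) := tendsto_of_tendsto_of_tendsto_of_le_of_le
    hylim tendsto_const_nhds (fun n => (hb n).1.le) fun n => (hb n).2.le
  refine le_of_tendsto' ((aecover_Ioo_of_Ioc halim hblim).lintegral_tendsto_of_countably_generated
    hF) fun n => ?_
  have h1 : a n < (τ + σ) / 2 := (ha n).2.trans (hx n).2
  have h2 : (τ + σ) / 2 < b n := (hy n).1.trans (hb n).1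
  rw [Measure.restrict_restrict measurableSet_Ioc]
  refine (lintegral_mono_set Set.inter_subset_left).trans (h _ (haG n ⟨(ha n).1, ?_⟩) _
    (hbG n ⟨?_, (hb n).2⟩) (h1.trans h2).le (ha n).1 (hb n).2)
  · exact h1.trans hmid.2
  · exact hmid.1.trans h2

theorem IsWeakEnergySolution.lintegral_sobNorm_Ioo_le
    (sol : IsWeakEnergySolution γ α f g T u₀ u₁ u v)
    (hT : 0 < T) (hγ : 0 ≤ γ) (hα : 0 ≤ α) {A K : ℝ} (hA : 0 ≤ A) (hK : 0 ≤ K)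
    (hd : ContDiff ℝ 1 f) (hg : QuinticGrowth A f) (hm : Monotone fun s => f s + K * s)
    {τ σ E D : ℝ} (hτ : 0 ≤ τ) (hτσ : τ < σ) (hσ : σ ≤ T) (hE : 0 ≤ E)
    (hen : ∀ᵐ t ∂volume.restrict (Set.Ioo τ σ), energyNorm (u t) (v t) ≤ ENNReal.ofReal E)
    (hD : ∫⁻ t in Set.Ioo τ σ, sobNorm (1 / 2) (v t) ^ 2 ≤ ENNReal.ofReal (D ^ 2)) :
    ∫⁻ t in Set.Ioo τ σ, sobNorm (3 / 2) (u t) ^ 2 ≤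
      ENNReal.ofReal (3 * E ^ 2 * (σ - τ) + 18 * multBound γ α K (σ - τ) E D ‖g‖) := by
  obtain ⟨G, hG, hGb⟩ := sol.sum_mult_le hT hγ hα hA hK hd hg hm hτ hσ hE hen hD
  have hsub0 : Set.Ioo τ σ ⊆ Set.Ioo 0 T := Set.Ioo_subset_Ioo hτ hσ
  refine lintegral_Ioo_le_of_dense hτσ (aemeasurable_sobNorm_sq
    (sol.measurable_u.mono_measure (Measure.restrict_mono hsub0 le_rfl)) _) hG
    fun a ha b hb hab h1 h2 => ?_
  have hsub : Set.Ioc a b ⊆ Set.Ioo τ σ := fun t ht => ⟨h1.trans ht.1, ht.2.trans_lt h2⟩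
  exact sol.lintegral_sobNorm_Ioc_le hE hab (hsub.trans hsub0) hsub (by linarith) hen
    (hGb a ha b hb hab)

theorem sq_normL2Sob (s a b : ℝ) (w : ℝ → L2) :
    normL2Sob s a b w ^ 2 = ∫⁻ t in Set.Ioo a b, sobNorm s (w t) ^ 2 := by
  rw [normL2Sob, ← ENNReal.rpow_natCast, ← ENNReal.rpow_mul]; simp

theorem normL2Sob_mono {s a b c d : ℝ} (h : Set.Ioo a b ⊆ Set.Ioo c d) (w : ℝ → L2) :
    normL2Sob s a b w ≤ normL2Sob s c d w :=
  ENNReal.rpow_le_rpow (lintegral_mono_set h) (by norm_num)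

theorem normLinftyEnergy_mono {a b c d : ℝ} (h : Set.Ioo a b ⊆ Set.Ioo c d) (w z : ℝ → L2) :
    normLinftyEnergy a b w z ≤ normLinftyEnergy c d w z :=
  essSup_mono_measure (Measure.absolutelyContinuous_of_le (Measure.restrict_mono h le_rfl))

theorem IsWeakEnergySolution.sq_normL2Sob_le
    (sol : IsWeakEnergySolution γ α f g T u₀ u₁ u v)
    (hT : 0 < T) (hγ : 0 ≤ γ) (hα : 0 ≤ α) {A K : ℝ} (hA : 0 ≤ A) (hK : 0 ≤ K)
    (hd : ContDiff ℝ 1 f) (hg : QuinticGrowth A f) (hm : Monotone fun s => f s + K * s)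
    {τ σ : ℝ} (hτ : 0 ≤ τ) (hτσ : τ < σ) (hσ : σ ≤ T) :
    normL2Sob (3 / 2) τ σ u ^ 2 ≤ ENNReal.ofReal
      (3 * (normLinftyEnergy τ σ u v).toReal ^ 2 * (σ - τ) + 18 * multBound γ α K (σ - τ)
        (normLinftyEnergy τ σ u v).toReal (normL2Sob (1 / 2) τ σ v).toReal ‖g‖) := by
  have hsub : Set.Ioo τ σ ⊆ Set.Ioo 0 T := Set.Ioo_subset_Ioo hτ hσ
  have h1 : normLinftyEnergy τ σ u v ≠ ⊤ :=
    ((normLinftyEnergy_mono hsub u v).trans_lt sol.energy).ne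
  have h2 : normL2Sob (1 / 2) τ σ v ≠ ⊤ :=
    ((normL2Sob_mono hsub v).trans_lt sol.dissipation.2).ne
  rw [sq_normL2Sob]
  refine sol.lintegral_sobNorm_Ioo_le hT hγ hα hA hK hd hg hm hτ hτσ hσ ENNReal.toReal_nonneg
    ?_ ?_
  · rw [ENNReal.ofReal_toReal h1]
    exact ENNReal.ae_le_essSup _
  · rw [ENNReal.ofReal_pow ENNReal.toReal_nonneg, ENNReal.ofReal_toReal h2, sq_normL2Sob]

end Regularity

end QuinticWave

end

/-! ### The main estimate with a linear function $Q$ -/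

theorem theorem2p2 (γ α C κ K : ℝ) (hγ : 0 < γ) (hα : 0 < α) (hC : 0 < C) (hκ : 0 < κ)
    (hK : 0 < K) (f : ℝ → ℝ) (hf : QuinticWave.Nonlinearity C κ K f) :
    ∃ Q : ℝ≥0 → ℝ≥0, Monotone Q ∧
      ∀ (g u₀ u₁ : QuinticWave.L2) (T : ℝ) (u v : ℝ → QuinticWave.L2), 0 < T →
        QuinticWave.IsWeakEnergySolution γ α f g T u₀ u₁ u v →
        QuinticWave.MemL2Sob (3 / 2) 0 T u ∧
        ∀ τ : ℝ, 0 ≤ τ → τ + 1 ≤ T →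
          QuinticWave.normL2Sob (3 / 2) τ (τ + 1) u ≤
            Q (QuinticWave.normLinftyEnergy τ (τ + 1) u v
                + QuinticWave.normL2Sob (1 / 2) τ (τ + 1) v + ‖g‖ₑ).toNNReal := by
  have hA : 0 ≤ |f 0| + 2 * C := by positivity
  -- $M^2$ adds the coefficients, on an interval of length one, of $E^2$, of $D^2$ ($18\cdot18=324$)
  -- and of $\|g\|^2$ ($18\cdot9=162$). Each of $E,D,\|g\|$ is at most their sum $r$, so $Q(r)=Mr$
  -- works.
  set M : ℝ≥0 := NNReal.sqrt (Real.toNNReal (3 + 18 * (18 + 9 * (α + γ) + (18 * K + 9)) +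
    324 + 162)) with hM
  refine ⟨fun r => M * r, fun r s h => mul_le_mul_right h M, fun g u₀ u₁ T u v hT sol => ⟨⟨sol.measurable_u,
    ?_⟩, fun τ hτ hτT => ?_⟩⟩
  -- Membership is the same estimate on the whole interval $(0,T)$; its bound may grow with $T$, but
  -- only finiteness is needed.
  · have h := sol.sq_normL2Sob_le hT hγ.le hα.le hA hK.le hf.contDiff (hf.quinticGrowth hC)
      hf.monotone le_rfl hT le_rfl
    have h2 := h.trans_lt ENNReal.ofReal_lt_top
    exact (ENNReal.pow_lt_top_iff (n := 2)).1 h2 |>.resolve_right (by norm_num)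
  · have h := sol.sq_normL2Sob_le hT hγ.le hα.le hA hK.le hf.contDiff (hf.quinticGrowth hC)
      hf.monotone hτ (lt_add_one τ) hτT
    have hsub : Set.Ioo τ (τ + 1) ⊆ Set.Ioo 0 T := Set.Ioo_subset_Ioo hτ hτT
    have h1 : QuinticWave.normLinftyEnergy τ (τ + 1) u v ≠ ⊤ :=
      ((QuinticWave.normLinftyEnergy_mono hsub u v).trans_lt sol.energy).ne
    have h2 : QuinticWave.normL2Sob (1 / 2) τ (τ + 1) v ≠ ⊤ :=
      ((QuinticWave.normL2Sob_mono hsub v).trans_lt sol.dissipation.2).ne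
    set E := (QuinticWave.normLinftyEnergy τ (τ + 1) u v).toReal
    set D := (QuinticWave.normL2Sob (1 / 2) τ (τ + 1) v).toReal
    have hE : 0 ≤ E := ENNReal.toReal_nonneg
    have hD : 0 ≤ D := ENNReal.toReal_nonneg
    have hN := norm_nonneg g
    have hM2 : (M : ℝ) ^ 2 = 3 + 18 * (18 + 9 * (α + γ) + (18 * K + 9)) + 324 + 162 := by
      rw [hM, ← NNReal.coe_pow, NNReal.sq_sqrt, Real.coe_toNNReal _ (by positivity)]
    have hsum : ((QuinticWave.normLinftyEnergy τ (τ + 1) u v +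
        QuinticWave.normL2Sob (1 / 2) τ (τ + 1) v + ‖g‖ₑ).toNNReal : ℝ) = E + D + ‖g‖ := by
      rw [ENNReal.coe_toNNReal_eq_toReal, ENNReal.toReal_add (ENNReal.add_ne_top.2 ⟨h1, h2⟩)
        enorm_ne_top, ENNReal.toReal_add h1 h2, toReal_enorm]
    refine (ENNReal.pow_le_pow_left_iff (n := 2) (by norm_num)).1 (h.trans ?_)
    rw [← ENNReal.ofReal_coe_nnreal, ← ENNReal.ofReal_pow (NNReal.coe_nonneg _)]
    refine ENNReal.ofReal_le_ofReal ?_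
    rw [NNReal.coe_mul, hsum, mul_pow, hM2, QuinticWave.multBound]
    have hX : E ^ 2 ≤ (E + D + ‖g‖) ^ 2 := by gcongr; linarith
    have hY : D ^ 2 ≤ (E + D + ‖g‖) ^ 2 := by gcongr; linarith
    have hZ : ‖g‖ ^ 2 ≤ (E + D + ‖g‖) ^ 2 := by gcongr; linarith
    have hX' : (3 + 18 * (18 + 9 * (α + γ) + (18 * K + 9))) * E ^ 2 ≤
        (3 + 18 * (18 + 9 * (α + γ) + (18 * K + 9))) * (E + D + ‖g‖) ^ 2 := by gcongr
    rw [add_sub_cancel_left]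
    linarith
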